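/- **Setting.** Fix a finite set of one- and two-qubit unitary gates that is closed under inverses and contains $H$, $S$, $\mathrm{CNOT}$ (which generate the Clifford group) and $T$. A (brickwork) layer on $n$ qubits in a line has a parity $r\in\{0,1\}$ and puts on each of the disjoint pairs of neighbours $(r+2j,\,r+2j+1)$ either one two-qubit gate of the set (in one of the two orientations) or at most one one-qubit gate on each of the two qubits. Let $d=d(n)=\lfloor\log_2 n\rfloor^2$ and let $\mathscr C_n$ be the finite set of $n$-qubit circuits of $d$ layers with alternating parities. For a circuit $C$ let $|C\rangle=C|0^n\rangle$. A quantum polynomial-time (QPT) algorithm is a polynomial-time uniform family of polynomial-size circuits over the gate set, with ancillas initialized to $|0\rangle$, whose output register is measured in the standard basis. *$\varepsilon$-No-Learning assumption*: for every polynomial $q$ and every QPT algorithm $A$, for all sufficiently large $n$, $$\Pr\big[D\in\mathscr C_n \text{ and } |\langle C|D\rangle|^2\ge\varepsilon(n)\;:\;C\leftarrow\mathscr C_n \text{ uniform},\ D\leftarrow A(|C\rangle^{\otimes q(n)})\big]\le\varepsilon(n).$$ *Noise model $\mathcal N$*: for every $n$, initialization of $n$ qubits, every layer on $n$ qubits,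 and measurement (before an ideal measurement) are accompanied or replaced by quantum channels; a circuit is executed by composing the channels of its layers, and operations on separate blocks of $n$ qubits experience independent noise (tensor products of channels). The fidelity of running a circuit $L$ is $\langle L|\rho|L\rangle$, where $\rho$ is the state that enters the final ideal measurement when $L$ is run on a noisy initialized register. *Signature scheme with parameters $t=t(n)\in\mathbb N$, $k=k(n)\in\mathbb R$, for one-bit messages.* $\mathrm{SKGen}$: sample $\mathrm{sk}=(C^{(b)}_j)_{b\in\{0,1\},j\in[t]}$ independently and uniformly from $\mathscr C_n$. $\mathrm{PKGen}$: output $|\mathrm{pk}\rangle=\bigotimes_{b}\bigotimes_{j}|C_j^{(b)}\rangle$. $\mathrm{Sign}(\mathrm{sk},m)$: output the classical descriptions of $(C_1^{(m)},\dots,C_t^{(m)})$. $\mathrm{Ver}(|\mathrm{pk}\rangle,m,\sigma)$: interpret $\sigma$ as descriptions of $D_1,\dots,D_t\in\mathscr C_n$; for each $j$ apply $D_j^\dagger$ to the block of $|C_j^{(m)}\rangle$ and measure it; set $E_j=1$ if $D_j$ is a valid description and the result is $0^n$, and $E_j=0$ otherwise; accept iff $E_1+\dots+E_t\ge k$. Write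 $\widetilde{\mathrm{PKGen}}$, $\widetilde{\mathrm{Ver}}$ for these algorithms run on a device with noise model $\mathcal N$. **Lemma (NISQ-friendly digital signatures).** Let $p$ be a polynomial with coefficients in $\mathbb N$, positive at all positive integers, such that $\mathcal N$ runs every $n$-qubit circuit of $d'$ layers with fidelity at least $1/p(nd')$, for all $n,d'\ge1$. Assume $\varepsilon$-No-Learning for some negligible function $\varepsilon$. Then for every sufficiently large polynomial $t$ (that is, there is a polynomial $t_0$ such that this holds for all polynomials $t\ge t_0$; polynomials with coefficients in $\mathbb N$), with $$k(n)=\Big(\frac1{p(2n\,d(n))}-\sqrt{\frac n{2t(n)}}\Big)\,t(n),$$ the scheme has the following properties. 1. *Correctness*: for each message $m\in\{0,1\}$, $\Pr[\mathrm{Ver}(|\mathrm{pk}\rangle,m,\sigma)\text{ accepts}]=1-\mathrm{negl}(n)$, where $\mathrm{sk}\leftarrow\mathrm{SKGen}(1^n)$, $|\mathrm{pk}\rangle\leftarrow\mathrm{PKGen}(\mathrm{sk})$, $\sigma\leftarrow\mathrm{Sign}(\mathrm{sk},m)$. 2. *One-time security*: for every polynomial $q$ and all QPT algorithms $A_1,A_2$,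 the probability that $m'\ne m$ and $\mathrm{Ver}(|\mathrm{pk}\rangle,m',\sigma')$ accepts is negligible in $n$, where $\mathrm{sk}\leftarrow\mathrm{SKGen}(1^n)$, $|\mathrm{pk}\rangle\leftarrow\mathrm{PKGen}(\mathrm{sk})$, $m\leftarrow A_1(|\mathrm{pk}\rangle^{\otimes q(n)})$, $\sigma\leftarrow\mathrm{Sign}(\mathrm{sk},m)$, $(m',\sigma')\leftarrow A_2(|\mathrm{pk}\rangle^{\otimes q(n)},m,\sigma)$. 3. *Noise robustness*: for each message $m\in\{0,1\}$, $\Pr[\widetilde{\mathrm{Ver}}(\widetilde{\mathrm{PKGen}}(\mathrm{sk}),m,\sigma)\text{ accepts}]=1-\mathrm{negl}(n)$, where $\mathrm{sk}\leftarrow\mathrm{SKGen}(1^n)$ and $\sigma\leftarrow\mathrm{Sign}(\mathrm{sk},m)$. -/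

import Mathlib

namespace QSig

open Matrix Polynomial

/-! ### Polynomial time: a while language over binary trees with a step count -/

/-- Binary trees, the data of the classical machine model. -/
inductive Tr : Type where
  | leaf : Tr
  | node : Tr → Tr → Tr

namespace Tr

def size : Tr → ℕ
  | leaf => 1
  | node a b => a.size + b.size + 1

def left : Tr → Tr
  | leaf => leaf
  | node a _ => a

def right : Tr → Tr
  | leaf => leaf
  | node _ b => b

/-- The unary string `1^n`. -/
def unary : ℕ → Tr
  | 0 => leaf
  | n + 1 => node leaf (unary n)

end Tr

/-- While programs: each program maps a tree to a tree. -/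
inductive Prog : Type where
  | skip : Prog
  | leaf : Prog
  | left : Prog
  | right : Prog
  | pair : Prog → Prog → Prog
  | comp : Prog → Prog → Prog
  | ite : Prog → Prog → Prog → Prog
  | while : Prog → Prog → Prog

/-- `Runs P x y c`: on input `x` the program `P` halts with output `y` after `c` steps.
`comp P Q` runs `P` and then `Q`; `leaf` counts as the truth value "false". An elementary instruction
is charged the size of the tree that it reads, and sizes of outputs are bounded by step counts, so the
step count is polynomially related to the running time of a Turing machine. -/
inductive Runs : Prog → Tr → Tr → ℕ → Prop where
  | skip (x : Tr) : Runs .skip x x (x.size + 1)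
  | leaf (x : Tr) : Runs .leaf x .leaf (x.size + 1)
  | left (x : Tr) : Runs .left x x.left (x.size + 1)
  | right (x : Tr) : Runs .right x x.right (x.size + 1)
  | pair {P Q : Prog} {x y z : Tr} {c c' : ℕ} :
      Runs P x y c → Runs Q x z c' → Runs (.pair P Q) x (.node y z) (c + c' + 1)
  | comp {P Q : Prog} {x y z : Tr} {c c' : ℕ} :
      Runs P x y c → Runs Q y z c' → Runs (.comp P Q) x z (c + c' + 1)
  | iteTrue {B P Q : Prog} {x u v y : Tr} {c c' : ℕ} :
      Runs B x (.node u v) c → Runs P x y c' → Runs (.ite B P Q) x y (c + c' + 1)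
  | iteFalse {B P Q : Prog} {x y : Tr} {c c' : ℕ} :
      Runs B x .leaf c → Runs Q x y c' → Runs (.ite B P Q) x y (c + c' + 1)
  | whileStop {B P : Prog} {x : Tr} {c : ℕ} :
      Runs B x .leaf c → Runs (.while B P) x x (c + x.size + 1)
  | whileStep {B P : Prog} {x u v y z : Tr} {c c' c'' : ℕ} :
      Runs B x (.node u v) c → Runs P x y c' → Runs (.while B P) y z c'' →
        Runs (.while B P) x z (c + c' + c'' + 1)

/-- `f n` is computed from `1^n` by one program in time polynomial in `n`. -/
def PolyTime (f : ℕ → Tr) : Prop :=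
  ∃ (P : Prog) (q : ℕ[X]), ∀ n : ℕ, ∃ c ≤ q.eval n, Runs P (Tr.unary n) (f n) c

/-- Types whose elements are written as trees; all the encodings below are injective. -/
class Enc (α : Type) where
  enc : α → Tr

instance : Enc ℕ := ⟨Tr.unary⟩
instance (m : ℕ) : Enc (Fin m) := ⟨fun i => Tr.unary i.val⟩
instance : Enc Unit := ⟨fun _ => .leaf⟩
instance : Enc Bool := ⟨fun b => if b then .node .leaf .leaf else .leaf⟩
instance {α β : Type} [Enc α] [Enc β] : Enc (α × β) := ⟨fun x => .node (Enc.enc x.1) (Enc.enc x.2)⟩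
instance {α : Type} {β : α → Type} [Enc α] [∀ a, Enc (β a)] : Enc (Σ a, β a) :=
  ⟨fun x => .node (Enc.enc x.1) (Enc.enc x.2)⟩
instance {α β : Type} [Enc α] [Enc β] : Enc (α ⊕ β) :=
  ⟨fun x => match x with
    | .inl a => .node .leaf (Enc.enc a)
    | .inr b => .node (.node .leaf .leaf) (Enc.enc b)⟩
instance {α : Type} [Enc α] : Enc (Option α) :=
  ⟨fun x => match x with
    | none => .leaf
    | some a => .node .leaf (Enc.enc a)⟩
instance {α : Type} [Enc α] : Enc (List α) :=
  ⟨fun l => l.foldr (fun a r => .node (Enc.enc a) r) .leaf⟩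

/-- A function is negligible if it tends to zero faster than every inverse polynomial. -/
def Negligible (f : ℕ → ℝ) : Prop :=
  Asymptotics.SuperpolynomialDecay Filter.atTop (fun n : ℕ => (n : ℝ)) f

/-! ### Gates and circuits; `false` is the basis state `0` and `true` is the basis state `1` -/

noncomputable def hGate : Matrix Bool Bool ℂ :=
  Matrix.of fun a b => (if a && b then -1 else 1) / (Real.sqrt 2 : ℂ)

noncomputable def sGate : Matrix Bool Bool ℂ :=
  Matrix.diagonal fun b => if b then Complex.I else 1

noncomputable def tGate : Matrix Bool Bool ℂ :=
  Matrix.diagonal fun b => if b then Complex.exp (Complex.I * (Real.pi / 4)) else 1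

/-- The first qubit is the control. -/
noncomputable def cnotGate : Matrix (Bool × Bool) (Bool × Bool) ℂ :=
  Matrix.of fun x y => if x = (y.1, xor y.1 y.2) then 1 else 0

/-- A finite set of one- and two-qubit gates that is closed under inverses and contains the generators
`H`, `S`, `CNOT` of the Clifford group and the gate `T` (hence is universal). -/
structure GateSet where
  num1 : ℕ
  num2 : ℕ
  one : Fin num1 → Matrix Bool Bool ℂ
  two : Fin num2 → Matrix (Bool × Bool) (Bool × Bool) ℂ
  one_unitary : ∀ g, one g ∈ Matrix.unitaryGroup Bool ℂ
  two_unitary : ∀ g, two g ∈ Matrix.unitaryGroup (Bool × Bool) ℂ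
  inv1 : Fin num1 → Fin num1
  inv2 : Fin num2 → Fin num2
  one_inv : ∀ g, one (inv1 g) = (one g)ᴴ
  two_inv : ∀ g, two (inv2 g) = (two g)ᴴ
  has_h : ∃ g, one g = hGate
  has_s : ∃ g, one g = sGate
  has_t : ∃ g, one g = tGate
  has_cnot : ∃ g, two g = cnotGate

/-- A gate of the gate set together with the wires on which it acts. -/
inductive GateApp (G : GateSet) (W : Type) : Type where
  | one (g : Fin G.num1) (i : W) : GateApp G W
  | two (g : Fin G.num2) (i j : W) (h : i ≠ j) : GateApp G W

instance {G : GateSet} {W : Type} [Enc W] : Enc (GateApp G W) :=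
  ⟨fun a => match a with
    | .one g i => .node .leaf (Enc.enc (g, i))
    | .two g i j _ => .node (.node .leaf .leaf) (Enc.enc (g, i, j))⟩

section Semantics

variable {G : GateSet} {W : Type} [Fintype W] [DecidableEq W]

/-- The unitary of a gate on the qubits `W`, in the standard basis `W → Bool`. -/
def GateApp.mat : GateApp G W → Matrix (W → Bool) (W → Bool) ℂ
  | .one g i => Matrix.of fun x y =>
      if ∀ w, w ≠ i → x w = y w then G.one g (x i) (y i) else 0
  | .two g i j _ => Matrix.of fun x y =>
      if ∀ w, w ≠ i → w ≠ j → x w = y w then G.two g (x i, x j) (y i, y j) else 0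

/-- The unitary of a circuit; the head of the list is the gate that is applied first. -/
def circMat : List (GateApp G W) → Matrix (W → Bool) (W → Bool) ℂ
  | [] => 1
  | a :: L => circMat L * a.mat

end Semantics

/-! ### Quantum polynomial-time algorithms -/

/-- A QPT algorithm with input qubits `In n` and classical output bits `Out n`: a uniform family of
polynomial-size circuits on the input register, an output register and `anc n` further ancillas. All
qubits outside the input register start in the state `0`; at the end the output register is measured in
the standard basis and everything else is traced out. -/
structure QPT (G : GateSet) (In Out : ℕ → Type) [∀ n, Enc (In n)] [∀ n, Enc (Out n)] where
  anc : ℕ → ℕ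
  circ : ∀ n, List (GateApp G (In n ⊕ Out n ⊕ Fin (anc n)))
  uniform : PolyTime fun n => Enc.enc (anc n, circ n)

/-- The probability that the algorithm outputs `y` on the input state `φ`. -/
noncomputable def QPT.outProb {G : GateSet} {In Out : ℕ → Type} [∀ n, Enc (In n)] [∀ n, Enc (Out n)]
    [∀ n, Fintype (In n)] [∀ n, DecidableEq (In n)] [∀ n, Fintype (Out n)] [∀ n, DecidableEq (Out n)]
    (A : QPT G In Out) (n : ℕ) (φ : (In n → Bool) → ℂ) (y : Out n → Bool) : ℝ :=
  ∑ x : In n ⊕ Out n ⊕ Fin (A.anc n) → Bool,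
    if (fun o => x (.inr (.inl o))) = y then
      ‖(circMat (A.circ n) *ᵥ fun z =>
          if ∀ w, z (.inr w) = false then φ (fun i => z (.inl i)) else 0) x‖ ^ 2
    else 0

/-- The state of `q` copies of `φ`. -/
def copies {ι : Type} (q : ℕ) (φ : (ι → Bool) → ℂ) : (Fin q × ι → Bool) → ℂ :=
  fun x => ∏ c : Fin q, φ fun i => x (c, i)

/-- The average over a uniformly random element. -/
noncomputable def avg {α : Type} [Fintype α] (f : α → ℝ) : ℝ := (∑ a, f a) / Fintype.card α

/-! ### Brickwork circuits -/

/-- The content of a brick on two neighbouring qubits: an optional one-qubit gate on each of them, or a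
two-qubit gate in one of the two orientations. -/
abbrev Brick (G : GateSet) : Type :=
  (Option (Fin G.num1) × Option (Fin G.num1)) ⊕ (Fin G.num2 × Bool)

def Brick.inv {G : GateSet} : Brick G → Brick G
  | .inl (g, h) => .inl (g.map G.inv1, h.map G.inv1)
  | .inr (g, o) => .inr (G.inv2 g, o)

def Brick.gates {G : GateSet} {W : Type} (i j : W) (h : i ≠ j) : Brick G → List (GateApp G W)
  | .inl (g, g') => (g.toList.map fun a => .one a i) ++ (g'.toList.map fun a => .one a j)
  | .inr (g, false) => [.two g i j h]
  | .inr (g, true) => [.two g j i h.symm]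

/-- A layer of bricks on `n` qubits in a line: for the parity `r`, the `j`-th brick of the layer acts
on the qubits `r + 2 j` and `r + 2 j + 1` (counted from `0`). -/
abbrev Layer (G : GateSet) (n : ℕ) : Type := Σ r : Fin 2, (Fin ((n - r.val) / 2) → Brick G)

def Layer.inv {G : GateSet} {n : ℕ} (L : Layer G n) : Layer G n := ⟨L.1, fun j => (L.2 j).inv⟩

def Layer.gates {G : GateSet} {n : ℕ} (L : Layer G n) : List (GateApp G (Fin n)) :=
  (List.finRange ((n - L.1.val) / 2)).flatMap fun j =>
    Brick.gates (⟨L.1.val + 2 * j.val, by omega⟩ : Fin n) ⟨L.1.val + 2 * j.val + 1, by omega⟩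
      (by simp) (L.2 j)

/-- The unitary of a sequence of layers; the head of the list is applied first. -/
def layersMat {G : GateSet} {n : ℕ} (Ls : List (Layer G n)) :
    Matrix (Fin n → Bool) (Fin n → Bool) ℂ := circMat (Ls.flatMap Layer.gates)

/-- The state obtained from the all-zeros state by a sequence of layers. -/
def layersKet {G : GateSet} {n : ℕ} (Ls : List (Layer G n)) : (Fin n → Bool) → ℂ :=
  layersMat Ls *ᵥ Pi.single (fun _ => false) 1

/-- The depth `log² n` of the circuit ensemble. -/
def depth (n : ℕ) : ℕ := Nat.log 2 n ^ 2

/-- The positions of the bricks of an `n`-qubit brickwork of depth `log² n`; the parities of the layers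
alternate. -/
abbrev Slot (n : ℕ) : Type := Σ l : Fin (depth n), Fin ((n - l.val % 2) / 2)

/-- The ensemble of `n`-qubit brickwork circuits of depth `log² n`. -/
abbrev Ckt (G : GateSet) (n : ℕ) : Type := Slot n → Brick G

def Ckt.layers {G : GateSet} {n : ℕ} (C : Ckt G n) : List (Layer G n) :=
  List.ofFn fun l : Fin (depth n) => ⟨⟨l.val % 2, Nat.mod_lt _ (by norm_num)⟩, fun j => C ⟨l, j⟩⟩

/-- The layers of the inverse circuit. -/
def Ckt.dagger {G : GateSet} {n : ℕ} (C : Ckt G n) : List (Layer G n) :=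
  C.layers.reverse.map Layer.inv

def Ckt.ket {G : GateSet} {n : ℕ} (C : Ckt G n) : (Fin n → Bool) → ℂ := layersKet C.layers

/-- The squared overlap of the output states of two circuits. -/
noncomputable def Ckt.overlap {G : GateSet} {n : ℕ} (C D : Ckt G n) : ℝ := ‖star C.ket ⬝ᵥ D.ket‖ ^ 2

/-- The bits of a classical description of a circuit. -/
abbrev DescIdx (G : GateSet) (n : ℕ) : Type := Slot n × Brick G

instance (G : GateSet) (n : ℕ) : DecidableEq (DescIdx G n) := inferInstance
instance (G : GateSet) (n : ℕ) : Fintype (DescIdx G n) := inferInstance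
instance (G : GateSet) (n : ℕ) : Enc (DescIdx G n) := inferInstance

/-- The classical description of a circuit: one bit for each position and each possible brick, which
says whether this brick stands there. -/
def Ckt.describe {G : GateSet} {n : ℕ} (C : Ckt G n) : DescIdx G n → Bool :=
  fun i => decide (C i.1 = i.2)

open scoped Classical in
/-- The circuit that a bit string describes, if there is one. -/
noncomputable def decode {G : GateSet} {n : ℕ} (s : DescIdx G n → Bool) : Option (Ckt G n) :=
  if h : ∃ C : Ckt G n, C.describe = s then some h.choose else none

/-! ### The No-Learning assumption -/

/-- The probability that `A`, given `q n` copies of the output state of a uniformly random circuit `C`,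
outputs a description of a circuit `D` of the ensemble whose output state has squared overlap at
least `ε n` with that of `C`. -/
noncomputable def learnProb {G : GateSet} (ε : ℕ → ℝ) (q : ℕ[X])
    (A : QPT G (fun n => Fin (q.eval n) × Fin n) (fun n => DescIdx G n)) (n : ℕ) : ℝ :=
  avg fun C : Ckt G n => ∑ s : DescIdx G n → Bool,
    A.outProb n (copies (q.eval n) C.ket) s *
      (match decode s with
        | some D => if ε n ≤ C.overlap D then 1 else 0
        | none => 0)

/-- The `ε`-No-Learning assumption. -/
def NoLearning (G : GateSet) (ε : ℕ → ℝ) : Prop :=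
  ∀ (q : ℕ[X]) (A : QPT G (fun n => Fin (q.eval n) × Fin n) (fun n => DescIdx G n)),
    ∀ᶠ n in Filter.atTop, learnProb ε q A n ≤ ε n

/-! ### Noisy devices -/

/-- Linear maps on operators on `n` qubits. -/
abbrev Superop (n : ℕ) : Type :=
  Matrix (Fin n → Bool) (Fin n → Bool) ℂ →ₗ[ℂ] Matrix (Fin n → Bool) (Fin n → Bool) ℂ

/-- Quantum channels, by a Kraus decomposition. -/
def IsChannel {n : ℕ} (Φ : Superop n) : Prop :=
  ∃ (r : ℕ) (K : Fin r → Matrix (Fin n → Bool) (Fin n → Bool) ℂ),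
    ∑ a, (K a)ᴴ * K a = 1 ∧ ∀ ρ, Φ ρ = ∑ a, K a * ρ * (K a)ᴴ

/-- What a device does to a block of `n` qubits when it is asked to initialize it (`prep`, applied to
the ideal all-zeros state), to execute a layer of gates on it (`layer`), and to measure it in the
standard basis (`readout`, applied just before an ideal measurement). -/
structure Device (G : GateSet) where
  prep : ∀ n, Superop n
  layer : ∀ n, Layer G n → Superop n
  readout : ∀ n, Superop n

/-- The noiseless device. -/
def Device.ideal (G : GateSet) : Device G where
  prep _ := LinearMap.id
  layer _ L := LinearMap.mulLeft ℂ (layersMat [L]) ∘ₗ LinearMap.mulRight ℂ (layersMat [L])ᴴ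
  readout _ := LinearMap.id

namespace Device

variable {G : GateSet}

/-- A noise model: all operations are quantum channels. -/
def IsNoiseModel (N : Device G) : Prop :=
  (∀ n, IsChannel (N.prep n)) ∧ (∀ n L, IsChannel (N.layer n L)) ∧ ∀ n, IsChannel (N.readout n)

/-- The execution of a sequence of layers. -/
def exec (N : Device G) {n : ℕ} : List (Layer G n) → Superop n
  | [] => LinearMap.id
  | L :: Ls => N.exec Ls ∘ₗ N.layer n L

/-- The state that the device produces when it runs a sequence of layers on a fresh register. -/
def prepare (N : Device G) {n : ℕ} (Ls : List (Layer G n)) : Matrix (Fin n → Bool) (Fin n → Bool) ℂ :=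
  N.exec Ls (N.prep n (Matrix.single (fun _ => false) (fun _ => false) 1))

/-- The fidelity with which the device runs a circuit from initialization to measurement: the fidelity
of the state that enters the final ideal measurement with the pure output state of the ideal circuit. -/
noncomputable def fidelity (N : Device G) {n : ℕ} (Ls : List (Layer G n)) : ℝ :=
  (star (layersKet Ls) ⬝ᵥ (N.readout n (N.prepare Ls) *ᵥ layersKet Ls)).re

/-- Every `n`-qubit circuit of depth `d` is run with fidelity at least `1 / p (n d)`. -/
def FidelityAtLeast (N : Device G) (p : ℕ[X]) : Prop :=
  ∀ (n d : ℕ), 1 ≤ n → 1 ≤ d → ∀ Ls : List (Layer G n), Ls.length = d →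
    1 / ((p.eval (n * d) : ℕ) : ℝ) ≤ N.fidelity Ls

end Device

/-- The tensor product of linear maps that act on separate blocks of `n` qubits. -/
noncomputable def tensorMap {B : Type} [Fintype B] [DecidableEq B] {n : ℕ} (Φ : B → Superop n)
    (ρ : Matrix (B → Fin n → Bool) (B → Fin n → Bool) ℂ) :
    Matrix (B → Fin n → Bool) (B → Fin n → Bool) ℂ :=
  Matrix.of fun x y => ∑ u, ∑ v, (∏ b, Φ b (Matrix.single (u b) (v b) 1) (x b) (y b)) * ρ u v

/-! ### The signature scheme; the messages are single bits

The public key consists of blocks of `n` qubits, indexed by a bit and a number in `Fin t`. -/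

/-- Secret keys. `SKGen` returns a uniformly random one. -/
abbrev SecretKey (G : GateSet) (n t : ℕ) : Type := Bool × Fin t → Ckt G n

/-- The bits of a signature. -/
abbrev SigIdx (G : GateSet) (n t : ℕ) : Type := Fin t × DescIdx G n

/-- Standard basis of the public key register, by blocks. -/
abbrev PKBasis (n t : ℕ) : Type := Bool × Fin t → Fin n → Bool

/-- `PKGen`: the public key state. -/
def pkGen {G : GateSet} {n t : ℕ} (sk : SecretKey G n t) : ((Bool × Fin t) × Fin n → Bool) → ℂ :=
  fun x => ∏ a : Bool × Fin t, (sk a).ket fun i => x (a, i)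

/-- The density matrix of the public key state. -/
def pkDensity {G : GateSet} {n t : ℕ} (sk : SecretKey G n t) : Matrix (PKBasis n t) (PKBasis n t) ℂ :=
  Matrix.of fun x y => pkGen sk (fun i => x i.1 i.2) * star (pkGen sk fun i => y i.1 i.2)

/-- `PKGen` on the device `N`, with independent noise on the blocks. -/
def noisyPKGen {G : GateSet} (N : Device G) {n t : ℕ} (sk : SecretKey G n t) :
    Matrix (PKBasis n t) (PKBasis n t) ℂ :=
  Matrix.of fun x y => ∏ a : Bool × Fin t, N.prepare (sk a).layers (x a) (y a)

/-- `Sign`: the descriptions of the circuits that belong to the message. -/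
def sign {G : GateSet} {n t : ℕ} (sk : SecretKey G n t) (m : Bool) : SigIdx G n t → Bool :=
  fun i => (sk (m, i.1)).describe i.2

/-- `Ver` on the device `N` with threshold `k`: the probability that the signature `σ` of the message
`m` is accepted with the public key `ρ`. The signature is interpreted as circuits `D j`; the inverse of
`D j` is applied to block `j` of the half of the key that belongs to `m`, with independent noise on the
blocks, the blocks are measured, and `j` counts as passed if `D j` is a valid description and the
result on the block is all zeros. -/
noncomputable def verProb {G : GateSet} (N : Device G) {n t : ℕ} (k : ℝ)
    (ρ : Matrix (PKBasis n t) (PKBasis n t) ℂ) (m : Bool) (σ : SigIdx G n t → Bool) : ℝ :=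
  let D : Fin t → Option (Ckt G n) := fun j => decode fun i => σ (j, i)
  let Φ : Bool × Fin t → Superop n := fun a =>
    if a.1 = m then
      match D a.2 with
      | some C => N.readout n ∘ₗ N.exec C.dagger
      | none => LinearMap.id
    else LinearMap.id
  ∑ x : PKBasis n t,
    if k ≤ (Finset.card {j : Fin t | (D j).isSome ∧ x (m, j) = fun _ => false} : ℝ) then
      (tensorMap Φ ρ x x).re
    else 0

/-- The probability that the honest signature of `m` is accepted, everything being noiseless. -/
noncomputable def honestProb (G : GateSet) (n t : ℕ) (k : ℝ) (m : Bool) : ℝ :=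
  avg fun sk : SecretKey G n t => verProb (Device.ideal G) k (pkDensity sk) m (sign sk m)

/-- The probability that the honest signature of `m` is accepted when the public key is generated and
verified on the device `N`. -/
noncomputable def noisyHonestProb {G : GateSet} (N : Device G) (n t : ℕ) (k : ℝ) (m : Bool) : ℝ :=
  avg fun sk : SecretKey G n t => verProb N k (noisyPKGen N sk) m (sign sk m)

/-- Correctness of the scheme with parameters `t n` and `k n`. -/
def Correct (G : GateSet) (t : ℕ[X]) (k : ℕ → ℝ) : Prop :=
  ∀ m : Bool, Negligible fun n => 1 - honestProb G n (t.eval n) (k n) m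

/-- Noise robustness of the scheme with parameters `t n` and `k n`. -/
def NoiseRobust {G : GateSet} (N : Device G) (t : ℕ[X]) (k : ℕ → ℝ) : Prop :=
  ∀ m : Bool, Negligible fun n => 1 - noisyHonestProb N n (t.eval n) (k n) m

/-- `q` copies of the public key. -/
abbrev PKCopies (t q : ℕ[X]) (n : ℕ) : Type := Fin (q.eval n) × (Bool × Fin (t.eval n)) × Fin n

/-- First stage of a forger: from copies of the public key it computes a message. -/
abbrev Forger₁ (G : GateSet) (t q : ℕ[X]) : Type := QPT G (PKCopies t q) (fun _ => Unit)

/-- Second stage of a forger: from copies of the public key, a message and its signature it computes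
a message and a signature. -/
abbrev Forger₂ (G : GateSet) (t q : ℕ[X]) : Type :=
  QPT G (fun n => PKCopies t q n ⊕ Unit ⊕ SigIdx G n (t.eval n)) (fun n => Unit ⊕ SigIdx G n (t.eval n))

/-- The input state of the second stage of a forger. -/
def forgerInput {G : GateSet} {n t q : ℕ} (sk : SecretKey G n t) (m : Bool) :
    (Fin q × (Bool × Fin t) × Fin n ⊕ Unit ⊕ SigIdx G n t → Bool) → ℂ :=
  fun x =>
    if x (.inr (.inl ())) = m ∧ (fun i => x (.inr (.inr i))) = sign sk m then
      copies q (pkGen sk) fun i => x (.inl i)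
    else 0

/-- The probability that the forger outputs a message other than the one that was signed for it and a
signature that (noiseless) verification accepts with a fresh public key. -/
noncomputable def forgeProb {G : GateSet} (t q : ℕ[X]) (k : ℕ → ℝ) (A₁ : Forger₁ G t q)
    (A₂ : Forger₂ G t q) (n : ℕ) : ℝ :=
  avg fun sk : SecretKey G n (t.eval n) =>
    ∑ m : Bool, A₁.outProb n (copies (q.eval n) (pkGen sk)) (fun _ => m) *
      ∑ m' : Bool, ∑ σ' : SigIdx G n (t.eval n) → Bool,
        A₂.outProb n (forgerInput sk m) (Sum.elim (fun _ => m') σ') *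
          (if m' ≠ m then verProb (Device.ideal G) (k n) (pkDensity sk) m' σ' else 0)

/-- One-time security of the scheme with parameters `t n` and `k n`. -/
def OneTimeSecure (G : GateSet) (t : ℕ[X]) (k : ℕ → ℝ) : Prop :=
  ∀ (q : ℕ[X]) (A₁ : Forger₁ G t q) (A₂ : Forger₂ G t q), Negligible (forgeProb t q k A₁ A₂)

/-- The threshold `(1 / p (n · 2d) - √(n / (2 t))) t`, where `d` is the depth of the circuits of the
ensemble, so that `2d` is the depth of a circuit followed by its inverse. -/
noncomputable def threshold (p t : ℕ[X]) (n : ℕ) : ℝ :=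
  (1 / ((p.eval (n * (2 * depth n)) : ℕ) : ℝ) - Real.sqrt (n / (2 * ((t.eval n : ℕ) : ℝ)))) * ((t.eval n : ℕ) : ℝ)

end QSig

namespace QSig

open Matrix Polynomial

set_option linter.unusedSectionVars false

/-! ### Polynomial-time functions of the tree machine -/

/-! Honest keys. Verifying an honest block amounts to running `C` followed by its inverse, a circuit
of depth `2d` whose ideal output is `0^n`. The block therefore passes with probability equal to the
fidelity of that run, which is at least `1/p(2nd)`. The noise is independent on the blocks, so
Hoeffding's inequality with deviation `s = √(n/(2t))` bounds the probability of rejection by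
`exp(-2s²t) = e^{-n}` (`one_sub_verProb_le`). This is noise robustness; correctness is the same
bound for the noiseless device, whose fidelity is `1`.

Forgeries. The expected number of passed blocks of a forged signature is the sum of the overlaps of
the key circuits with the claimed circuits, and Markov's inequality bounds the probability of
acceptance by `1/k` times that sum (`verProb_ideal_le`). An overlap is at most `ε` plus the
indicator that it reaches `ε`, and that event is what a learner aims at. For each message `m` a
learner is built. It samples the circuits of a whole public key, prepares `q` copies of it, puts the
`q` copies of the unknown state in place of a random block of the half `!m`, runs the second stage
of the forger on `m` and the signature of `m` (which it knows), and outputs the forged description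
for that block. No-Learning then bounds the success probabilities of the forger, summed over the
blocks, by `4tε` (`learn_ge`); the factor `4` is the price of sampling with fair coins. The first
stage of the forger needs no simulation, because its probability of choosing `m` is bounded by `1`
and both messages are summed over. Altogether forging succeeds with probability at most `2 · (t/k) ·
5ε`, and `t/k ≤ 2p(2n³)` once `t` is large (`le_threshold`).

Most of the work is to exhibit the learner as a uniform family of circuits over a gate set of which
only `H`, `S`, `T` and `CNOT` are known explicitly. Coins are Hadamard-prepared wires that serve
only as controls, so branches with different coins do not interfere. Bricks and the block are chosen
by coin-driven permutations of one-hot registers (`walk_mixing`, `heapWalk_avg_ge`). A brick is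
applied conditionally by exchanging its wires with dummy wires under a control (`act_prepStep`).
`branch_outProb` evaluates one branch and `learn_outProb_ge` combines the branches. Uniformity is
obtained from a calculus `PT` of polynomial-time functions closed under bounded folds, applied to
the encodings of the gates (`encPlaced_learn`). -/

theorem eval_le_eval (q : ℕ[X]) {a b : ℕ} (h : a ≤ b) : q.eval a ≤ q.eval b := by
  rw [Polynomial.eval_eq_sum_range, Polynomial.eval_eq_sum_range]
  exact Finset.sum_le_sum fun i _ => Nat.mul_le_mul_left _ (Nat.pow_le_pow_left h i)

/-- Every rule charges at least the size of its output. A time bound is thus also a size bound,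
which is what makes polynomial bounds compose. -/
theorem Runs.size_le {P : Prog} {x y : Tr} {c : ℕ} (h : Runs P x y c) : y.size ≤ c := by
  induction h with
  | skip x => omega
  | leaf x => simp [Tr.size]
  | left x => cases x <;> simp [Tr.size, Tr.left]; omega
  | right x => cases x <;> simp [Tr.size, Tr.right]; omega
  | pair _ _ h1 h2 => simp only [Tr.size]; omega
  | comp _ _ h1 h2 => omega
  | iteTrue _ _ h1 h2 => omega
  | iteFalse _ _ h1 h2 => omega
  | whileStop _ _ => omega
  | whileStep _ _ _ h1 h2 h3 => omega

theorem Tr.one_le_size (x : Tr) : 1 ≤ x.size := by cases x <;> simp [Tr.size]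

/-- One program maps `e x` to `f x` for all `x`, in time polynomial in the size of `e x`. -/
def PTe {X : Type} (e f : X → Tr) : Prop :=
  ∃ (P : Prog) (q : ℕ[X]), ∀ x, ∃ c ≤ q.eval (e x).size, Runs P (e x) (f x) c

namespace PTe

variable {X Y : Type} {e f g : X → Tr}

theorem size_le (h : PTe e f) : ∃ q : ℕ[X], ∀ x, (f x).size ≤ q.eval (e x).size := by
  obtain ⟨P, q, h⟩ := h
  refine ⟨q, fun x => ?_⟩
  obtain ⟨c, hc, hr⟩ := h x
  exact hr.size_le.trans hc

theorem reindex (h : PTe e f) (k : Y → X) : PTe (fun y => e (k y)) (fun y => f (k y)) := by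
  obtain ⟨P, q, h⟩ := h
  exact ⟨P, q, fun y => h (k y)⟩

theorem refl (e : X → Tr) : PTe e e :=
  ⟨.skip, Polynomial.X + 1, fun x => ⟨(e x).size + 1, by simp, .skip _⟩⟩

theorem trans (h : PTe e f) (h' : PTe f g) : PTe e g := by
  obtain ⟨P, q, h⟩ := h
  obtain ⟨P', q', h'⟩ := h'
  -- The second program reads a tree whose size is at most the step count of the first.
  refine ⟨.comp P P', q + q'.comp q + 1, fun x => ?_⟩
  obtain ⟨c, hc, hr⟩ := h x
  obtain ⟨c', hc', hr'⟩ := h' x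
  refine ⟨c + c' + 1, ?_, .comp hr hr'⟩
  have := eval_le_eval q' (hr.size_le.trans hc)
  simp only [eval_add, eval_comp, eval_one]
  omega

theorem node (h : PTe e f) (h' : PTe e g) : PTe e fun x => .node (f x) (g x) := by
  obtain ⟨P, q, h⟩ := h
  obtain ⟨P', q', h'⟩ := h'
  refine ⟨.pair P P', q + q' + 1, fun x => ?_⟩
  obtain ⟨c, hc, hr⟩ := h x
  obtain ⟨c', hc', hr'⟩ := h' x
  refine ⟨c + c' + 1, ?_, .pair hr hr'⟩
  simp only [eval_add, eval_one]
  omega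

theorem left' (e : X → Tr) : PTe e fun x => (e x).left :=
  ⟨.left, Polynomial.X + 1, fun x => ⟨(e x).size + 1, by simp, .left _⟩⟩

theorem right' (e : X → Tr) : PTe e fun x => (e x).right :=
  ⟨.right, Polynomial.X + 1, fun x => ⟨(e x).size + 1, by simp, .right _⟩⟩

theorem left (h : PTe e f) : PTe e fun x => (f x).left := h.trans (left' f)

theorem right (h : PTe e f) : PTe e fun x => (f x).right := h.trans (right' f)

theorem const (e : X → Tr) (T : Tr) : PTe e fun _ => T := by
  induction T with
  | leaf => exact ⟨.leaf, Polynomial.X + 1, fun x => ⟨(e x).size + 1, by simp, .leaf _⟩⟩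
  | node a b ha hb => exact ha.node hb

/-- Case distinction on whether a tree is a leaf. -/
theorem ite {b : X → Tr} (hb : PTe e b) {c : X → Prop} [DecidablePred c]
    (hc : ∀ x, b x = .leaf ↔ ¬ c x) (hf : PTe e f) (hg : PTe e g) :
    PTe e fun x => if c x then f x else g x := by
  obtain ⟨B, r, hb⟩ := hb
  obtain ⟨P, q, hf⟩ := hf
  obtain ⟨P', q', hg⟩ := hg
  refine ⟨.ite B P P', r + q + q' + 1, fun x => ?_⟩
  obtain ⟨c₀, hc₀, hr₀⟩ := hb x
  obtain ⟨c₁, hc₁, hr₁⟩ := hf x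
  obtain ⟨c₂, hc₂, hr₂⟩ := hg x
  simp only [eval_add, eval_one]
  by_cases h : c x
  · have hx : b x ≠ .leaf := fun h' => (hc x).1 h' h
    obtain ⟨u, v, huv⟩ : ∃ u v, b x = .node u v := by
      cases hbx : b x with
      | leaf => exact absurd hbx hx
      | node u v => exact ⟨u, v, rfl⟩
    rw [huv] at hr₀
    simp only [h, if_true]
    exact ⟨c₀ + c₁ + 1, by omega, .iteTrue hr₀ hr₁⟩
  · rw [(hc x).2 h] at hr₀
    simp only [h, if_false]
    exact ⟨c₀ + c₂ + 1, by omega, .iteFalse hr₀ hr₂⟩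

end PTe

instance : Enc Tr := ⟨id⟩

/-- Polynomial-time computable functions between encoded types. -/
@[fun_prop]
def PT {α β : Type} [Enc α] [Enc β] (f : α → β) : Prop := PTe Enc.enc fun a => Enc.enc (f a)

section PT

variable {Γ α β γ σ : Type} [Enc Γ] [Enc α] [Enc β] [Enc γ] [Enc σ]

@[fun_prop]
theorem PT.id : PT fun a : α => a := PTe.refl _

@[fun_prop]
theorem PT.const (b : β) : PT fun _ : α => b := PTe.const _ _

@[fun_prop]
theorem PT.comp {g : β → γ} {f : α → β} (hg : PT g) (hf : PT f) : PT fun a => g (f a) :=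
  PTe.trans hf (hg.reindex f)

@[fun_prop]
theorem PT.prodMk {f : Γ → α} {g : Γ → β} (hf : PT f) (hg : PT g) : PT fun x => (f x, g x) :=
  PTe.node hf hg

@[fun_prop]
theorem PT.fst : PT fun x : α × β => x.1 := PTe.left' _

@[fun_prop]
theorem PT.snd : PT fun x : α × β => x.2 := PTe.right' _

@[fun_prop]
theorem PT.trLeft : PT Tr.left := PTe.left' _

@[fun_prop]
theorem PT.trRight : PT Tr.right := PTe.right' _

@[fun_prop]
theorem PT.trNode {f g : Γ → Tr} (hf : PT f) (hg : PT g) : PT fun x => Tr.node (f x) (g x) :=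
  PTe.node hf hg

@[fun_prop]
theorem PT.enc : PT fun a : α => Enc.enc a := PTe.refl _

/-- Only trees are computed, so functions into different types are interchangeable as soon as the
trees of their values agree. This gives, for instance, successors, numbers read off the spine of a
tree, and circuits from lists of encoded gates. -/
theorem PT.of_enc {f : Γ → α} {g : Γ → β} (hf : PT f) (h : ∀ x, Enc.enc (f x) = Enc.enc (g x)) :
    PT g := by
  unfold PT at *
  simpa only [h] using hf

theorem PT.size_le {f : α → β} (hf : PT f) :
    ∃ q : ℕ[X], ∀ x, (Enc.enc (f x)).size ≤ q.eval (Enc.enc x).size := PTe.size_le hf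

@[fun_prop]
theorem PT.ite {c : Γ → Bool} {f g : Γ → α} (hc : PT c) (hf : PT f) (hg : PT g) :
    PT fun x => if c x = true then f x else g x := by
  have := PTe.ite (c := fun x => c x = true) hc
    (fun x => by cases h : c x <;> simp [Enc.enc]) hf hg
  unfold PT
  convert this using 2 with x
  cases h : c x <;> simp [h]

@[fun_prop]
theorem PT.cons {f : Γ → α} {g : Γ → List α} (hf : PT f) (hg : PT g) : PT fun x => f x :: g x :=
  PTe.node hf hg

@[fun_prop]
theorem PT.succ {f : Γ → ℕ} (hf : PT f) : PT fun x => f x + 1 :=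
  PT.of_enc (f := fun x => Tr.node .leaf (Enc.enc (f x))) (by fun_prop) fun _ => rfl

@[fun_prop]
theorem PT.pred {f : Γ → ℕ} (hf : PT f) : PT fun x => f x - 1 := by
  refine PT.of_enc (f := fun x => (Enc.enc (f x)).right) (by fun_prop) fun x => ?_
  cases f x <;> rfl

/-- Whether a tree is a node. -/
def Tr.isNode : Tr → Bool
  | .leaf => false
  | .node _ _ => true

@[fun_prop]
theorem PT.isNode {f : Γ → Tr} (hf : PT f) : PT fun x => (f x).isNode := by
  unfold PT
  have := PTe.ite (c := fun x => (f x).isNode = true) hf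
    (fun x => by cases h : f x <;> simp [Enc.enc, Tr.isNode]) (PTe.const _ (Enc.enc true))
    (PTe.const _ (Enc.enc false))
  convert this using 2 with x
  cases h : (f x).isNode <;> simp [h]

end PT

theorem size_unary (n : ℕ) : (Tr.unary n).size = 2 * n + 1 := by
  induction n with
  | zero => rfl
  | succ n ih => simp only [Tr.unary, Tr.size, ih]; ring

/-- The two notions differ only in the measure of the input: `n` against the size `2 n + 1` of its
unary tree. -/
theorem polyTime_iff_pt {f : ℕ → Tr} : PolyTime f ↔ PT f := by
  constructor
  · rintro ⟨P, q, h⟩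
    refine ⟨P, q, fun n => ?_⟩
    obtain ⟨c, hc, hr⟩ := h n
    refine ⟨c, hc.trans (eval_le_eval q ?_), hr⟩
    change n ≤ (Tr.unary n).size
    rw [size_unary]; omega
  · rintro ⟨P, q, h⟩
    refine ⟨P, q.comp (2 * X + 1), fun n => ?_⟩
    obtain ⟨c, hc, hr⟩ := h n
    refine ⟨c, hc.trans (le_of_eq ?_), hr⟩
    change q.eval (Tr.unary n).size = _
    rw [size_unary]; simp

/-! ### Bounded loops over lists. -/

section Fold
variable {Γ α β γ σ : Type} [Enc Γ] [Enc α] [Enc β] [Enc γ] [Enc σ]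

/-- The tree that holds the loop state of a fold. -/
def foldState (g : Γ) (s : σ) (l : List α) : Tr := .node (Enc.enc g) (.node (Enc.enc s) (Enc.enc l))

/-- The loop consumes the list head by head. The bound `S` is demanded of every intermediate state
(a prefix folded, the suffix still to come), because the costs of test and body are known only for
states of bounded size. A turn costs at most `2 b + 1`, and the final exit at most `b + S + 1`. -/
theorem runs_foldl {step : Γ → σ → α → σ} {B P : Prog} {b S : ℕ} (g : Γ)
    (hB : ∀ (s : σ) (l : List α), (foldState g s l).size ≤ S →
      ∃ c ≤ b, Runs B (foldState g s l) (Enc.enc l) c)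
    (hP : ∀ (s : σ) (a : α) (l : List α), (foldState g s (a :: l)).size ≤ S →
      ∃ c ≤ b, Runs P (foldState g s (a :: l)) (foldState g (step g s a) l) c)
    (l : List α) : ∀ (s : σ),
    (∀ l₁ l₂, l = l₁ ++ l₂ → (foldState g (l₁.foldl (step g) s) l₂).size ≤ S) →
    ∃ c ≤ (l.length + 1) * (2 * b + S + 1),
      Runs (.while B P) (foldState g s l) (foldState g (l.foldl (step g) s) ([] : List α)) c := by
  induction l with
  | nil =>
    intro s hS
    have h0 := hS [] [] rfl
    obtain ⟨c, hc, hr⟩ := hB s [] h0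
    refine ⟨_, ?_, .whileStop hr⟩
    simp at *; omega
  | cons a l ih =>
    intro s hS
    have h0 := hS [] (a :: l) rfl
    obtain ⟨c, hc, hr⟩ := hB s (a :: l) h0
    obtain ⟨c', hc', hr'⟩ := hP s a l h0
    obtain ⟨c'', hc'', hr''⟩ := ih (step g s a) fun l₁ l₂ h => by
      have := hS (a :: l₁) l₂ (by simp [h])
      simpa using this
    refine ⟨c + c' + c'' + 1, ?_, .whileStep hr hr' hr''⟩
    have : (a :: l).length = l.length + 1 := rfl
    rw [this, Nat.add_mul (l.length + 1)]
    omega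

theorem length_le_size (l : List α) : l.length ≤ (Enc.enc l).size := by
  induction l with
  | nil => simp
  | cons a l ih =>
    change l.length + 1 ≤ (Enc.enc a).size + (Enc.enc l).size + 1
    omega

theorem size_suffix_le {l₁ l₂ : List α} : (Enc.enc l₂).size ≤ (Enc.enc (l₁ ++ l₂)).size := by
  induction l₁ with
  | nil => simp
  | cons a l ih =>
    change _ ≤ (Enc.enc a).size + (Enc.enc (l ++ l₂)).size + 1
    omega

/-- Polynomial time is not closed under iteration, since intermediate values may grow exponentially.
The hypothesis `hB` excludes this by bounding the accumulator after every prefix of the list. -/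
theorem PT.foldl {step : Γ → σ → α → σ} {init : Γ → σ} {l : Γ → List α}
    (hstep : PT fun p : (Γ × σ) × α => step p.1.1 p.1.2 p.2) (hinit : PT init) (hl : PT l)
    (hB : ∃ B : ℕ[X], ∀ g l', l' <+: l g →
      (Enc.enc (l'.foldl (step g) (init g))).size ≤ B.eval (Enc.enc g).size) :
    PT fun g => (l g).foldl (step g) (init g) := by
  obtain ⟨Q, hQ⟩ := hB
  obtain ⟨ql, hql⟩ := hl.size_le
  have hcond : PTe (fun p : Γ × σ × List α => foldState p.1 p.2.1 p.2.2) fun p => Enc.enc p.2.2 :=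
    (PTe.refl _).right.right
  have hbody : PTe (fun p : Γ × σ × α × List α => foldState p.1 p.2.1 (p.2.2.1 :: p.2.2.2))
      fun p => foldState p.1 (step p.1 p.2.1 p.2.2.1) p.2.2.2 := by
    have h1 : PTe (fun p : Γ × σ × α × List α => foldState p.1 p.2.1 (p.2.2.1 :: p.2.2.2))
        fun p => Enc.enc ((p.1, p.2.1), p.2.2.1) :=
      ((PTe.refl _).left.node (PTe.refl _).right.left).node (PTe.refl _).right.right.left
    have h2 := h1.trans (hstep.reindex fun p : Γ × σ × α × List α => ((p.1, p.2.1), p.2.2.1))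
    exact (PTe.refl _).left.node (h2.node (PTe.refl _).right.right.right)
  obtain ⟨B, qB, hB⟩ := hcond
  obtain ⟨P, qP, hP⟩ := hbody
  have hloop : PTe (fun g => foldState g (init g) (l g))
      fun g => foldState g ((l g).foldl (step g) (init g)) ([] : List α) := by
    -- The loop state holds `g`, the accumulator and the remaining list, joined by two inner nodes.
    let qS : ℕ[X] := X + Q + ql + 2
    let qb : ℕ[X] := qB.comp qS + qP.comp qS
    refine ⟨.while B P, (ql + 1) * (2 * qb + qS + 1), fun g => ?_⟩
    have hgl : (Enc.enc g).size ≤ (foldState g (init g) (l g)).size := by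
      simp only [foldState, Tr.size]; omega
    have key := runs_foldl (step := step) (B := B) (P := P) (b := qb.eval (Enc.enc g).size)
      (S := qS.eval (Enc.enc g).size) g
      (fun s l hS => by
        obtain ⟨c, hc, hr⟩ := hB (g, s, l)
        refine ⟨c, hc.trans ((eval_le_eval qB hS).trans ?_), hr⟩
        simp only [qb, eval_add, eval_comp]; omega)
      (fun s a l hS => by
        obtain ⟨c, hc, hr⟩ := hP (g, s, a, l)
        refine ⟨c, hc.trans ((eval_le_eval qP hS).trans ?_), hr⟩
        simp only [qb, eval_add, eval_comp]; omega)
      (l g) (init g) (fun l₁ l₂ h => by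
        have h1 := hQ g l₁ ⟨l₂, h.symm⟩
        have h2 := hql g
        rw [h] at h2
        have h3 : (Enc.enc l₂).size ≤ _ := size_suffix_le (l₁ := l₁)
        simp only [qS, eval_add, eval_X, foldState, Tr.size, eval_ofNat]
        omega)
    obtain ⟨c, hc, hr⟩ := key
    refine ⟨c, hc.trans ?_, hr⟩
    have e1 := eval_le_eval qb hgl
    have e2 := eval_le_eval qS hgl
    have e3 := (length_le_size (l g)).trans ((hql g).trans (eval_le_eval ql hgl))
    simp only [eval_mul, eval_add, eval_one, eval_ofNat]
    exact Nat.mul_le_mul (by omega) (by omega)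
  have hstart : PTe (Enc.enc : Γ → Tr) fun g => foldState g (init g) (l g) :=
    (PTe.refl _).node (hinit.node hl)
  exact (hstart.trans hloop).right.left
end Fold

/-! ### Lists and arithmetic in polynomial time. -/

section Arith
variable {Γ α β γ σ : Type} [Enc Γ] [Enc α] [Enc β] [Enc γ] [Enc σ]

theorem size_cons (a : α) (l : List α) :
    (Enc.enc (a :: l)).size = (Enc.enc a).size + (Enc.enc l).size + 1 := rfl

theorem size_nil : (Enc.enc ([] : List α)).size = 1 := rfl

theorem size_pair (a : α) (b : β) :
    (Enc.enc (a, b)).size = (Enc.enc a).size + (Enc.enc b).size + 1 := rfl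

theorem size_nat (n : ℕ) : (Enc.enc n).size = 2 * n + 1 := size_unary n

theorem size_append (l₁ l₂ : List α) :
    (Enc.enc (l₁ ++ l₂)).size + 1 = (Enc.enc l₁).size + (Enc.enc l₂).size := by
  induction l₁ with
  | nil => simp [size_nil]; omega
  | cons a l ih => simp only [List.cons_append, size_cons]; omega

theorem size_prefix_le {l₁ l₂ : List α} (h : l₁ <+: l₂) : (Enc.enc l₁).size ≤ (Enc.enc l₂).size := by
  obtain ⟨l, rfl⟩ := h
  have := size_append l₁ l
  have := Tr.one_le_size (Enc.enc l)
  omega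

theorem size_le_of_mem {a : α} {l : List α} (h : a ∈ l) : (Enc.enc a).size ≤ (Enc.enc l).size := by
  induction l with
  | nil => simp at h
  | cons b l ih =>
    rcases List.mem_cons.1 h with rfl | h
    · rw [size_cons]; omega
    · rw [size_cons]; have := ih h; omega

-- A number and a list of units are the same tree, so a number can serve as the counter of a loop.
@[fun_prop]
theorem PT.replicate {f : Γ → ℕ} (hf : PT f) : PT fun x => List.replicate (f x) () := by
  refine PT.of_enc hf fun x => ?_
  induction f x with
  | zero => rfl
  | succ n ih =>
    rw [List.replicate_succ]
    change Tr.node Tr.leaf (Enc.enc n) = Tr.node Tr.leaf _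
    rw [ih]; rfl

theorem size_foldl_cons (l : List α) : ∀ s : List α,
    (Enc.enc (l.foldl (fun s a => a :: s) s)).size + 1 = (Enc.enc l).size + (Enc.enc s).size := by
  induction l with
  | nil => intro s; simp [size_nil]; omega
  | cons a l ih => intro s; rw [List.foldl_cons]; have := ih (a :: s); simp only [size_cons] at *; omega

/-- Reversal onto an accumulator, from which reversal and concatenation are derived. -/
theorem PT.foldl_cons {f g : Γ → List α} (hf : PT f) (hg : PT g) :
    PT fun x => (f x).foldl (fun s a => a :: s) (g x) := by
  refine PT.foldl (step := fun _ s a => a :: s) (by fun_prop) hg hf ?_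
  obtain ⟨q, hq⟩ := hf.size_le
  obtain ⟨q', hq'⟩ := hg.size_le
  refine ⟨q + q', fun x l' h => ?_⟩
  have := size_foldl_cons l' (g x)
  have h1 := size_prefix_le h
  have h2 := hq x
  have h3 := hq' x
  rw [eval_add]; omega

theorem foldl_cons_eq (l : List α) : ∀ s, l.foldl (fun s a => a :: s) s = l.reverse ++ s := by
  induction l with
  | nil => simp
  | cons a l ih => intro s; simp [ih]

@[fun_prop]
theorem PT.reverse {f : Γ → List α} (hf : PT f) : PT fun x => (f x).reverse := by
  have := PT.foldl_cons hf (PT.const ([] : List α))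
  simpa only [foldl_cons_eq, List.append_nil] using this

@[fun_prop]
theorem PT.append {f g : Γ → List α} (hf : PT f) (hg : PT g) : PT fun x => f x ++ g x := by
  have := PT.foldl_cons hf.reverse hg
  simpa only [foldl_cons_eq, List.reverse_reverse] using this

theorem size_flatMap_le (f : α → List β) (S : ℕ) (l : List α)
    (h : ∀ a ∈ l, (Enc.enc (f a)).size ≤ S) :
    (Enc.enc (l.flatMap f)).size ≤ l.length * S + 1 := by
  induction l with
  | nil => simp [size_nil]
  | cons a l ih =>
    have h1 := ih fun b hb => h b (List.mem_cons_of_mem _ hb)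
    have h2 := h a List.mem_cons_self
    have h3 := size_append (f a) (l.flatMap f)
    rw [List.flatMap_cons, List.length_cons, Nat.add_mul]
    omega

theorem foldl_append_eq (f : α → List β) (l : List α) : ∀ s,
    l.foldl (fun s a => s ++ f a) s = s ++ l.flatMap f := by
  induction l with
  | nil => simp
  | cons a l ih => intro s; simp [ih, List.flatMap_cons]

@[fun_prop]
theorem PT.flatMap {l : Γ → List α} {f : Γ → α → List β} (hl : PT l)
    (hf : PT fun p : Γ × α => f p.1 p.2) : PT fun x => (l x).flatMap (f x) := by
  have key : PT fun x => (l x).foldl (fun s a => s ++ f x a) [] := by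
    refine PT.foldl (step := fun x s a => s ++ f x a) ?_ (PT.const _) hl ?_
    · have h2 : PT fun p : (Γ × List β) × α => f p.1.1 p.2 :=
        hf.comp (f := fun p : (Γ × List β) × α => (p.1.1, p.2)) (by fun_prop)
      fun_prop
    · obtain ⟨q, hq⟩ := hl.size_le
      obtain ⟨q', hq'⟩ := hf.size_le
      -- An element of the list is no larger than the list, so the pair of `x` and the element has
      -- size at most `|x| + q + 1`.
      refine ⟨q * q'.comp (X + q + 1) + 1, fun x l' h => ?_⟩
      have h0 := hq x
      have h1 := size_prefix_le h
      rw [foldl_append_eq, List.nil_append]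
      refine (size_flatMap_le (f x) ((q'.comp (X + q + 1)).eval (Enc.enc x).size) l' ?_).trans ?_
      · intro a ha
        refine (hq' (x, a)).trans ?_
        rw [eval_comp]
        refine eval_le_eval _ ?_
        have := size_le_of_mem ha
        rw [size_pair]
        simp only [eval_add, eval_X, eval_one]
        omega
      · rw [eval_add, eval_mul, eval_one]
        have := length_le_size l'
        exact Nat.add_le_add_right (Nat.mul_le_mul_right _ (by omega)) _
  simpa only [foldl_append_eq, List.nil_append] using key

@[fun_prop]
theorem PT.map {l : Γ → List α} {f : Γ → α → β} (hl : PT l)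
    (hf : PT fun p : Γ × α => f p.1 p.2) : PT fun x => (l x).map (f x) := by
  have : PT fun x => (l x).flatMap fun a => [f x a] := by fun_prop
  simpa only [← List.map_eq_flatMap] using this

theorem PT.iterate {step : Γ → σ → σ} {init : Γ → σ} {m : Γ → ℕ}
    (hstep : PT fun p : Γ × σ => step p.1 p.2) (hinit : PT init) (hm : PT m)
    (hB : ∃ B : ℕ[X], ∀ g i, i ≤ m g →
      (Enc.enc ((step g)^[i] (init g))).size ≤ B.eval (Enc.enc g).size) :
    PT fun g => (step g)^[m g] (init g) := by
  have e : ∀ (g : Γ) (l : List Unit) (s : σ),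
      l.foldl (fun s _ => step g s) s = (step g)^[l.length] s := by
    intro g l
    induction l with
    | nil => intro s; rfl
    | cons a l ih => intro s; simp [ih]
  have := PT.foldl (step := fun g s (_ : Unit) => step g s) (init := init)
    (l := fun g => List.replicate (m g) ())
    (hstep.comp (f := fun p : (Γ × σ) × Unit => (p.1.1, p.1.2)) (by fun_prop)) hinit (by fun_prop) (by
      obtain ⟨B, hB⟩ := hB
      refine ⟨B, fun g l' h => ?_⟩
      rw [e]
      exact hB _ _ (by simpa using h.length_le))
  simpa only [e, List.length_replicate] using this

@[fun_prop]
theorem PT.add {f g : Γ → ℕ} (hf : PT f) (hg : PT g) : PT fun x => f x + g x := by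
  have e : ∀ i a, (fun s : ℕ => s + 1)^[i] a = a + i := by
    intro i a; simp
  have : PT fun x => (fun s : ℕ => s + 1)^[g x] (f x) := by
    refine PT.iterate (step := fun _ s => s + 1) (by fun_prop) hf hg ?_
    obtain ⟨q, hq⟩ := hf.size_le
    obtain ⟨q', hq'⟩ := hg.size_le
    refine ⟨q + q', fun x i hi => ?_⟩
    have h1 := hq x
    have h2 := hq' x
    rw [e]
    simp only [size_nat, eval_add] at *
    omega
  simpa only [e] using this

@[fun_prop]
theorem PT.sub {f g : Γ → ℕ} (hf : PT f) (hg : PT g) : PT fun x => f x - g x := by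
  have e : ∀ i a, (fun s : ℕ => s - 1)^[i] a = a - i := by
    intro i
    induction i with
    | zero => intro a; rfl
    | succ i ih => intro a; rw [Function.iterate_succ_apply, ih]; omega
  have : PT fun x => (fun s : ℕ => s - 1)^[g x] (f x) := by
    refine PT.iterate (step := fun _ s => s - 1) (by fun_prop) hf hg ?_
    obtain ⟨q, hq⟩ := hf.size_le
    refine ⟨q, fun x i hi => ?_⟩
    have h1 := hq x
    rw [e]
    simp only [size_nat] at *
    omega
  simpa only [e] using this

@[fun_prop]
theorem PT.mul {f g : Γ → ℕ} (hf : PT f) (hg : PT g) : PT fun x => f x * g x := by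
  have e : ∀ b i a, (fun s : ℕ => s + b)^[i] a = a + b * i := by
    intro b i
    induction i with
    | zero => intro a; rfl
    | succ i ih => intro a; rw [Function.iterate_succ_apply, ih]; ring
  have : PT fun x => (fun s : ℕ => s + f x)^[g x] 0 := by
    refine PT.iterate (step := fun x s => s + f x) (by fun_prop) (PT.const _) hg ?_
    obtain ⟨q, hq⟩ := hf.size_le
    obtain ⟨q', hq'⟩ := hg.size_le
    refine ⟨2 * (q * q') + 1, fun x i hi => ?_⟩
    have h1 := hq x
    have h2 := hq' x
    rw [e]
    simp only [size_nat, eval_add, eval_mul, eval_ofNat, eval_one] at *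
    have := Nat.mul_le_mul (show f x ≤ q.eval (Enc.enc x).size by omega)
      (show i ≤ q'.eval (Enc.enc x).size by omega)
    omega
  simpa only [e, zero_add] using this

@[fun_prop]
theorem PT.polyEval {f : Γ → ℕ} (q : ℕ[X]) (hf : PT f) : PT fun x => q.eval (f x) := by
  induction q using Polynomial.induction_on' with
  | add p q hp hq => simp only [eval_add]; fun_prop
  | monomial k a =>
    simp only [eval_monomial]
    refine PT.mul (PT.const a) ?_
    induction k with
    | zero => simp only [pow_zero]; fun_prop
    | succ k ih => simp only [pow_succ]; fun_prop

theorem range_iterate (i : ℕ) :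
    (fun s : ℕ × List ℕ => (s.1 + 1, s.1 :: s.2))^[i] (0, []) = (i, (List.range i).reverse) := by
  induction i with
  | zero => rfl
  | succ i ih => rw [Function.iterate_succ_apply', ih, List.range_succ]; simp

theorem size_range_reverse (i : ℕ) : (Enc.enc (List.range i).reverse).size ≤ i * (2 * i + 2) + 1 := by
  induction i with
  | zero => simp [size_nil]
  | succ i ih =>
    rw [List.range_succ, List.reverse_append]
    simp only [List.reverse_cons, List.reverse_nil, List.nil_append, List.singleton_append, size_cons,
      size_nat]
    nlinarith

@[fun_prop]
theorem PT.range {f : Γ → ℕ} (hf : PT f) : PT fun x => List.range (f x) := by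
  have : PT fun x => (fun s : ℕ × List ℕ => (s.1 + 1, s.1 :: s.2))^[f x] (0, []) := by
    refine PT.iterate (step := fun _ s => (s.1 + 1, s.1 :: s.2)) (by fun_prop) (PT.const _) hf ?_
    obtain ⟨q, hq⟩ := hf.size_le
    refine ⟨q * (2 * q + 2) + 2 * q + 5, fun x i hi => ?_⟩
    rw [range_iterate]
    have h1 := hq x
    have h2 := size_range_reverse i
    simp only [size_pair, size_nat, eval_add, eval_mul, eval_ofNat] at *
    have h3 : i ≤ q.eval (Enc.enc x).size := by omega
    have h4 := Nat.mul_le_mul h3 (show 2 * i + 2 ≤ 2 * q.eval (Enc.enc x).size + 2 by omega)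
    omega
  simp only [range_iterate] at this
  have h2 : PT fun x => (List.range (f x)).reverse.reverse := (PT.snd.comp this).reverse
  simpa only [List.reverse_reverse] using h2

/-- A bit alternates at every step and the quotient grows whenever the bit falls back, so one count
delivers quotient and remainder together. -/
theorem half_iterate (i : ℕ) :
    (fun s : ℕ × Bool => (if s.2 = true then s.1 + 1 else s.1, if s.2 = true then false else true))^[i]
      (0, false) = (i / 2, decide (i % 2 = 1)) := by
  induction i with
  | zero => rfl
  | succ i ih =>
    rw [Function.iterate_succ_apply', ih]
    rcases Nat.mod_two_eq_zero_or_one i with h | h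
    · have h1 : (i + 1) / 2 = i / 2 := by omega
      have h2 : (i + 1) % 2 = 1 := by omega
      simp [h, h1, h2]
    · have h1 : (i + 1) / 2 = i / 2 + 1 := by omega
      have h2 : (i + 1) % 2 = 0 := by omega
      simp [h, h1, h2]

theorem PT.halfMod {f : Γ → ℕ} (hf : PT f) : PT fun x => (f x / 2, decide (f x % 2 = 1)) := by
  have : PT fun x => (fun s : ℕ × Bool =>
      (if s.2 = true then s.1 + 1 else s.1, if s.2 = true then false else true))^[f x] (0, false) := by
    refine PT.iterate (step := fun _ (s : ℕ × Bool) =>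
      (if s.2 = true then s.1 + 1 else s.1, if s.2 = true then false else true))
      (by fun_prop) (PT.const _) hf ?_
    obtain ⟨q, hq⟩ := hf.size_le
    refine ⟨q + 5, fun x i hi => ?_⟩
    rw [half_iterate]
    have h1 := hq x
    have h2 : (Enc.enc (decide (i % 2 = 1))).size ≤ 3 := by
      by_cases h : i % 2 = 1 <;> simp [h, Enc.enc, Tr.size]
    simp only [size_pair, size_nat, eval_add, eval_ofNat] at *
    omega
  simpa only [half_iterate] using this

@[fun_prop]
theorem PT.half {f : Γ → ℕ} (hf : PT f) : PT fun x => f x / 2 := PT.fst.comp hf.halfMod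

@[fun_prop]
theorem PT.mod_two {f : Γ → ℕ} (hf : PT f) : PT fun x => f x % 2 := by
  have h : PT fun x => if decide (f x % 2 = 1) = true then 1 else 0 :=
    PT.ite (PT.snd.comp hf.halfMod) (PT.const 1) (PT.const 0)
  have e : ∀ x, (if decide (f x % 2 = 1) = true then 1 else 0) = f x % 2 := by
    intro x
    rcases Nat.mod_two_eq_zero_or_one (f x) with h | h <;> simp [h]
  simpa only [e] using h

@[fun_prop]
theorem PT.decide_pos {f : Γ → ℕ} (hf : PT f) : PT fun x => decide (0 < f x) := by
  have h : PT fun x => (Enc.enc (f x)).isNode := by fun_prop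
  have e : ∀ n : ℕ, (Enc.enc n).isNode = decide (0 < n) := by
    intro n; cases n <;> rfl
  simpa only [e] using h

/-- One halving step of the computation of the binary logarithm. -/
def logStep (s : ℕ × ℕ) : ℕ × ℕ :=
  if decide (0 < s.2 / 2) = true then (s.1 + 1, s.2 / 2) else s

/-- A halving trades one unit of the logarithm for one unit of the counter, so their sum is
invariant. The number decreases as long as it exceeds `1`; after `n` steps it is at most `1` and its
logarithm is `0`. -/
theorem logStep_iterate (i n : ℕ) : (logStep^[i] (0, n)).1 + Nat.log 2 (logStep^[i] (0, n)).2 = Nat.log 2 n ∧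
    (logStep^[i] (0, n)).2 ≤ max 1 (n - i) := by
  induction i with
  | zero => simp
  | succ i ih =>
    rw [Function.iterate_succ_apply']
    set s := logStep^[i] (0, n)
    unfold logStep
    by_cases h : 0 < s.2 / 2
    · simp only [h, decide_true, if_true]
      refine ⟨?_, by omega⟩
      have := Nat.log_of_one_lt_of_le (b := 2) (n := s.2) (by norm_num) (by omega)
      omega
    · simp only [h, decide_false, Bool.false_eq_true, if_false]
      exact ⟨ih.1, by omega⟩

@[fun_prop]
theorem PT.log {f : Γ → ℕ} (hf : PT f) : PT fun x => Nat.log 2 (f x) := by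
  have : PT fun x => logStep^[f x] (0, f x) := by
    refine PT.iterate (step := fun _ => logStep) (by unfold logStep; fun_prop) (by fun_prop) hf ?_
    obtain ⟨q, hq⟩ := hf.size_le
    refine ⟨2 * q + 5, fun x i hi => ?_⟩
    have h1 := hq x
    have h2 := logStep_iterate i (f x)
    have h3 := Nat.log_le_self 2 (f x)
    rw [← Prod.mk.eta (p := logStep^[i] (0, f x)), size_pair]
    simp only [size_nat, eval_add, eval_mul, eval_ofNat] at *
    omega
  have e : ∀ n, (logStep^[n] (0, n)).1 = Nat.log 2 n := by
    intro n
    have h := logStep_iterate n n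
    have : Nat.log 2 (logStep^[n] (0, n)).2 = 0 := Nat.log_of_lt (by omega)
    omega
  have h2 : PT fun x => (logStep^[f x] (0, f x)).1 := PT.fst.comp this
  simpa only [e] using h2

@[fun_prop]
theorem PT.depth {f : Γ → ℕ} (hf : PT f) : PT fun x => depth (f x) := by
  unfold QSig.depth
  simp only [sq]
  fun_prop

/-- The number of nodes on the right spine of a tree. -/
def Tr.toNat : Tr → ℕ
  | .leaf => 0
  | .node _ b => b.toNat + 1

/-- The list of the left subtrees along the right spine of a tree. -/
def Tr.toList : Tr → List Tr
  | .leaf => []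
  | .node a b => a :: b.toList

theorem Tr.enc_toList (T : Tr) : Enc.enc T.toList = T := by
  induction T with
  | leaf => rfl
  | node a b _ hb =>
    change Tr.node a (Enc.enc b.toList) = _
    rw [hb]

@[fun_prop]
theorem PT.toList {f : Γ → Tr} (hf : PT f) : PT fun x => (f x).toList :=
  PT.of_enc hf fun x => (f x).enc_toList.symm

@[fun_prop]
theorem PT.toNat {f : Γ → Tr} (hf : PT f) : PT fun x => (f x).toNat := by
  have h : PT fun x => ((f x).toList.map fun _ => ()) := by fun_prop
  refine PT.of_enc h fun x => ?_
  induction f x with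
  | leaf => rfl
  | node a b _ hb =>
    change Tr.node Tr.leaf (Enc.enc (b.toList.map fun _ => ())) = Tr.node Tr.leaf _
    rw [hb]; rfl

theorem Tr.toNat_enc (n : ℕ) : (Enc.enc n).toNat = n := by
  induction n with
  | zero => rfl
  | succ n ih => exact congrArg (· + 1) ih

theorem Tr.toList_enc (l : List α) : (Enc.enc l).toList = l.map Enc.enc := by
  induction l with
  | nil => rfl
  | cons a l ih => exact congrArg (Enc.enc a :: ·) ih

/-- The list does not depend on the input, so the loop is unrolled into the program, and `f i` need
not be computable as a function of `i`. -/
theorem PT.flatMap_const {ι : Type} (l : List ι) {f : ι → Γ → List β} (hf : ∀ i, PT (f i)) :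
    PT fun x => l.flatMap fun i => f i x := by
  induction l with
  | nil => simp only [List.flatMap_nil]; fun_prop
  | cons i l ih =>
    simp only [List.flatMap_cons]
    exact PT.append (hf i) ih
end Arith

/-! ### The action of circuits on states -/

section Action

variable {G : GateSet} {W W' : Type} [DecidableEq W] [DecidableEq W']

/-- The action of a gate on a state. -/
noncomputable def GateApp.act (a : GateApp G W) (ψ : (W → Bool) → ℂ) : (W → Bool) → ℂ :=
  match a with
  | .one g i => fun x => ∑ b, G.one g (x i) b * ψ (Function.update x i b)
  | .two g i j _ => fun x => ∑ b, ∑ b', G.two g (x i, x j) (b, b') *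
      ψ (Function.update (Function.update x i b) j b')

/-- The action of a circuit on a state. -/
noncomputable def act : List (GateApp G W) → ((W → Bool) → ℂ) → (W → Bool) → ℂ
  | [], ψ => ψ
  | a :: L, ψ => act L (a.act ψ)

theorem act_nil (ψ : (W → Bool) → ℂ) : act ([] : List (GateApp G W)) ψ = ψ := rfl

theorem act_cons (a : GateApp G W) (L) (ψ : (W → Bool) → ℂ) : act (a :: L) ψ = act L (a.act ψ) := rfl

theorem act_append (L L' : List (GateApp G W)) : ∀ ψ : (W → Bool) → ℂ,
    act (L ++ L') ψ = act L' (act L ψ) := by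
  induction L with
  | nil => intro ψ; rfl
  | cons a L ih => intro ψ; exact ih _

/-- Row `x` of the matrix is supported on the assignments that agree with `x` off the wires of the
gate. These are exactly the updates of `x` at those wires. -/
theorem GateApp.mat_mulVec [Fintype W] (a : GateApp G W) (ψ : (W → Bool) → ℂ) :
    a.mat *ᵥ ψ = a.act ψ := by
  funext x
  cases a with
  | one g i =>
    simp only [mulVec, dotProduct, GateApp.mat, GateApp.act, of_apply, ite_mul, zero_mul]
    rw [← Finset.sum_filter]
    refine (Finset.sum_bij' (fun b _ => Function.update x i b) (fun y _ => y i) ?_ ?_ ?_ ?_ ?_).symm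
    · intro b _
      simp only [Finset.mem_filter, Finset.mem_univ, true_and]
      intro w hw
      rw [Function.update_of_ne hw]
    · intros; simp
    · intros; simp
    · intro y hy
      simp only [Finset.mem_filter, Finset.mem_univ, true_and] at hy
      funext w
      by_cases h : w = i
      · subst h; simp
      · rw [Function.update_of_ne h, hy w h]
    · intros; simp
  | two g i j hij =>
    simp only [mulVec, dotProduct, GateApp.mat, GateApp.act, of_apply, ite_mul, zero_mul]
    rw [← Finset.sum_filter, ← Fintype.sum_prod_type']
    refine (Finset.sum_bij' (fun b _ => Function.update (Function.update x i b.1) j b.2)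
      (fun y _ => (y i, y j)) ?_ ?_ ?_ ?_ ?_).symm
    · intro b _
      simp only [Finset.mem_filter, Finset.mem_univ, true_and]
      intro w hw hw'
      rw [Function.update_of_ne hw', Function.update_of_ne hw]
    · intros; simp
    · intros; simp [Function.update_of_ne hij]
    · intro y hy
      simp only [Finset.mem_filter, Finset.mem_univ, true_and] at hy
      funext w
      by_cases h' : w = j
      · subst h'; simp
      · rw [Function.update_of_ne h']
        by_cases h : w = i
        · subst h; simp
        · rw [Function.update_of_ne h, hy w h h']
    · intros; simp [Function.update_of_ne hij]

theorem circMat_mulVec [Fintype W] (L : List (GateApp G W)) : ∀ ψ : (W → Bool) → ℂ,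
    circMat L *ᵥ ψ = act L ψ := by
  induction L with
  | nil => intro ψ; simp [circMat, act]
  | cons a L ih => intro ψ; rw [circMat, ← mulVec_mulVec, ih, a.mat_mulVec, act_cons]

/-- Renaming of the wires of a gate. -/
def GateApp.map (f : W → W') (hf : Function.Injective f) : GateApp G W → GateApp G W'
  | .one g i => .one g (f i)
  | .two g i j h => .two g (f i) (f j) (hf.ne h)

/-- Renaming of the wires of a circuit. -/
def relabel (f : W → W') (hf : Function.Injective f) (L : List (GateApp G W)) : List (GateApp G W') :=
  L.map (GateApp.map f hf)

/-- `χ` does not depend on the wires in the range of `f`. -/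
def IndepOf (f : W → W') (χ : (W' → Bool) → ℂ) : Prop :=
  ∀ x i b, χ (Function.update x (f i) b) = χ x

theorem GateApp.act_map (f : W → W') (hf : Function.Injective f) (a : GateApp G W)
    (φ : (W → Bool) → ℂ) {χ : (W' → Bool) → ℂ} (hχ : IndepOf f χ) :
    (a.map f hf).act (fun x => φ (x ∘ f) * χ x) = fun x => a.act φ (x ∘ f) * χ x := by
  have hu : ∀ (x : W' → Bool) i b, Function.update x (f i) b ∘ f = Function.update (x ∘ f) i b :=
    fun x i b => Function.update_comp_eq_of_injective x hf i b
  funext x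
  cases a with
  | one g i =>
    simp only [GateApp.map, GateApp.act, hu, hχ x, Finset.sum_mul, mul_assoc, Function.comp]
  | two g i j h =>
    simp only [GateApp.map, GateApp.act, hu, hχ _, Finset.sum_mul, mul_assoc, Function.comp]

/-- A factor that is independent of the wires of the circuit is carried along like a scalar. This is
how circuits on a block, or the circuit of the forger, are run inside a larger register. -/
theorem act_relabel (f : W → W') (hf : Function.Injective f) (L : List (GateApp G W))
    {χ : (W' → Bool) → ℂ} (hχ : IndepOf f χ) : ∀ φ : (W → Bool) → ℂ,
    act (relabel f hf L) (fun x => φ (x ∘ f) * χ x) = fun x => act L φ (x ∘ f) * χ x := by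
  induction L with
  | nil => intro φ; rfl
  | cons a L ih =>
    intro φ
    rw [relabel, List.map_cons, act_cons, a.act_map f hf φ hχ]
    exact ih _

theorem relabel_append (f : W → W') (hf : Function.Injective f) (L L' : List (GateApp G W)) :
    relabel f hf (L ++ L') = relabel f hf L ++ relabel f hf L' := List.map_append

theorem relabel_flatMap {ι : Type} (f : W → W') (hf : Function.Injective f) (l : List ι)
    (F : ι → List (GateApp G W)) :
    relabel f hf (l.flatMap F) = l.flatMap fun i => relabel f hf (F i) := List.map_flatMap

theorem relabel_relabel {W'' : Type} [DecidableEq W''] (f : W → W') (hf : Function.Injective f)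
    (g : W' → W'') (hg : Function.Injective g) (L : List (GateApp G W)) :
    relabel g hg (relabel f hf L) = relabel (g ∘ f) (hg.comp hf) L := by
  rw [relabel, relabel, relabel, List.map_map]
  congr 1
  funext a
  cases a <;> rfl

/-- Renaming by a permutation conjugates the action. -/
theorem act_relabel_perm (σ : Equiv.Perm W) (L : List (GateApp G W)) (ψ : (W → Bool) → ℂ) :
    act (relabel σ σ.injective L) ψ = fun x => act L (fun y => ψ (y ∘ σ.symm)) (x ∘ σ) := by
  have h := act_relabel σ σ.injective L (χ := fun _ => 1) (fun _ _ _ => rfl) fun y => ψ (y ∘ σ.symm)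
  have e : (fun x : W → Bool => ψ ((x ∘ σ) ∘ σ.symm) * 1) = ψ := by
    funext x
    rw [mul_one]
    congr 1
    funext w; simp
  rw [e] at h
  rw [h]
  funext x; rw [mul_one]

theorem GateApp.act_smul (a : GateApp G W) (z : ℂ) (ψ : (W → Bool) → ℂ) :
    a.act (fun x => z * ψ x) = fun x => z * a.act ψ x := by
  funext x
  cases a <;> simp only [GateApp.act, Finset.mul_sum] <;>
    refine Finset.sum_congr rfl fun b _ => ?_
  · ring
  · refine Finset.sum_congr rfl fun b' _ => ?_
    ring

theorem act_smul (L : List (GateApp G W)) (z : ℂ) : ∀ ψ : (W → Bool) → ℂ,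
    act L (fun x => z * ψ x) = fun x => z * act L ψ x := by
  induction L with
  | nil => intro ψ; rfl
  | cons a L ih => intro ψ; rw [act_cons, a.act_smul, ih]; rfl

end Action

/-! ### Unitarity -/

section Unitary

variable {G : GateSet} {W : Type} [Fintype W] [DecidableEq W]

theorem GateApp.mat_conjTranspose_one (g : Fin G.num1) (i : W) :
    (GateApp.one g i : GateApp G W).matᴴ = (GateApp.one (G.inv1 g) i : GateApp G W).mat := by
  ext x y
  simp only [conjTranspose_apply, GateApp.mat, of_apply, G.one_inv]
  by_cases h : ∀ w, w ≠ i → y w = x w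
  · rw [if_pos h, if_pos fun w hw => (h w hw).symm]
  · rw [if_neg h, if_neg fun h' => h fun w hw => (h' w hw).symm, star_zero]

theorem GateApp.mat_conjTranspose_two (g : Fin G.num2) (i j : W) (hij : i ≠ j) :
    (GateApp.two g i j hij : GateApp G W).matᴴ = (GateApp.two (G.inv2 g) i j hij : GateApp G W).mat := by
  ext x y
  simp only [conjTranspose_apply, GateApp.mat, of_apply, G.two_inv]
  by_cases h : ∀ w, w ≠ i → w ≠ j → y w = x w
  · rw [if_pos h, if_pos fun w hw hw' => (h w hw hw').symm]
  · rw [if_neg h, if_neg fun h' => h fun w hw hw' => (h' w hw hw').symm, star_zero]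

/-- The inverse gate. -/
def GateApp.inv {W : Type} : GateApp G W → GateApp G W
  | .one g i => .one (G.inv1 g) i
  | .two g i j h => .two (G.inv2 g) i j h

theorem GateApp.mat_inv (a : GateApp G W) : a.inv.mat = a.matᴴ := by
  cases a with
  | one g i => exact (GateApp.mat_conjTranspose_one g i).symm
  | two g i j h => exact (GateApp.mat_conjTranspose_two g i j h).symm

theorem GateApp.act_inv_act (a : GateApp G W) (ψ : (W → Bool) → ℂ) : a.inv.act (a.act ψ) = ψ := by
  funext x
  cases a with
  | one g i =>
    have hu := (Matrix.mem_unitaryGroup_iff').1 (G.one_unitary g)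
    simp only [GateApp.inv, GateApp.act, Function.update_idem, Function.update_self, Finset.mul_sum]
    rw [Finset.sum_comm]
    have : ∀ b', ∑ b, G.one (G.inv1 g) (x i) b * (G.one g b b' * ψ (Function.update x i b')) =
        (1 : Matrix Bool Bool ℂ) (x i) b' * ψ (Function.update x i b') := by
      intro b'
      rw [← hu, star_eq_conjTranspose, ← G.one_inv, Matrix.mul_apply, Finset.sum_mul]
      simp only [mul_assoc]
    simp only [this, Matrix.one_apply, ite_mul, one_mul, zero_mul]
    rw [Finset.sum_ite_eq]
    simp
  | two g i j h =>
    have hu := (Matrix.mem_unitaryGroup_iff').1 (G.two_unitary g)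
    have hup : ∀ b b' c c', Function.update (Function.update (Function.update (Function.update x i b) j b') i c) j c'
        = Function.update (Function.update x i c) j c' := by
      intro b b' c c'
      funext w
      by_cases hj : w = j
      · subst hj; simp
      · by_cases hi : w = i
        · subst hi; simp [Function.update_of_ne hj]
        · simp [Function.update_of_ne hj, Function.update_of_ne hi]
    have hi : ∀ b b', Function.update (Function.update x i b) j b' i = b := by
      intro b b'; rw [Function.update_of_ne h, Function.update_self]
    simp only [GateApp.inv, GateApp.act, hup, hi, Function.update_self, ← Fintype.sum_prod_type']
    simp only [Finset.mul_sum]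
    rw [Finset.sum_comm]
    have : ∀ c : Bool × Bool, ∑ b : Bool × Bool, G.two (G.inv2 g) (x i, x j) (b.1, b.2) *
        (G.two g (b.1, b.2) (c.1, c.2) * ψ (Function.update (Function.update x i c.1) j c.2)) =
        (1 : Matrix (Bool × Bool) (Bool × Bool) ℂ) (x i, x j) c *
          ψ (Function.update (Function.update x i c.1) j c.2) := by
      intro c
      rw [← hu, star_eq_conjTranspose, ← G.two_inv, Matrix.mul_apply, Finset.sum_mul]
      simp only [mul_assoc, Prod.mk.eta]
    simp only [this, Matrix.one_apply, ite_mul, one_mul, zero_mul]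
    rw [Finset.sum_ite_eq]
    simp

theorem GateApp.mat_unitary (a : GateApp G W) : a.matᴴ * a.mat = 1 := by
  rw [← a.mat_inv]
  apply Matrix.ext_of_mulVec_single
  intro x
  rw [← mulVec_mulVec, a.mat_mulVec, a.inv.mat_mulVec, a.act_inv_act, one_mulVec]

theorem circMat_unitary (L : List (GateApp G W)) : (circMat L)ᴴ * circMat L = 1 := by
  induction L with
  | nil => simp [circMat]
  | cons a L ih =>
    rw [circMat, conjTranspose_mul, Matrix.mul_assoc, ← Matrix.mul_assoc _ (circMat L), ih,
      Matrix.one_mul, a.mat_unitary]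

theorem sum_norm_sq_eq (ψ : (W → Bool) → ℂ) :
    ((∑ x, ‖ψ x‖ ^ 2 : ℝ) : ℂ) = star ψ ⬝ᵥ ψ := by
  simp only [dotProduct, Pi.star_apply, Complex.ofReal_sum]
  refine Finset.sum_congr rfl fun x _ => ?_
  rw [RCLike.star_def, Complex.conj_mul']
  push_cast; rfl

theorem sum_norm_sq_mulVec {U : Matrix (W → Bool) (W → Bool) ℂ} (hU : Uᴴ * U = 1)
    (ψ : (W → Bool) → ℂ) : ∑ x, ‖(U *ᵥ ψ) x‖ ^ 2 = ∑ x, ‖ψ x‖ ^ 2 := by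
  apply Complex.ofReal_injective
  rw [sum_norm_sq_eq, sum_norm_sq_eq, star_mulVec, ← dotProduct_mulVec, mulVec_mulVec, hU, one_mulVec]

theorem sum_norm_sq_act (L : List (GateApp G W)) (ψ : (W → Bool) → ℂ) :
    ∑ x, ‖act L ψ x‖ ^ 2 = ∑ x, ‖ψ x‖ ^ 2 := by
  rw [← circMat_mulVec, sum_norm_sq_mulVec (circMat_unitary L)]

end Unitary

/-! ### Reversible gadgets over the gate set -/

section Gadgets

variable (G : GateSet) {W : Type} [DecidableEq W]

noncomputable def hIdx : Fin G.num1 := G.has_h.choose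
noncomputable def sIdx : Fin G.num1 := G.has_s.choose
noncomputable def tIdx : Fin G.num1 := G.has_t.choose
noncomputable def cnotIdx : Fin G.num2 := G.has_cnot.choose

theorem one_hIdx : G.one (hIdx G) = hGate := G.has_h.choose_spec
theorem one_sIdx : G.one (sIdx G) = sGate := G.has_s.choose_spec
theorem one_tIdx : G.one (tIdx G) = tGate := G.has_t.choose_spec
theorem two_cnotIdx : G.two (cnotIdx G) = cnotGate := G.has_cnot.choose_spec

/-- A CNOT gate, or nothing if the wires agree. -/
noncomputable def cnot (i j : W) : List (GateApp G W) :=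
  if h : i ≠ j then [.two (cnotIdx G) i j h] else []

/-- A doubly controlled phase flip. -/
noncomputable def ccz (a b c : W) : List (GateApp G W) :=
  [.one (tIdx G) a, .one (tIdx G) b, .one (tIdx G) c] ++
  (cnot G a b ++ [.one (G.inv1 (tIdx G)) b] ++ cnot G a b) ++
  (cnot G b c ++ [.one (G.inv1 (tIdx G)) c] ++ cnot G b c) ++
  (cnot G a c ++ [.one (G.inv1 (tIdx G)) c] ++ cnot G a c) ++
  (cnot G a c ++ (cnot G b c ++ [.one (tIdx G) c] ++ cnot G b c) ++ cnot G a c)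

/-- A swap of `a` and `b` that is controlled by `c`. -/
noncomputable def cswap (c a b : W) : List (GateApp G W) :=
  cnot G b a ++ ([.one (hIdx G) b] ++ ccz G c a b ++ [.one (hIdx G) b]) ++ cnot G b a

/-- A bit flip. -/
noncomputable def notGate (i : W) : List (GateApp G W) :=
  [.one (hIdx G) i, .one (sIdx G) i, .one (sIdx G) i, .one (hIdx G) i]

/-- A swap. -/
noncomputable def swapGate (a b : W) : List (GateApp G W) :=
  cnot G a b ++ cnot G b a ++ cnot G a b

variable {G}

theorem act_cnot {i j : W} (h : i ≠ j) (ψ : (W → Bool) → ℂ) :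
    act (cnot G i j) ψ = fun x => ψ (Function.update x j (xor (x i) (x j))) := by
  funext x
  rw [cnot, dif_pos h, act_cons, act_nil]
  simp only [GateApp.act, two_cnotIdx, cnotGate, of_apply]
  have h1 : ∀ b, Function.update (Function.update x i (x i)) j b = Function.update x j b := by
    intro b; rw [Function.update_eq_self]
  cases hi : x i <;> cases hj : x j <;> rw [hi] at h1 <;> simp [h1]

theorem act_one_diagonal {g : Fin G.num1} {d : Bool → ℂ} (hg : G.one g = Matrix.diagonal d) (i : W)
    (ψ : (W → Bool) → ℂ) : act [GateApp.one g i] ψ = fun x => d (x i) * ψ x := by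
  funext x
  rw [act_cons, act_nil]
  simp [GateApp.act, hg, Matrix.diagonal_apply]

/-- Conjugation by `CNOT` makes a diagonal gate on `j` read the parity of `i` and `j` instead. The
phase polynomial of `ccz` is assembled from such parities. -/
theorem act_cnot_conj {i j : W} (h : i ≠ j) {L : List (GateApp G W)} {m : (W → Bool) → ℂ}
    (hL : ∀ ψ, act L ψ = fun x => m x * ψ x) (ψ : (W → Bool) → ℂ) :
    act (cnot G i j ++ L ++ cnot G i j) ψ =
      fun x => m (Function.update x j (xor (x i) (x j))) * ψ x := by
  rw [act_append, act_append, act_cnot h, act_cnot h, hL]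
  funext x
  simp [Function.update_of_ne h]

/-- The phases of the `T` gate. -/
noncomputable def tPhase (b : Bool) : ℂ := if b then Complex.exp (Complex.I * (Real.pi / 4)) else 1

theorem one_tIdx_diagonal : G.one (tIdx G) = Matrix.diagonal tPhase := one_tIdx G

theorem one_inv_tIdx_diagonal : G.one (G.inv1 (tIdx G)) = Matrix.diagonal (star tPhase) := by
  rw [G.one_inv, one_tIdx_diagonal, Matrix.diagonal_conjTranspose]

theorem tPhase_pow_four : tPhase true ^ 4 = -1 := by
  simp only [tPhase, if_true]
  rw [← Complex.exp_nat_mul, ← Complex.exp_pi_mul_I]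
  congr 1
  push_cast; ring

theorem star_tPhase_mul : star (tPhase true) * tPhase true = 1 := by
  simp only [tPhase, if_true]
  rw [RCLike.star_def, ← Complex.exp_conj, ← Complex.exp_add]
  simp [← Complex.ofReal_ofNat, ← Complex.ofReal_div]

/-- For bits, `a + b + c - (a⊕b) - (b⊕c) - (a⊕c) + (a⊕b⊕c) = 4abc`, and the fourth power of the
phase of `T` is `-1`. -/
theorem phase_identity (a b c : Bool) :
    tPhase c * (tPhase b * tPhase a) * (star tPhase) (xor a b) * (star tPhase) (xor b c) *
      (star tPhase) (xor a c) * tPhase (xor b (xor a c)) = if a && b && c then -1 else 1 := by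
  have e4 := tPhase_pow_four
  have e1 := star_tPhase_mul
  have e0 : tPhase false = 1 := rfl
  cases a <;> cases b <;> cases c <;>
    simp only [Bool.xor_false, Bool.xor_true, Bool.not_true, Bool.not_false,
      Bool.and_true, Bool.and_false, Pi.star_apply, e0, star_one, one_mul, mul_one, if_true,
      Bool.false_eq_true, if_false]
  all_goals
    first
      | linear_combination (tPhase true * star (tPhase true) + 1) * e1
      | linear_combination e4

theorem act_ccz {a b c : W} (hab : a ≠ b) (hac : a ≠ c) (hbc : b ≠ c) (ψ : (W → Bool) → ℂ) :
    act (ccz G a b c) ψ = fun x => (if x a && x b && x c then -1 else 1) * ψ x := by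
  have hT : ∀ (i : W) ψ, act [GateApp.one (tIdx G) i] ψ = fun x => tPhase (x i) * ψ x :=
    act_one_diagonal one_tIdx_diagonal
  have hT' : ∀ (i : W) ψ, act [GateApp.one (G.inv1 (tIdx G)) i] ψ =
      fun x => (star tPhase) (x i) * ψ x := act_one_diagonal one_inv_tIdx_diagonal
  have h3 : ∀ ψ, act ([.one (tIdx G) a, .one (tIdx G) b, .one (tIdx G) c] : List (GateApp G W)) ψ =
      fun x => tPhase (x c) * (tPhase (x b) * (tPhase (x a) * ψ x)) := by
    intro ψ
    have := act_append [GateApp.one (tIdx G) a]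
      ([.one (tIdx G) b, .one (tIdx G) c] : List (GateApp G W)) ψ
    rw [List.singleton_append] at this
    rw [this, hT]
    have := act_append [GateApp.one (tIdx G) b]
      ([.one (tIdx G) c] : List (GateApp G W)) (fun x => tPhase (x a) * ψ x)
    rw [List.singleton_append] at this
    rw [this, hT, hT]
  have hab' := act_cnot_conj hab (hT' b)
  have hbc' := act_cnot_conj hbc (hT' c)
  have hac' := act_cnot_conj hac (hT' c)
  have hbac' := act_cnot_conj hac (act_cnot_conj hbc (hT c))
  have happ : ∀ (A B C D E : List (GateApp G W)) ψ,
      act (A ++ B ++ C ++ D ++ E) ψ = act E (act D (act C (act B (act A ψ)))) := by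
    intro A B C D E ψ
    simp only [act_append]
  rw [ccz, happ, h3, hab', hbc', hac', hbac']
  funext x
  simp only [Function.update_self, Function.update_of_ne hbc]
  rw [← phase_identity]
  ring

theorem act_hadamard (i : W) (ψ : (W → Bool) → ℂ) : act [GateApp.one (hIdx G) i] ψ =
    fun x => (Real.sqrt 2 : ℂ)⁻¹ * (ψ (Function.update x i false) +
      (if x i then -1 else 1) * ψ (Function.update x i true)) := by
  funext x
  rw [act_cons, act_nil]
  simp only [GateApp.act, one_hIdx, hGate, of_apply, Fintype.sum_bool, Bool.and_true, Bool.and_false]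
  cases x i <;> simp <;> ring

theorem sqrt_two_inv_sq : (Real.sqrt 2 : ℂ)⁻¹ * (Real.sqrt 2 : ℂ)⁻¹ = 1 / 2 := by
  rw [← mul_inv, ← Complex.ofReal_mul, Real.mul_self_sqrt (by norm_num)]
  norm_num

/-- On the wire `i`, conjugation by `H` turns the diagonal matrix with entries `m₀`, `m₁` into `(m₀
+ m₁)/2 · 1 + (m₀ - m₁)/2 · X`. -/
theorem act_hadamard_conj {i : W} {L : List (GateApp G W)} {m : (W → Bool) → ℂ}
    (hL : ∀ ψ, act L ψ = fun x => m x * ψ x) (ψ : (W → Bool) → ℂ) (x : W → Bool) :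
    act ([GateApp.one (hIdx G) i] ++ L ++ [GateApp.one (hIdx G) i]) ψ x =
      (1 / 2) * ((m (Function.update x i false) + m (Function.update x i true)) * ψ x +
       (m (Function.update x i false) - m (Function.update x i true)) *
          ψ (Function.update x i (!x i))) := by
  rw [act_append, act_append, act_hadamard, act_hadamard, hL]
  have h := sqrt_two_inv_sq
  simp only [Function.update_idem, Function.update_self]
  have hx : ∀ b, x i = b → Function.update x i b = x := by
    rintro b rfl; exact Function.update_eq_self i x
  generalize (Real.sqrt 2 : ℂ)⁻¹ = s at *
  cases hb : x i
  · simp only [hx false hb, Bool.not_false, Bool.false_eq_true, if_false, if_true]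
    rw [← h]; ring
  · simp only [hx true hb, Bool.not_true, Bool.false_eq_true, if_false, if_true]
    rw [← h]; ring

theorem act_ccx {a b c : W} (hab : a ≠ b) (hac : a ≠ c) (hbc : b ≠ c) (ψ : (W → Bool) → ℂ) :
    act ([GateApp.one (hIdx G) c] ++ ccz G a b c ++ [GateApp.one (hIdx G) c]) ψ =
      fun x => ψ (Function.update x c (xor (x a && x b) (x c))) := by
  funext x
  rw [act_hadamard_conj (act_ccz hab hac hbc)]
  simp only [Function.update_self, Function.update_of_ne hac, Function.update_of_ne hbc]
  cases x a <;> cases x b <;> simp <;> ring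

/-- Three XORs swap two bits. Controlling only the middle one suffices, because the outer two cancel
when it is absent. -/
theorem act_cswap {c a b : W} (hca : c ≠ a) (hcb : c ≠ b) (hab : a ≠ b) (ψ : (W → Bool) → ℂ) :
    act (cswap G c a b) ψ = fun x => if x c then ψ (x ∘ Equiv.swap a b) else ψ x := by
  rw [cswap, act_append, act_append, act_ccx hca hcb hab, act_cnot hab.symm, act_cnot hab.symm]
  funext x
  have hs : x ∘ Equiv.swap a b = Function.update (Function.update x a (x b)) b (x a) := by
    funext w
    by_cases hb : w = b
    · subst hb; simp
    · by_cases ha : w = a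
      · subst ha; simp [Function.update_of_ne hab]
      · simp [Function.update_of_ne hb, Function.update_of_ne ha, Equiv.swap_apply_of_ne_of_ne ha hb]
  cases hc : x c
  · simp only [Bool.false_eq_true, if_false]
    congr 1
    funext w
    by_cases ha : w = a
    · subst ha
      simp [Function.update_of_ne hca, hc, Function.update_of_ne hab, Function.update_of_ne hab.symm]
    · by_cases hb : w = b
      · subst hb
        simp [Function.update_of_ne hca, hc, Function.update_of_ne hab, Function.update_of_ne hab.symm]
      · simp [Function.update_of_ne hb, Function.update_of_ne ha]
  · simp only [if_true]
    rw [hs]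
    congr 1
    funext w
    by_cases hb : w = b
    · subst hb
      simp [Function.update_of_ne hca, hc, Function.update_of_ne hab, Function.update_of_ne hab.symm]
      cases x w <;> cases x a <;> rfl
    · by_cases ha : w = a
      · subst ha
        simp [Function.update_of_ne hca, hc, Function.update_of_ne hab, Function.update_of_ne hab.symm]
      · simp [Function.update_of_ne hb, Function.update_of_ne ha]

theorem act_swapGate {a b : W} (hab : a ≠ b) (ψ : (W → Bool) → ℂ) :
    act (swapGate G a b) ψ = fun x => ψ (x ∘ Equiv.swap a b) := by
  rw [swapGate, act_append, act_append, act_cnot hab, act_cnot hab.symm, act_cnot hab]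
  funext x
  change ψ _ = ψ _
  congr 1
  funext w
  by_cases hb : w = b
  · subst hb
    simp [Function.update_of_ne hab, Function.update_of_ne hab.symm]
  · by_cases ha : w = a
    · subst ha
      simp [Function.update_of_ne hab, Function.update_of_ne hab.symm]
      cases x w <;> cases x b <;> rfl
    · simp [Function.update_of_ne hb, Function.update_of_ne ha, Equiv.swap_apply_of_ne_of_ne ha hb]

/-- `S² = Z` and `HZH = X`. -/
theorem act_notGate (i : W) (ψ : (W → Bool) → ℂ) :
    act (notGate G i) ψ = fun x => ψ (Function.update x i (!x i)) := by
  have hS : ∀ ψ : (W → Bool) → ℂ,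
      act ([GateApp.one (sIdx G) i] ++ [GateApp.one (sIdx G) i]) ψ =
        fun x => (if x i then -1 else 1) * ψ x := by
    intro ψ
    have h := act_one_diagonal (i := i) (one_sIdx G)
    rw [act_append, h, h]
    funext x
    cases hx : x i <;> simp [← mul_assoc, hx]
  funext x
  have h := act_hadamard_conj (i := i) hS ψ x
  simp only [Function.update_self] at h
  rw [notGate]
  refine h.trans ?_
  simp; ring

end Gadgets

/-! ### Tail bounds for products of finite distributions -/

section Tail

/-- Hoeffding's lemma for a Bernoulli variable. -/
theorem bernoulli_mgf_le {p : ℝ} (h0 : 0 ≤ p) (h1 : p ≤ 1) (l : ℝ) :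
    (1 - p) + p * Real.exp (-l) ≤ Real.exp (-l * p + l ^ 2 / 8) := by
  classical
  let μ : MeasureTheory.Measure Bool :=
    ENNReal.ofReal p • MeasureTheory.Measure.dirac true +
      ENNReal.ofReal (1 - p) • MeasureTheory.Measure.dirac false
  have hμ : MeasureTheory.IsProbabilityMeasure μ := ⟨by
    simp only [μ, MeasureTheory.Measure.add_apply, MeasureTheory.Measure.smul_apply,
      MeasureTheory.measure_univ, smul_eq_mul, mul_one]
    rw [← ENNReal.ofReal_add h0 (by linarith)]
    simp⟩
  have hint : ∀ f : Bool → ℝ, ∫ b, f b ∂μ = p * f true + (1 - p) * f false := by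
    intro f
    rw [MeasureTheory.integral_fintype]
    · simp [μ, MeasureTheory.measureReal_def, h0, h1]
    · exact MeasureTheory.Integrable.of_finite
  -- A centred variable with values in an interval of length `1` is sub-Gaussian with parameter
  -- `(1/2)² = 1/4`. The shift by the mean `p` is undone below.
  have hs := ProbabilityTheory.hasSubgaussianMGF_of_mem_Icc (μ := μ) (a := 0) (b := 1)
    (X := fun b : Bool => if b then (1 : ℝ) else 0) (measurable_of_finite _).aemeasurable
    (Filter.Eventually.of_forall fun b => by cases b <;> simp)
  have h := hs.mgf_le (-l)
  rw [ProbabilityTheory.mgf, hint, hint] at h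
  simp only [if_true, Bool.false_eq_true, if_false, mul_one, mul_zero, add_zero, zero_sub] at h
  have e1 : -l * (1 - p) = l * p + -l := by ring
  have e2 : -l * -p = l * p := by ring
  rw [e1, e2, Real.exp_add] at h
  have e3 : ((((‖(1 : ℝ) - 0‖₊ / 2) ^ 2 : NNReal) : ℝ)) = 1 / 4 := by
    push_cast; norm_num
  rw [e3] at h
  have h4 : Real.exp (-l * p + l ^ 2 / 8) = Real.exp (-(l * p)) * Real.exp (1 / 4 * (-l) ^ 2 / 2) := by
    rw [← Real.exp_add]; congr 1; ring
  rw [h4]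
  have h5 : Real.exp (-(l * p)) * (Real.exp (l * p)) = 1 := by rw [← Real.exp_add]; simp
  calc (1 - p) + p * Real.exp (-l)
      = Real.exp (-(l * p)) * (p * (Real.exp (l * p) * Real.exp (-l)) + (1 - p) * Real.exp (l * p)) := by
        linear_combination (-(1 - p) - p * Real.exp (-l)) * h5
    _ ≤ _ := mul_le_mul_of_nonneg_left h (Real.exp_pos _).le

variable {B Y : Type} [Fintype B] [DecidableEq B] [Fintype Y] {P : B → Y → ℝ}

theorem sum_prod_eq_prod_sum (f : B → Y → ℝ) : ∑ x : B → Y, ∏ b, f b (x b) = ∏ b, ∑ y, f b y := by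
  rw [Finset.prod_univ_sum, Fintype.piFinset_univ]

theorem sum_prod_eq_one (h1 : ∀ b, ∑ y, P b y = 1) : ∑ x : B → Y, ∏ b, P b (x b) = 1 := by
  rw [sum_prod_eq_prod_sum]; simp [h1]

/-- The marginal distribution at one coordinate. -/
theorem sum_marginal (h1 : ∀ b, ∑ y, P b y = 1) (c : B) (f : Y → ℝ) :
    ∑ x : B → Y, f (x c) * ∏ b, P b (x b) = ∑ y, f y * P c y := by
  have : ∀ x : B → Y, f (x c) * ∏ b, P b (x b) =
      ∏ b, (if b = c then f (x b) else 1) * P b (x b) := by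
    intro x
    rw [Finset.prod_mul_distrib, Finset.prod_ite_eq' Finset.univ c fun b => f (x b)]
    simp
  simp only [this]
  rw [sum_prod_eq_prod_sum (fun b y => (if b = c then f y else 1) * P b y), ← Finset.mul_prod_erase _ _ (Finset.mem_univ c)]
  simp only [if_true]
  rw [Finset.prod_eq_one, mul_one]
  intro b hb
  simp [Finset.ne_of_mem_erase hb, h1]

variable {J : Type} [Fintype J] {e : J → B} {A : J → Y → Prop} [∀ j, DecidablePred (A j)]

/-- Markov's inequality for the number of counted coordinates; independence enters only through the
marginals. The map `e` selects the coordinates that count, later the blocks of one half of the key.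
-/
theorem sum_threshold_le (h0 : ∀ b y, 0 ≤ P b y) (h1 : ∀ b, ∑ y, P b y = 1) {k : ℝ} (hk : 0 < k) :
    (∑ x : B → Y, if k ≤ (Finset.card {j : J | A j (x (e j))} : ℝ) then ∏ b, P b (x b) else 0) ≤
      (1 / k) * ∑ j, ∑ y, if A j y then P (e j) y else 0 := by
  have hc : ∀ x : B → Y, (if k ≤ (Finset.card {j : J | A j (x (e j))} : ℝ) then ∏ b, P b (x b) else 0) ≤
      (1 / k) * ∑ j, (if A j (x (e j)) then 1 else 0) * ∏ b, P b (x b) := by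
    intro x
    have hp : 0 ≤ ∏ b, P b (x b) := Finset.prod_nonneg fun b _ => h0 _ _
    rw [← Finset.sum_mul, Finset.sum_boole, ← mul_assoc]
    split_ifs with h
    · have : 1 ≤ 1 / k * (Finset.card {j : J | A j (x (e j))} : ℝ) := by
        rw [one_div, inv_mul_eq_div, le_div_iff₀ hk]; linarith
      nlinarith
    · positivity
  refine (Finset.sum_le_sum fun x _ => hc x).trans (le_of_eq ?_)
  rw [← Finset.mul_sum, Finset.sum_comm]
  congr 1
  refine Finset.sum_congr rfl fun j _ => ?_
  rw [sum_marginal h1 (e j) fun y => if A j y then 1 else 0]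
  simp

/-- Chernoff's method. The indicator of a count below `k` is at most `exp (l (k - count))`, whose
expectation factors over the coordinates; each factor is bounded by Hoeffding's lemma. Injectivity
of `e` makes the counted coordinates distinct, hence independent, and the others sum to one. -/
theorem sum_below_threshold_le [DecidableEq J] (he : Function.Injective e)
    (h0 : ∀ b y, 0 ≤ P b y) (h1 : ∀ b, ∑ y, P b y = 1)
    {μ s k : ℝ} (hA : ∀ j, μ ≤ ∑ y, if A j y then P (e j) y else 0) (hs : 0 ≤ s)
    (hJ : 0 < Fintype.card J) (hk : k ≤ (μ - s) * Fintype.card J) :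
    (∑ x : B → Y, if k ≤ (Finset.card {j : J | A j (x (e j))} : ℝ) then 0 else ∏ b, P b (x b)) ≤
      Real.exp (-(2 * s ^ 2 * Fintype.card J)) := by
  -- The exponent per coordinate is `-l s + l²/8`, which attains its minimum `-2 s²` at `l = 4 s`.
  set l : ℝ := 4 * s with hl
  have hl0 : 0 ≤ l := by positivity
  have hJ' : (0 : ℝ) < Fintype.card J := by exact_mod_cast hJ
  -- the exponential weight of a coordinate
  have hw : ∀ x : B → Y, (∏ b, (∏ j : J, if e j = b then (if A j (x b) then Real.exp (-l) else 1) else 1))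
      = Real.exp (-l * (Finset.card {j : J | A j (x (e j))} : ℝ)) := by
    intro x
    rw [Finset.prod_comm]
    have : ∀ j : J, ∏ b, (if e j = b then (if A j (x b) then Real.exp (-l) else 1) else 1) =
        if A j (x (e j)) then Real.exp (-l) else 1 := by
      intro j
      rw [Finset.prod_ite_eq Finset.univ (e j) fun b => if A j (x b) then Real.exp (-l) else 1]
      simp
    simp only [this]
    rw [Finset.prod_ite, Finset.prod_const, Finset.prod_const_one, mul_one, ← Real.exp_nat_mul]
    congr 1
    ring
  have hc : ∀ x : B → Y, (if k ≤ (Finset.card {j : J | A j (x (e j))} : ℝ) then 0 else ∏ b, P b (x b)) ≤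
      Real.exp (l * k) * ∏ b, (∏ j : J, if e j = b then (if A j (x b) then Real.exp (-l) else 1) else 1) *
        P b (x b) := by
    intro x
    have hp : 0 ≤ ∏ b, P b (x b) := Finset.prod_nonneg fun b _ => h0 _ _
    rw [Finset.prod_mul_distrib, hw, ← mul_assoc, ← Real.exp_add]
    split_ifs with h
    · positivity
    · refine le_mul_of_one_le_left hp (Real.one_le_exp ?_)
      push Not at h
      nlinarith
  refine (Finset.sum_le_sum fun x _ => hc x).trans ?_
  rw [← Finset.mul_sum, sum_prod_eq_prod_sum (fun b y =>
    (∏ j : J, if e j = b then (if A j y then Real.exp (-l) else 1) else 1) * P b y)]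
  -- only the coordinates in the range of `e` contribute
  have hb : ∏ b, ∑ y, (∏ j : J, if e j = b then (if A j y then Real.exp (-l) else 1) else 1) * P b y =
      ∏ j, ∑ y, (if A j y then Real.exp (-l) else 1) * P (e j) y := by
    rw [← Finset.prod_subset (Finset.subset_univ (Finset.univ.image e)), Finset.prod_image he.injOn]
    · refine Finset.prod_congr rfl fun j _ => Finset.sum_congr rfl fun y _ => ?_
      congr 1
      rw [Finset.prod_eq_single j]
      · simp
      · intro i _ hi
        rw [if_neg (he.ne hi)]
      · simp
    · intro b _ hb
      have : ∀ j, e j ≠ b := fun j h => hb (Finset.mem_image.2 ⟨j, Finset.mem_univ _, h⟩)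
      simp [this, h1]
  rw [hb]
  have hf : ∀ j, ∑ y, (if A j y then Real.exp (-l) else 1) * P (e j) y ≤
      Real.exp (-l * μ + l ^ 2 / 8) := by
    intro j
    set q := ∑ y, if A j y then P (e j) y else 0 with hq
    have hsplit : ∑ y, (if A j y then Real.exp (-l) else 1) * P (e j) y = (1 - q) + q * Real.exp (-l) := by
      have h2 : 1 - q = ∑ y, (P (e j) y - if A j y then P (e j) y else 0) := by
        rw [Finset.sum_sub_distrib, h1, hq]
      rw [h2, hq, Finset.sum_mul, ← Finset.sum_add_distrib]
      refine Finset.sum_congr rfl fun y _ => ?_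
      split_ifs <;> ring
    have hq0 : 0 ≤ q := Finset.sum_nonneg fun y _ => by split_ifs <;> simp [h0]
    have hq1 : q ≤ 1 := by
      rw [← h1 (e j)]
      refine Finset.sum_le_sum fun y _ => ?_
      split_ifs <;> simp [h0]
    rw [hsplit]
    refine (bernoulli_mgf_le hq0 hq1 l).trans (Real.exp_le_exp.2 ?_)
    have := hA j
    nlinarith
  have hprod : ∏ j, ∑ y, (if A j y then Real.exp (-l) else 1) * P (e j) y ≤
      Real.exp (-l * μ + l ^ 2 / 8) ^ Fintype.card J := by
    refine (Finset.prod_le_prod (fun j _ => ?_) fun j _ => hf j).trans (le_of_eq (by simp))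
    refine Finset.sum_nonneg fun y _ => mul_nonneg ?_ (h0 _ _)
    split_ifs <;> positivity
  refine (mul_le_mul_of_nonneg_left hprod (Real.exp_pos _).le).trans ?_
  rw [← Real.exp_nat_mul, ← Real.exp_add]
  refine Real.exp_le_exp.2 ?_
  have := mul_le_mul_of_nonneg_left hk hl0
  nlinarith

end Tail

/-! ### Inverses of brickwork circuits -/

section Inverse

variable {G : GateSet} {W : Type} [DecidableEq W]

/-- The wires on which a gate acts. -/
def GateApp.wires {W : Type} : GateApp G W → List W
  | .one _ i => [i]
  | .two _ i j _ => [i, j]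

theorem GateApp.act_comm {a b : GateApp G W} (h : a.wires.Disjoint b.wires) (ψ : (W → Bool) → ℂ) :
    a.act (b.act ψ) = b.act (a.act ψ) := by
  funext x
  cases a with
  | one g i =>
    cases b with
    | one g' i' =>
      have h1 : i ≠ i' := by simpa [GateApp.wires, eq_comm] using h
      have hu : ∀ c d, Function.update (Function.update x i' d) i c =
          Function.update (Function.update x i c) i' d := fun c d => (Function.update_comm h1 _ _ _).symm
      simp only [GateApp.act, Function.update_of_ne h1, Function.update_of_ne h1.symm, hu,
        Fintype.sum_bool]
      ring
    | two g' i' j' hij' =>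
      obtain ⟨h1, h2⟩ : i ≠ i' ∧ i ≠ j' := by simpa [GateApp.wires, eq_comm] using h
      have hu : ∀ c d d', Function.update (Function.update (Function.update x i' d) j' d') i c =
          Function.update (Function.update (Function.update x i c) i' d) j' d' := fun c d d' => by
        rw [Function.update_comm h1, Function.update_comm h2]
      simp only [GateApp.act, Function.update_of_ne h1, Function.update_of_ne h1.symm,
        Function.update_of_ne h2, Function.update_of_ne h2.symm, hu, Fintype.sum_bool]
      ring
  | two g i j hij =>
    cases b with
    | one g' i' =>
      obtain ⟨h1, h2⟩ : i ≠ i' ∧ j ≠ i' := by simpa [GateApp.wires, eq_comm] using h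
      have hu : ∀ c d d', Function.update (Function.update (Function.update x i' c) i d) j d' =
          Function.update (Function.update (Function.update x i d) j d') i' c := fun c d d' => by
        rw [Function.update_comm h2, Function.update_comm h1]
      simp only [GateApp.act, Function.update_of_ne h1, Function.update_of_ne h1.symm,
        Function.update_of_ne h2, Function.update_of_ne h2.symm, hu, Fintype.sum_bool]
      ring
    | two g' i' j' hij' =>
      obtain ⟨⟨h1, h2⟩, h3, h4⟩ : (i ≠ i' ∧ i ≠ j') ∧ j ≠ i' ∧ j ≠ j' := by
        have h' : (i ≠ i' ∧ j ≠ i') ∧ i ≠ j' ∧ j ≠ j' := by simpa [GateApp.wires, eq_comm] using h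
        tauto
      have hu : ∀ c c' d d', Function.update (Function.update (Function.update
          (Function.update x i' c) j' c') i d) j d' = Function.update (Function.update
          (Function.update (Function.update x i d) j d') i' c) j' c' := fun c c' d d' => by
        rw [Function.update_comm h3, Function.update_comm h1, Function.update_comm h4,
          Function.update_comm h2]
      simp only [GateApp.act, Function.update_of_ne h1, Function.update_of_ne h1.symm,
        Function.update_of_ne h2, Function.update_of_ne h2.symm, Function.update_of_ne h3,
        Function.update_of_ne h3.symm, Function.update_of_ne h4, Function.update_of_ne h4.symm, hu,
        Fintype.sum_bool]
      ring

variable [Fintype W]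

theorem GateApp.mat_commute {a b : GateApp G W} (h : a.wires.Disjoint b.wires) :
    Commute a.mat b.mat := by
  apply Matrix.ext_of_mulVec_single
  intro x
  rw [← mulVec_mulVec, ← mulVec_mulVec]
  simp only [GateApp.mat_mulVec]
  exact GateApp.act_comm h _

theorem circMat_commute {a : GateApp G W} {L : List (GateApp G W)}
    (h : ∀ b ∈ L, a.wires.Disjoint b.wires) : Commute a.mat (circMat L) := by
  induction L with
  | nil => exact Commute.one_right _
  | cons b L ih =>
    exact (ih fun c hc => h c (List.mem_cons_of_mem _ hc)).mul_right
      (GateApp.mat_commute (h b List.mem_cons_self))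

theorem circMat_append (L L' : List (GateApp G W)) : circMat (L ++ L') = circMat L' * circMat L := by
  induction L with
  | nil => simp [circMat]
  | cons a L ih => rw [List.cons_append, circMat, circMat, ih, Matrix.mul_assoc]

/-- An inverse reverses the order of the gates. Gates on disjoint wires commute, so those of a layer
may be inverted in place and the result is again a layer. -/
theorem circMat_map_inv {L : List (GateApp G W)}
    (h : L.Pairwise fun a b => a.wires.Disjoint b.wires) : circMat (L.map .inv) = (circMat L)ᴴ := by
  induction L with
  | nil => simp [circMat]
  | cons a L ih =>
    rw [List.pairwise_cons] at h
    rw [List.map_cons, circMat, circMat, ih h.2, a.mat_inv, ← conjTranspose_mul,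
      (circMat_commute h.1).eq]

theorem Brick.mem_gates_wires {W : Type} {i j : W} (h : i ≠ j) {b : Brick G} {a : GateApp G W}
    (ha : a ∈ b.gates i j h) {w : W} (hw : w ∈ a.wires) : w = i ∨ w = j := by
  rcases b with ⟨g, g'⟩ | ⟨g, o⟩
  · simp only [Brick.gates, List.mem_append, List.mem_map, Option.mem_toList] at ha
    rcases ha with ⟨c, -, rfl⟩ | ⟨c, -, rfl⟩ <;> simp [GateApp.wires] at hw <;> simp [hw]
  · cases o <;> simp only [Brick.gates, List.mem_singleton] at ha <;> subst ha <;>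
      simp [GateApp.wires] at hw <;> tauto

theorem Brick.gates_pairwise {W : Type} {i j : W} (h : i ≠ j) (b : Brick G) :
    (b.gates i j h).Pairwise fun a b => a.wires.Disjoint b.wires := by
  rcases b with ⟨g, g'⟩ | ⟨g, o⟩
  · cases g <;> cases g' <;> simp [Brick.gates, GateApp.wires, h]
  · cases o <;> simp [Brick.gates]

theorem Brick.gates_inv {W : Type} {i j : W} (h : i ≠ j) (b : Brick G) :
    b.inv.gates i j h = (b.gates i j h).map .inv := by
  rcases b with ⟨g, g'⟩ | ⟨g, o⟩
  · cases g <;> cases g' <;> simp [Brick.gates, Brick.inv, GateApp.inv]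
  · cases o <;> simp [Brick.gates, Brick.inv, GateApp.inv]

theorem Layer.gates_inv {n : ℕ} (L : Layer G n) : L.inv.gates = L.gates.map .inv := by
  rw [Layer.gates, Layer.gates, List.map_flatMap]
  simp only [Layer.inv, Brick.gates_inv]

theorem Layer.gates_pairwise {n : ℕ} (L : Layer G n) :
    L.gates.Pairwise fun a b => a.wires.Disjoint b.wires := by
  rw [Layer.gates, List.pairwise_flatMap]
  refine ⟨fun j _ => Brick.gates_pairwise _ _, ?_⟩
  refine List.Pairwise.imp ?_ (List.pairwise_lt_finRange _)
  intro j j' hj a ha b hb w hw hw'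
  have h1 := Brick.mem_gates_wires _ ha hw
  have h2 := Brick.mem_gates_wires _ hb hw'
  have hlt : j.val < j'.val := hj
  simp only [Fin.ext_iff] at h1 h2
  omega

theorem layersMat_append {n : ℕ} (Ls Ls' : List (Layer G n)) :
    layersMat (Ls ++ Ls') = layersMat Ls' * layersMat Ls := by
  rw [layersMat, List.flatMap_append, circMat_append]; rfl

theorem layersMat_nil {n : ℕ} : layersMat ([] : List (Layer G n)) = 1 := rfl

theorem layersMat_cons {n : ℕ} (L : Layer G n) (Ls : List (Layer G n)) :
    layersMat (L :: Ls) = layersMat Ls * layersMat [L] := by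
  rw [← List.singleton_append, layersMat_append]

theorem layersMat_inv_reverse {n : ℕ} (Ls : List (Layer G n)) :
    layersMat (Ls.reverse.map Layer.inv) = (layersMat Ls)ᴴ := by
  induction Ls with
  | nil => simp [layersMat_nil]
  | cons L Ls ih =>
    rw [List.reverse_cons, List.map_append, layersMat_append, ih, layersMat_cons L Ls, conjTranspose_mul]
    congr 1
    simp only [List.map_singleton, layersMat, List.flatMap_singleton, Layer.gates_inv]
    exact circMat_map_inv L.gates_pairwise

theorem layersMat_dagger {n : ℕ} (C : Ckt G n) : layersMat C.dagger = (layersMat C.layers)ᴴ :=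
  layersMat_inv_reverse _

theorem layersMat_unitary {n : ℕ} (Ls : List (Layer G n)) : (layersMat Ls)ᴴ * layersMat Ls = 1 :=
  circMat_unitary _

theorem layersMat_layers_dagger {n : ℕ} (C : Ckt G n) : layersMat (C.layers ++ C.dagger) = 1 := by
  rw [layersMat_append, layersMat_dagger, layersMat_unitary]

theorem length_layers {n : ℕ} (C : Ckt G n) : C.layers.length = depth n := List.length_ofFn

theorem length_dagger {n : ℕ} (C : Ckt G n) : C.dagger.length = depth n := by
  rw [Ckt.dagger, List.length_map, List.length_reverse, length_layers]

theorem sum_norm_sq_layersKet {n : ℕ} (Ls : List (Layer G n)) : ∑ x, ‖layersKet Ls x‖ ^ 2 = 1 := by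
  rw [layersKet, sum_norm_sq_mulVec (layersMat_unitary Ls)]
  rw [Finset.sum_eq_single (fun _ => false)]
  · simp
  · intro x _ hx
    simp [Pi.single_eq_of_ne hx]
  · simp

end Inverse

/-! ### States and channels -/

section Channels

open scoped ComplexOrder

variable {n : ℕ}

/-- Density matrices. -/
def IsState (ρ : Matrix (Fin n → Bool) (Fin n → Bool) ℂ) : Prop := ρ.PosSemidef ∧ ρ.trace = 1

theorem IsChannel.isState {Φ : Superop n} (hΦ : IsChannel Φ)
    {ρ : Matrix (Fin n → Bool) (Fin n → Bool) ℂ} (hρ : IsState ρ) : IsState (Φ ρ) := by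
  obtain ⟨r, K, hK, h⟩ := hΦ
  constructor
  · rw [h]
    exact posSemidef_sum _ fun a _ => hρ.1.mul_mul_conjTranspose_same (K a)
  · rw [h, trace_sum]
    have : ∀ a, (K a * ρ * (K a)ᴴ).trace = ((K a)ᴴ * K a * ρ).trace := by
      intro a
      rw [trace_mul_comm, Matrix.mul_assoc]
    simp only [this]
    rw [← trace_sum, ← Matrix.sum_mul, hK, Matrix.one_mul, hρ.2]

theorem IsState.diag_eq {ρ : Matrix (Fin n → Bool) (Fin n → Bool) ℂ} (hρ : IsState ρ)
    (x : Fin n → Bool) : ρ x x = ((ρ x x).re : ℂ) := by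
  have := hρ.1.isHermitian.apply x x
  exact (Complex.conj_eq_iff_re.1 this).symm

theorem IsState.diag_nonneg {ρ : Matrix (Fin n → Bool) (Fin n → Bool) ℂ} (hρ : IsState ρ)
    (x : Fin n → Bool) : 0 ≤ (ρ x x).re := by
  have := hρ.1.diag_nonneg (i := x)
  exact (Complex.le_def.1 this).1

theorem IsState.sum_diag {ρ : Matrix (Fin n → Bool) (Fin n → Bool) ℂ} (hρ : IsState ρ) :
    ∑ x, (ρ x x).re = 1 := by
  have := congrArg Complex.re hρ.2
  simpa [Matrix.trace] using this

theorem isState_vecMulVec {ψ : (Fin n → Bool) → ℂ} (h : ∑ x, ‖ψ x‖ ^ 2 = 1) :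
    IsState (vecMulVec ψ (star ψ)) := by
  refine ⟨posSemidef_vecMulVec_self_star ψ, ?_⟩
  rw [trace_vecMulVec, dotProduct_comm, ← sum_norm_sq_eq, h, Complex.ofReal_one]

theorem single_eq_vecMulVec (x : Fin n → Bool) :
    Matrix.single x x (1 : ℂ) = vecMulVec (Pi.single x 1) (star (Pi.single x 1)) := by
  ext i j
  rw [Matrix.single_apply, vecMulVec_apply, Pi.star_apply, Pi.single_apply, Pi.single_apply]
  by_cases hi : i = x
  · by_cases hj : j = x
    · simp [hi, hj]
    · simp [hj, Ne.symm hj]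
  · simp [hi, Ne.symm hi]

theorem isState_single (x : Fin n → Bool) : IsState (Matrix.single x x (1 : ℂ)) := by
  rw [single_eq_vecMulVec]
  apply isState_vecMulVec
  rw [Finset.sum_eq_single x]
  · simp
  · intro y _ hy
    simp [Pi.single_eq_of_ne hy]
  · simp

variable {G : GateSet} {N : Device G}

theorem Device.IsNoiseModel.isState_exec (hN : N.IsNoiseModel) (Ls : List (Layer G n)) :
    ∀ {ρ : Matrix (Fin n → Bool) (Fin n → Bool) ℂ}, IsState ρ → IsState (N.exec Ls ρ) := by
  induction Ls with
  | nil => intro ρ hρ; exact hρ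
  | cons L Ls ih => intro ρ hρ; exact ih ((hN.2.1 n L).isState hρ)

theorem Device.IsNoiseModel.isState_prepare (hN : N.IsNoiseModel) (Ls : List (Layer G n)) :
    IsState (N.prepare Ls) :=
  hN.isState_exec Ls ((hN.1 n).isState (isState_single _))

theorem Device.exec_append (N : Device G) (Ls Ls' : List (Layer G n))
    (ρ : Matrix (Fin n → Bool) (Fin n → Bool) ℂ) : N.exec (Ls ++ Ls') ρ = N.exec Ls' (N.exec Ls ρ) := by
  induction Ls generalizing ρ with
  | nil => rfl
  | cons L Ls ih => exact ih _

theorem Device.ideal_exec (Ls : List (Layer G n)) (ρ : Matrix (Fin n → Bool) (Fin n → Bool) ℂ) :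
    (Device.ideal G).exec Ls ρ = layersMat Ls * ρ * (layersMat Ls)ᴴ := by
  induction Ls generalizing ρ with
  | nil => simp [Device.exec, layersMat_nil]
  | cons L Ls ih =>
    change (Device.ideal G).exec Ls (layersMat [L] * (ρ * (layersMat [L])ᴴ)) = _
    rw [ih, layersMat_cons L Ls, conjTranspose_mul]
    simp only [Matrix.mul_assoc]

theorem mul_vecMulVec_mul (U : Matrix (Fin n → Bool) (Fin n → Bool) ℂ) (ψ : (Fin n → Bool) → ℂ) :
    U * vecMulVec ψ (star ψ) * Uᴴ = vecMulVec (U *ᵥ ψ) (star (U *ᵥ ψ)) := by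
  rw [mul_vecMulVec, vecMulVec_mul, star_mulVec]

theorem Device.ideal_prepare (Ls : List (Layer G n)) :
    (Device.ideal G).prepare Ls = vecMulVec (layersKet Ls) (star (layersKet Ls)) := by
  change (Device.ideal G).exec Ls (Matrix.single _ _ 1) = _
  rw [Device.ideal_exec, single_eq_vecMulVec, mul_vecMulVec_mul]
  rfl

theorem Device.ideal_isNoiseModel : (Device.ideal G).IsNoiseModel := by
  have hid : ∀ n, IsChannel (LinearMap.id : Superop n) := fun n =>
    ⟨1, fun _ => 1, by simp, fun ρ => by simp⟩
  refine ⟨hid, fun n L => ⟨1, fun _ => layersMat [L], ?_, fun ρ => ?_⟩, hid⟩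
  · simp [layersMat_unitary]
  · simp [Device.ideal, Matrix.mul_assoc]

theorem Device.ideal_fidelity (Ls : List (Layer G n)) : (Device.ideal G).fidelity Ls = 1 := by
  change (star (layersKet Ls) ⬝ᵥ ((Device.ideal G).prepare Ls *ᵥ layersKet Ls)).re = 1
  rw [Device.ideal_prepare, vecMulVec_mulVec, dotProduct_smul, ← sum_norm_sq_eq, sum_norm_sq_layersKet]
  simp

/-- Positive natural values of `p` are at least `1`, so fidelity `1` meets the hypothesis. This
makes correctness an instance of noise robustness. -/
theorem Device.ideal_fidelityAtLeast {p : ℕ[X]} (hp : ∀ x : ℕ, 1 ≤ x → 0 < p.eval x) :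
    (Device.ideal G).FidelityAtLeast p := by
  intro n d hn hd Ls _
  rw [Device.ideal_fidelity]
  have : 1 ≤ p.eval (n * d) := hp _ (Nat.mul_pos hn hd)
  rw [div_le_one (by exact_mod_cast this)]
  exact_mod_cast this

end Channels

/-! ### The acceptance probability of verification -/

section Verification

variable {G : GateSet} {n t : ℕ}

theorem describe_injective : Function.Injective (Ckt.describe : Ckt G n → DescIdx G n → Bool) := by
  intro C D h
  funext s
  have := congrFun h (s, C s)
  simp only [Ckt.describe, decide_true] at this
  exact (of_decide_eq_true this.symm).symm

theorem decode_describe (C : Ckt G n) : decode C.describe = some C := by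
  have h : ∃ D : Ckt G n, D.describe = C.describe := ⟨C, rfl⟩
  rw [decode, dif_pos h]
  exact congrArg some (describe_injective h.choose_spec)

theorem superop_apply_eq_sum (Φ : Superop n) (ρ : Matrix (Fin n → Bool) (Fin n → Bool) ℂ)
    (x y : Fin n → Bool) : Φ ρ x y = ∑ p : (Fin n → Bool) × (Fin n → Bool),
      Φ (Matrix.single p.1 p.2 1) x y * ρ p.1 p.2 := by
  conv_lhs => rw [matrix_eq_sum_single ρ]
  rw [map_sum, Matrix.sum_apply, Fintype.sum_prod_type]
  refine Finset.sum_congr rfl fun u _ => ?_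
  rw [map_sum, Matrix.sum_apply]
  refine Finset.sum_congr rfl fun v _ => ?_
  have : Matrix.single u v (ρ u v) = ρ u v • Matrix.single u v (1 : ℂ) := by
    rw [Matrix.smul_single, smul_eq_mul, mul_one]
  rw [this, map_smul, Matrix.smul_apply, smul_eq_mul, mul_comm]

/-- Each factor is expanded in matrix units, and the product of the sums is the sum over all choices
of units for the blocks. -/
theorem tensorMap_prod {B : Type} [Fintype B] [DecidableEq B] (Φ : B → Superop n)
    (ρ : B → Matrix (Fin n → Bool) (Fin n → Bool) ℂ) (x y : B → Fin n → Bool) :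
    tensorMap Φ (Matrix.of fun x y => ∏ b, ρ b (x b) (y b)) x y = ∏ b, Φ b (ρ b) (x b) (y b) := by
  have h : ∀ b, Φ b (ρ b) (x b) (y b) = ∑ p : (Fin n → Bool) × (Fin n → Bool),
      Φ b (Matrix.single p.1 p.2 1) (x b) (y b) * ρ b p.1 p.2 :=
    fun b => superop_apply_eq_sum (Φ b) (ρ b) (x b) (y b)
  rw [Finset.prod_congr rfl fun b _ => h b]
  simp only [tensorMap, of_apply]
  rw [Finset.prod_univ_sum, Fintype.piFinset_univ, ← Fintype.sum_prod_type',
    ← (Equiv.arrowProdEquivProdArrow B (fun _ => Fin n → Bool) (fun _ => Fin n → Bool)).sum_comp]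
  refine Finset.sum_congr rfl fun p _ => ?_
  simp [Equiv.arrowProdEquivProdArrow, Finset.prod_mul_distrib]

/-- What the device `N` does to a block of the key in the verification of circuits `D`. -/
noncomputable def blockMap (N : Device G) (m : Bool) (D : Fin t → Option (Ckt G n)) (a : Bool × Fin t) :
    Superop n :=
  if a.1 = m then
    match D a.2 with
    | some C => N.readout n ∘ₗ N.exec C.dagger
    | none => LinearMap.id
  else LinearMap.id

theorem isState_blockMap {N : Device G} (hN : N.IsNoiseModel) (m : Bool) (D : Fin t → Option (Ckt G n))
    (a : Bool × Fin t) {ρ : Matrix (Fin n → Bool) (Fin n → Bool) ℂ} (hρ : IsState ρ) :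
    IsState (blockMap N m D a ρ) := by
  unfold blockMap
  split_ifs
  · cases D a.2 with
    | none => exact hρ
    | some C => exact (hN.2.2 n).isState (hN.isState_exec _ hρ)
  · exact hρ

/-- With a product key and independent noise the measured blocks form a product distribution. Each
block is in a state, so its diagonal is real and the real part passes through the product. -/
theorem verProb_prod {N : Device G} (hN : N.IsNoiseModel) (k : ℝ)
    {ρ : Bool × Fin t → Matrix (Fin n → Bool) (Fin n → Bool) ℂ} (hρ : ∀ a, IsState (ρ a)) (m : Bool)
    (σ : SigIdx G n t → Bool) {D : Fin t → Option (Ckt G n)}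
    (hD : ∀ j, decode (G := G) (n := n) (fun i => σ (j, i)) = D j) :
    verProb N k (Matrix.of fun x y => ∏ a, ρ a (x a) (y a)) m σ =
      ∑ x : PKBasis n t,
        if k ≤ (Finset.card {j : Fin t | (D j).isSome ∧ x (m, j) = fun _ => false} : ℝ) then
          ∏ a, (blockMap N m D a (ρ a) (x a) (x a)).re else 0 := by
  have hD' : (fun j : Fin t => decode (G := G) (n := n) fun i => σ (j, i)) = D := by
    funext j
    exact hD j
  unfold verProb
  rw [hD']
  refine Finset.sum_congr rfl fun x _ => ?_
  congr 1
  change (tensorMap (fun a => blockMap N m D a) _ x x).re = _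
  rw [tensorMap_prod]
  have : ∀ a, blockMap N m D a (ρ a) (x a) (x a) =
      (((blockMap N m D a (ρ a) (x a) (x a)).re : ℝ) : ℂ) :=
    fun a => (isState_blockMap hN m D a (hρ a)).diag_eq (x a)
  conv_lhs => rw [Finset.prod_congr rfl fun a _ => this a]
  rw [← Complex.ofReal_prod, Complex.ofReal_re]

theorem noisyPKGen_ideal (sk : SecretKey G n t) : noisyPKGen (Device.ideal G) sk = pkDensity sk := by
  ext x y
  simp only [noisyPKGen, pkDensity, of_apply, Device.ideal_prepare, vecMulVec_apply, pkGen, Pi.star_apply,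
    star_prod, Finset.prod_mul_distrib]
  rfl

theorem layersKet_layers_dagger (C : Ckt G n) :
    layersKet (C.layers ++ C.dagger) = Pi.single (fun _ => false) 1 := by
  rw [layersKet, layersMat_layers_dagger, one_mulVec]

/-- `C` followed by its inverse has ideal output `0^n`, so the fidelity of that run is the
probability of the outcome `0^n`, that is, of passing. This is the origin of the depth `2d` in the
threshold. -/
theorem readout_exec_eq_fidelity (N : Device G) (C : Ckt G n) :
    (N.readout n (N.exec C.dagger (N.prepare C.layers)) (fun _ => false) (fun _ => false)).re =
      N.fidelity (C.layers ++ C.dagger) := by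
  rw [Device.fidelity, layersKet_layers_dagger, Device.prepare, Device.prepare, Device.exec_append]
  simp [Pi.star_single]

/-- Honest signatures are rejected by a device of high fidelity with small probability. -/
theorem one_sub_verProb_le {N : Device G} (hN : N.IsNoiseModel) {p : ℕ[X]} (hfid : N.FidelityAtLeast p)
    (hn : 1 ≤ n) (hd : 1 ≤ depth n) (ht : 0 < t) {k s : ℝ} (hs : 0 ≤ s)
    (hk : k ≤ (1 / ((p.eval (n * (2 * depth n)) : ℕ) : ℝ) - s) * t) (sk : SecretKey G n t) (m : Bool) :
    0 ≤ 1 - verProb N k (noisyPKGen N sk) m (sign sk m) ∧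
    1 - verProb N k (noisyPKGen N sk) m (sign sk m) ≤ Real.exp (-(2 * s ^ 2 * t)) := by
  set D : Fin t → Option (Ckt G n) := fun j => some (sk (m, j)) with hDdef
  have hst : ∀ a, IsState (N.prepare (sk a).layers) := fun a => hN.isState_prepare _
  have hver := verProb_prod (ρ := fun a => N.prepare (sk a).layers) (D := D) hN k hst m (sign sk m)
    fun j => decode_describe (sk (m, j))
  set P : Bool × Fin t → (Fin n → Bool) → ℝ :=
    fun a y => (blockMap N m D a (N.prepare (sk a).layers) y y).re with hP
  have h0 : ∀ a y, 0 ≤ P a y := fun a y => (isState_blockMap hN m D a (hst a)).diag_nonneg y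
  have h1 : ∀ a, ∑ y, P a y = 1 := fun a => (isState_blockMap hN m D a (hst a)).sum_diag
  have hA : ∀ j : Fin t, 1 / ((p.eval (n * (2 * depth n)) : ℕ) : ℝ) ≤
      ∑ y, if (D j).isSome ∧ y = (fun _ => false) then P (m, j) y else 0 := by
    intro j
    have hlen : ((sk (m, j)).layers ++ (sk (m, j)).dagger).length = 2 * depth n := by
      rw [List.length_append, length_layers, length_dagger]; ring
    refine (hfid n (2 * depth n) hn (by omega) _ hlen).trans (le_of_eq ?_)
    rw [← readout_exec_eq_fidelity, Finset.sum_eq_single (fun _ => false)]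
    · simp [hP, hDdef, blockMap]
    · intro y _ hy; simp [hy]
    · simp
  have htail := sum_below_threshold_le (e := fun j : Fin t => (m, j))
    (A := fun j y => (D j).isSome ∧ y = fun _ => false) (fun i j h => (Prod.ext_iff.1 h).2)
    h0 h1 hA hs (by simpa using ht) (k := k) (by simpa using hk)
  have hcompl : 1 - verProb N k (noisyPKGen N sk) m (sign sk m) =
      ∑ x : PKBasis n t,
        if k ≤ (Finset.card {j : Fin t | (D j).isSome ∧ x (m, j) = fun _ => false} : ℝ) then
          0 else ∏ a, P a (x a) := by
    rw [← sum_prod_eq_one h1, show noisyPKGen N sk =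
      Matrix.of fun x y => ∏ a, N.prepare (sk a).layers (x a) (y a) from rfl, hver,
      ← Finset.sum_sub_distrib]
    refine Finset.sum_congr rfl fun x _ => ?_
    split_ifs <;> simp [hP]
  rw [hcompl]
  refine ⟨Finset.sum_nonneg fun x _ => ?_, by simpa using htail⟩
  split_ifs
  · exact le_rfl
  · exact Finset.prod_nonneg fun a _ => h0 _ _

/-- The squared overlap with a decoded circuit. -/
noncomputable def overlapOpt (C : Ckt G n) : Option (Ckt G n) → ℝ
  | some D => C.overlap D
  | none => 0

/-- The amplitude of `D† C |0^n⟩` at `0^n` is the inner product of the two output states. -/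
theorem ideal_pass_eq_overlap (C D : Ckt G n) :
    ((Device.ideal G).exec D.dagger ((Device.ideal G).prepare C.layers)
      (fun _ => false) (fun _ => false)).re = C.overlap D := by
  rw [Device.ideal_exec, Device.ideal_prepare, mul_vecMulVec_mul, vecMulVec_apply, layersMat_dagger,
    Pi.star_apply, Ckt.overlap]
  have h : ((layersMat D.layers)ᴴ *ᵥ layersKet C.layers) (fun _ => false) =
      star (star C.ket ⬝ᵥ D.ket) := by
    rw [star_dotProduct, star_star, Ckt.ket, Ckt.ket, dotProduct_comm, dotProduct_comm,
      layersKet, layersKet, star_mulVec, ← dotProduct_mulVec, Pi.star_single, star_one,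
      single_one_dotProduct]
  rw [h, star_star, RCLike.star_def, Complex.conj_mul']
  norm_cast

/-- By Markov's inequality, since a block passes with probability equal to the overlap; invalid
descriptions never pass and contribute zero. -/
theorem verProb_ideal_le {k : ℝ} (hk : 0 < k) (sk : SecretKey G n t) (m : Bool)
    (σ : SigIdx G n t → Bool) :
    verProb (Device.ideal G) k (pkDensity sk) m σ ≤
      (1 / k) * ∑ j, overlapOpt (sk (m, j)) (decode (G := G) (n := n) fun i => σ (j, i)) := by
  have hN : (Device.ideal G).IsNoiseModel := Device.ideal_isNoiseModel
  obtain ⟨D, hDσ⟩ : ∃ D : Fin t → Option (Ckt G n), ∀ j,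
      decode (G := G) (n := n) (fun i => σ (j, i)) = D j := ⟨_, fun j => rfl⟩
  rw [Finset.sum_congr rfl fun j _ => congrArg (overlapOpt (sk (m, j))) (hDσ j)]
  have hst : ∀ a, IsState ((Device.ideal G).prepare (sk a).layers) := fun a => hN.isState_prepare _
  have hver := verProb_prod (ρ := fun a => (Device.ideal G).prepare (sk a).layers) (D := D) hN k hst m σ hDσ
  set P : Bool × Fin t → (Fin n → Bool) → ℝ :=
    fun a y => (blockMap (Device.ideal G) m D a ((Device.ideal G).prepare (sk a).layers) y y).re with hP
  have h0 : ∀ a y, 0 ≤ P a y := fun a y => (isState_blockMap hN m D a (hst a)).diag_nonneg y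
  have h1 : ∀ a, ∑ y, P a y = 1 := fun a => (isState_blockMap hN m D a (hst a)).sum_diag
  rw [← noisyPKGen_ideal]
  refine (le_of_eq hver).trans ((sum_threshold_le (e := fun j : Fin t => (m, j))
    (A := fun j y => (D j).isSome ∧ y = fun _ => false) h0 h1 hk).trans (le_of_eq ?_))
  congr 1
  refine Finset.sum_congr rfl fun j _ => ?_
  obtain hD | ⟨C, hD⟩ : D j = none ∨ ∃ C, D j = some C := by
    rcases h : D j with _ | C
    · exact Or.inl rfl
    · exact Or.inr ⟨C, rfl⟩
  · simp [hD, overlapOpt]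
  · have hs : (D j).isSome = true := by simp [hD]
    simp only [hs, true_and]
    rw [hD, overlapOpt, ← ideal_pass_eq_overlap, Finset.sum_eq_single (fun _ => false)]
    · simp [hP, blockMap, hD, Device.ideal]
    · intro y _ hy; simp [hy]
    · simp

theorem overlap_le_one (C D : Ckt G n) : C.overlap D ≤ 1 := by
  have hN : (Device.ideal G).IsNoiseModel := Device.ideal_isNoiseModel
  have h := hN.isState_exec D.dagger (hN.isState_prepare C.layers)
  rw [← ideal_pass_eq_overlap, ← h.sum_diag]
  exact Finset.single_le_sum (f := fun x => ((Device.ideal G).exec D.dagger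
    ((Device.ideal G).prepare C.layers) x x).re) (fun x _ => h.diag_nonneg x) (Finset.mem_univ _)

end Verification

/-! ### Correctness and noise robustness -/

section Robust

theorem avg_nonneg {α : Type} [Fintype α] {f : α → ℝ} (h : ∀ a, 0 ≤ f a) : 0 ≤ avg f :=
  div_nonneg (Finset.sum_nonneg fun a _ => h a) (Nat.cast_nonneg _)

theorem avg_mono {α : Type} [Fintype α] {f g : α → ℝ} (h : ∀ a, f a ≤ g a) : avg f ≤ avg g :=
  div_le_div_of_nonneg_right (Finset.sum_le_sum fun a _ => h a) (Nat.cast_nonneg _)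

theorem avg_const {α : Type} [Fintype α] [Nonempty α] (c : ℝ) : avg (fun _ : α => c) = c := by
  rw [avg, Finset.sum_const, Finset.card_univ, nsmul_eq_mul, mul_div_cancel_left₀]
  exact_mod_cast Fintype.card_ne_zero

theorem avg_sub {α : Type} [Fintype α] (f g : α → ℝ) :
    avg (fun a => f a - g a) = avg f - avg g := by
  rw [avg, avg, avg, Finset.sum_sub_distrib, sub_div]

theorem avg_add {α : Type} [Fintype α] (f g : α → ℝ) :
    avg (fun a => f a + g a) = avg f + avg g := by
  rw [avg, avg, avg, Finset.sum_add_distrib, add_div]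

theorem avg_const_mul {α : Type} [Fintype α] (c : ℝ) (f : α → ℝ) :
    avg (fun a => c * f a) = c * avg f := by
  rw [avg, avg, ← Finset.mul_sum, mul_div_assoc]

theorem avg_sum {α ι : Type} [Fintype α] (s : Finset ι) (f : ι → α → ℝ) :
    avg (fun a => ∑ i ∈ s, f i a) = ∑ i ∈ s, avg (f i) := by
  simp only [avg]
  rw [Finset.sum_comm, Finset.sum_div]

instance (G : GateSet) : Nonempty (Brick G) := ⟨.inl (none, none)⟩

theorem negligible_exp_neg : Negligible fun n => Real.exp (-(n : ℝ)) := by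
  intro z
  exact (Real.tendsto_pow_mul_exp_neg_atTop_nhds_zero z).comp tendsto_natCast_atTop_atTop

theorem Negligible.mono {f g : ℕ → ℝ} (hg : Negligible g)
    (h : ∀ᶠ n in Filter.atTop, 0 ≤ f n ∧ f n ≤ g n) : Negligible f := by
  refine Asymptotics.SuperpolynomialDecay.trans_eventually_abs_le hg ?_
  filter_upwards [h] with n hn
  change |f n| ≤ |g n|
  rw [abs_of_nonneg hn.1, abs_of_nonneg (hn.1.trans hn.2)]
  exact hn.2

theorem one_le_depth {n : ℕ} (hn : 2 ≤ n) : 1 ≤ depth n := by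
  have : 1 ≤ Nat.log 2 n := Nat.log_pos (by norm_num) hn
  exact Nat.one_le_pow _ _ this

/-- The square root in the threshold is the deviation `s` with `2 s² t = n`. The resulting bound
`e^{-n}` holds for every single key, hence on average. -/
theorem noiseRobust_of_fidelityAtLeast {G : GateSet} {N : Device G} (hN : N.IsNoiseModel) {p : ℕ[X]}
    (hfid : N.FidelityAtLeast p) {t : ℕ[X]} (ht : ∀ n, 0 < t.eval n) :
    NoiseRobust N t (threshold p t) := by
  intro m
  refine negligible_exp_neg.mono ?_
  -- From `n = 2` on the depth is positive, as the fidelity hypothesis requires.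
  filter_upwards [Filter.eventually_ge_atTop 2] with n hn
  have ht' : (0 : ℝ) < ((t.eval n : ℕ) : ℝ) := by exact_mod_cast ht n
  have hs : 2 * Real.sqrt (n / (2 * ((t.eval n : ℕ) : ℝ))) ^ 2 * ((t.eval n : ℕ) : ℝ) = n := by
    rw [Real.sq_sqrt (by positivity)]
    field_simp
  have key := fun sk : SecretKey G n (t.eval n) => one_sub_verProb_le hN hfid (by omega)
    (one_le_depth hn) (ht n) (Real.sqrt_nonneg _) (le_refl (threshold p t n)) sk m
  have e : 1 - noisyHonestProb N n (t.eval n) (threshold p t n) m =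
      avg fun sk : SecretKey G n (t.eval n) =>
        1 - verProb N (threshold p t n) (noisyPKGen N sk) m (sign sk m) := by
    rw [avg_sub, avg_const]; rfl
  rw [e]
  refine ⟨avg_nonneg fun sk => (key sk).1, ?_⟩
  rw [← avg_const (α := SecretKey G n (t.eval n)) (Real.exp (-(n : ℝ)))]
  refine avg_mono fun sk => ?_
  have := (key sk).2
  rwa [hs] at this

theorem correct_of_pos {G : GateSet} {p : ℕ[X]} (hp : ∀ x : ℕ, 1 ≤ x → 0 < p.eval x) {t : ℕ[X]}
    (ht : ∀ n, 0 < t.eval n) : Correct G t (threshold p t) := by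
  have h := noiseRobust_of_fidelityAtLeast (Device.ideal_isNoiseModel (G := G))
    (Device.ideal_fidelityAtLeast hp) ht
  intro m
  have := h m
  simp only [noisyHonestProb, noisyPKGen_ideal] at this
  exact this

end Robust

/-! ### Sampling with fair coins -/

section Averages

theorem avg_comp_equiv {α β : Type} [Fintype α] [Fintype β] (e : α ≃ β) (f : β → ℝ) :
    avg (fun a => f (e a)) = avg f := by
  rw [avg, avg, e.sum_comp, Fintype.card_congr e]

theorem avg_prod {α β : Type} [Fintype α] [Fintype β] (f : α × β → ℝ) :
    avg f = avg fun a => avg fun b => f (a, b) := by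
  simp only [avg]
  rw [Fintype.sum_prod_type, Fintype.card_prod, ← Finset.sum_div, div_div, Nat.cast_mul,
    mul_comm (Fintype.card β : ℝ)]

theorem avg_pi {ι : Type} [Fintype ι] [DecidableEq ι] {α : ι → Type} [∀ i, Fintype (α i)]
    (f : ∀ i, α i → ℝ) : (avg fun x : ∀ i, α i => ∏ i, f i (x i)) = ∏ i, avg (f i) := by
  simp only [avg]
  rw [Finset.prod_div_distrib, Fintype.card_pi, Nat.cast_prod, Finset.prod_univ_sum,
    Fintype.piFinset_univ]

theorem avg_bool (f : Bool → ℝ) : avg f = (f true + f false) / 2 := by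
  simp [avg]

end Averages

/-! ### Nearly uniform choices by coin-driven permutations. -/

section Mixing

variable {U B : Type} [Fintype U] [Nonempty U] [Fintype B] [DecidableEq B]

/-- The composition of a sequence of permutations. -/
def walk (f : U → Equiv.Perm B) : (R : ℕ) → (Fin R → U) → Equiv.Perm B
  | 0, _ => 1
  | R + 1, u => walk f R (Fin.tail u) * f (u 0)

theorem avg_fin_succ {α : Type} [Fintype α] {R : ℕ} (F : α → (Fin R → α) → ℝ) :
    (avg fun u : Fin (R + 1) → α => F (u 0) (Fin.tail u)) = avg fun a => avg fun u => F a u := by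
  rw [← avg_prod fun p : α × (Fin R → α) => F p.1 p.2,
    ← avg_comp_equiv (Fin.consEquiv fun _ : Fin (R + 1) => α)]
  rfl

/-- A random walk by permutations approaches the uniform distribution if every transition has
positive probability in one step. -/
theorem walk_mixing (f : U → Equiv.Perm B) {β : ℝ}
    (hβ : ∀ b b', β ≤ avg fun u => if f u b = b' then 1 else 0) (R : ℕ) : ∀ b b',
    (1 - (1 - Fintype.card B * β) ^ R) / Fintype.card B ≤
      avg fun u : Fin R → U => if walk f R u b = b' then (1 : ℝ) else 0 := by
  induction R with
  | zero => intro b b'; simpa using avg_nonneg fun u => by split_ifs <;> simp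
  | succ R ih =>
    intro b b'
    have hB : (0 : ℝ) < Fintype.card B := by
      exact_mod_cast Fintype.card_pos_iff.2 ⟨b⟩
    set Q : B → ℝ := fun c => avg fun u : Fin R → U => if walk f R u c = b' then (1 : ℝ) else 0 with hQ
    set M : B → ℝ := fun c => avg fun u => if f u b = c then (1 : ℝ) else 0 with hM
    have hstep : (avg fun u : Fin (R + 1) → U => if walk f (R + 1) u b = b' then (1 : ℝ) else 0) =
        ∑ c, M c * Q c := by
      have h1 := avg_fin_succ (R := R) (α := U) fun a u => if walk f R u (f a b) = b' then (1 : ℝ) else 0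
      refine Eq.trans h1 ?_
      have h2 : ∀ c, M c * Q c = avg fun a => (if f a b = c then 1 else 0) * Q c := by
        intro c
        simp only [mul_comm _ (Q c)]
        rw [avg_const_mul]
      simp only [h2]
      rw [← avg_sum]
      congr 1
      funext a
      simp [hQ]
    have hMsum : ∑ c, M c = 1 := by
      rw [hM, ← avg_sum]
      simp only [Finset.sum_ite_eq, Finset.mem_univ, if_true]
      exact avg_const 1
    -- Every step is a permutation, so the walk is doubly stochastic: the probabilities of reaching
    -- `b'` also sum to one over the starting points.
    have hQsum : ∑ c, Q c = 1 := by
      rw [hQ, ← avg_sum]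
      have : ∀ u : Fin R → U, ∑ c, (if walk f R u c = b' then (1 : ℝ) else 0) = 1 := by
        intro u
        rw [Finset.sum_eq_single ((walk f R u).symm b')]
        · simp
        · intro c _ hc
          rw [if_neg fun h => hc (by rw [← h, Equiv.symm_apply_apply])]
        · simp
      simp only [this]
      exact avg_const 1
    rw [hstep]
    set q := (1 - (1 - Fintype.card B * β) ^ R) / Fintype.card B with hq
    -- Each transition probability splits into the common part `β`, which meets `∑ Q = 1`, and the
    -- excess `M c - β`, which meets the induction bound `q`. The deficit from uniformity is thus
    -- multiplied by `1 - |B| β`.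
    have hle : ∑ c, (β * Q c + (M c - β) * q) ≤ ∑ c, M c * Q c := by
      refine Finset.sum_le_sum fun c _ => ?_
      have h1 : 0 ≤ M c - β := sub_nonneg.2 (hβ b c)
      have h2 : q ≤ Q c := ih c b'
      nlinarith
    refine le_trans (le_of_eq ?_) hle
    rw [Finset.sum_add_distrib, ← Finset.mul_sum, hQsum, ← Finset.sum_mul, Finset.sum_sub_distrib, hMsum,
      Finset.sum_const, Finset.card_univ, nsmul_eq_mul, hq]
    field_simp
    ring

/-- Follows from Bernoulli's inequality and `(1 - g)(1 + g) ≤ 1`. The decay like `1/(R g)` is far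
from sharp but suffices, because polynomially many rounds are affordable. -/
theorem pow_le_inv_one_add_mul {g : ℝ} (h0 : 0 ≤ g) (h1 : g ≤ 1) (R : ℕ) :
    (1 - g) ^ R * (1 + R * g) ≤ 1 := by
  have hb : 1 + R * g ≤ (1 + g) ^ R := one_add_mul_le_pow (by linarith) R
  calc (1 - g) ^ R * (1 + R * g) ≤ (1 - g) ^ R * (1 + g) ^ R :=
        mul_le_mul_of_nonneg_left hb (pow_nonneg (by linarith) _)
    _ = (1 - g ^ 2) ^ R := by rw [← mul_pow]; ring_nf
    _ ≤ 1 := pow_le_one₀ (by nlinarith) (by nlinarith)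

/-- A product of near-uniform distributions is within a factor of two from uniform. -/
theorem half_le_prod {ι : Type} [Fintype ι] {δ : ℝ} (h1 : δ ≤ 1)
    (h : (Fintype.card ι : ℝ) * δ ≤ 1 / 2) : 1 / 2 ≤ ∏ _i : ι, (1 - δ) := by
  rw [Finset.prod_const, Finset.card_univ]
  have := one_add_mul_le_pow (a := -δ) (by linarith) (Fintype.card ι)
  have e : 1 + -δ = 1 - δ := by ring
  rw [e] at this
  nlinarith

/-- Applies the swaps of a list for which the coin shows heads. -/
def swaps (u : B × B → Bool) (l : List (B × B)) : Equiv.Perm B :=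
  l.foldl (fun σ p => (if u p then Equiv.swap p.1 p.2 else 1) * σ) 1

theorem swaps_of_false (u : B × B → Bool) (l : List (B × B)) (hu : ∀ p ∈ l, u p = false) :
    ∀ σ : Equiv.Perm B, l.foldl (fun σ p => (if u p then Equiv.swap p.1 p.2 else 1) * σ) σ = σ := by
  induction l with
  | nil => intro σ; rfl
  | cons p l ih =>
    intro σ
    rw [List.foldl_cons, hu p List.mem_cons_self]
    simpa using ih (fun q hq => hu q (List.mem_cons_of_mem _ hq)) σ

theorem swaps_single {l : List (B × B)} (hl : l.Nodup) {p : B × B} (hp : p ∈ l) :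
    swaps (fun q => decide (q = p)) l = Equiv.swap p.1 p.2 := by
  obtain ⟨l₁, l₂, rfl⟩ := List.append_of_mem hp
  rw [List.nodup_append] at hl
  have h1 : ∀ q ∈ l₁, decide (q = p) = false := by
    intro q hq
    exact decide_eq_false fun h => hl.2.2 q hq p List.mem_cons_self h
  have h2 : ∀ q ∈ l₂, decide (q = p) = false := by
    intro q hq
    exact decide_eq_false fun h => (List.nodup_cons.1 hl.2.1).1 (h ▸ hq)
  rw [swaps, List.foldl_append, swaps_of_false _ l₁ h1, List.foldl_cons, swaps_of_false _ l₂ h2]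
  simp

/-- One outcome of the coins, heads for the pair `(b, b')` only or no heads at all if `b = b'`,
takes `b` to `b'`. The bound is the probability of this single outcome. -/
theorem swaps_avg_ge {l : List (B × B)} (hl : l.Nodup) (hmem : ∀ p : B × B, p.1 ≠ p.2 → p ∈ l)
    (b b' : B) : ((Fintype.card (B × B → Bool) : ℝ))⁻¹ ≤
      avg fun u : B × B → Bool => if swaps u l b = b' then (1 : ℝ) else 0 := by
  obtain ⟨u, hu⟩ : ∃ u : B × B → Bool, swaps u l b = b' := by
    by_cases h : b = b'
    · refine ⟨fun _ => false, ?_⟩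
      rw [swaps, swaps_of_false _ _ fun _ _ => rfl]
      simpa using h
    · refine ⟨fun q => decide (q = (b, b')), ?_⟩
      rw [swaps_single hl (hmem (b, b') h)]; simp
  rw [avg, ← one_div]
  refine div_le_div_of_nonneg_right ?_ (Nat.cast_nonneg _)
  have := Finset.single_le_sum (f := fun u : B × B → Bool => if swaps u l b = b' then (1 : ℝ) else 0)
    (fun u _ => by split_ifs <;> simp) (Finset.mem_univ u)
  simpa [hu] using this

end Mixing

/-! ### A coin-driven choice of a leaf of a binary heap. -/

section Heap

/-- One step of a token down a binary heap in which `v` has the children `2 v + 1` and `2 v + 2`. -/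
def heapStep (v : ℕ) (c : Bool) (h : ℕ) : ℕ :=
  (if c then Equiv.swap (2 * v + 1) (2 * v + 2) else 1) (Equiv.swap v (2 * v + 1) h)

/-- The final position of the token. -/
def heapWalk : (M : ℕ) → (Fin M → Bool) → ℕ
  | 0, _ => 0
  | M + 1, u => heapStep M (u (Fin.last M)) (heapWalk M fun i => u i.castSucc)

theorem avg_fin_succ_last {M : ℕ} (F : Bool → (Fin M → Bool) → ℝ) :
    (avg fun u : Fin (M + 1) → Bool => F (u (Fin.last M)) fun i => u i.castSucc) =
      avg fun a => avg fun u => F a u := by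
  rw [← avg_prod fun p : Bool × (Fin M → Bool) => F p.1 p.2,
    ← avg_comp_equiv (Fin.snocEquiv fun _ : Fin (M + 1) => Bool)]
  congr 1
  funext p
  simp [Fin.snocEquiv]

/-- The leaves of the heap after `M` steps are `M, …, 2 M`. The next step turns the leaf `M` into an
inner node that passes half of its probability to each of `2 M + 1` and `2 M + 2`, and half of `1/(M
+ 1)` is at least `1/(x + 1)` for either child `x`. With `M = t - 1` there are exactly `t` leaves,
whether or not `t` is a power of two. -/
theorem heapWalk_avg_ge (M : ℕ) : ∀ x, M ≤ x → x ≤ 2 * M →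
    1 / ((x : ℝ) + 1) ≤ avg fun u : Fin M → Bool => if heapWalk M u = x then (1 : ℝ) else 0 := by
  induction M with
  | zero =>
    intro x _ hx
    obtain rfl : x = 0 := by omega
    simp [heapWalk, avg_const]
  | succ M ih =>
    intro x hx hx'
    have h1 := avg_fin_succ_last (M := M) fun c u => if heapStep M c (heapWalk M u) = x then (1 : ℝ) else 0
    refine le_trans ?_ (le_of_eq h1.symm)
    rw [avg_bool]
    by_cases hlt : x ≤ 2 * M
    · have h2 : ∀ c, 1 / ((x : ℝ) + 1) ≤
          avg fun u : Fin M → Bool => if heapStep M c (heapWalk M u) = x then (1 : ℝ) else 0 := by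
        intro c
        refine (ih x (by omega) hlt).trans (avg_mono fun u => ?_)
        by_cases hu : heapWalk M u = x
        · have : heapStep M c x = x := by
            rw [heapStep, Equiv.swap_apply_of_ne_of_ne (by omega) (by omega)]
            split_ifs
            · rw [Equiv.swap_apply_of_ne_of_ne (by omega) (by omega)]
            · rfl
          simp [hu, this]
        · rw [if_neg hu]; split_ifs <;> simp
      linarith [h2 true, h2 false]
    · have hM := ih M le_rfl (by omega)
      have key : ∃ c, (avg fun u : Fin M → Bool => if heapWalk M u = M then (1 : ℝ) else 0) ≤
          avg fun u : Fin M → Bool => if heapStep M c (heapWalk M u) = x then (1 : ℝ) else 0 := by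
        -- Only this value of the coin is credited with bringing the token from `M` to `x`; the
        -- other one is bounded below by zero.
        refine ⟨decide (x = 2 * M + 2), avg_mono fun u => ?_⟩
        by_cases hu : heapWalk M u = M
        · have : heapStep M (decide (x = 2 * M + 2)) M = x := by
            rw [heapStep, Equiv.swap_apply_left]
            by_cases h2 : x = 2 * M + 2
            · simp [h2]
            · simp [h2]; omega
          simp [hu, this]
        · rw [if_neg hu]; split_ifs <;> simp
      have hnn : ∀ c, 0 ≤ avg fun u : Fin M → Bool =>
          if heapStep M c (heapWalk M u) = x then (1 : ℝ) else 0 :=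
        fun c => avg_nonneg fun u => by split_ifs <;> simp
      have hx2 : 1 / ((x : ℝ) + 1) ≤ (1 / ((M : ℝ) + 1)) / 2 := by
        rw [div_div]
        apply one_div_le_one_div_of_le (by positivity)
        have : (2 * M + 1 : ℝ) ≤ x := by exact_mod_cast (by omega : 2 * M + 1 ≤ x)
        linarith
      obtain ⟨c, hc⟩ := key
      have ht := hnn true
      have hf := hnn false
      cases c <;> linarith

end Heap

/-! ### Circuits with classical controls -/

section Fixed

variable {G : GateSet} {W : Type} [DecidableEq W]

/-- The wires in `S` have the values `k`. -/
def Agree (S : Set W) (k x : W → Bool) : Prop := ∀ w ∈ S, x w = k w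

open scoped Classical in
/-- The part of a state on which the wires in `S` have the values `k`. -/
noncomputable def fixOn (S : Set W) (k : W → Bool) (φ : (W → Bool) → ℂ) : (W → Bool) → ℂ :=
  fun x => if Agree S k x then φ x else 0

theorem fixOn_pos {S : Set W} {k x : W → Bool} (h : Agree S k x) (φ : (W → Bool) → ℂ) :
    fixOn S k φ x = φ x := if_pos h

theorem fixOn_neg {S : Set W} {k x : W → Bool} (h : ¬ Agree S k x) (φ : (W → Bool) → ℂ) :
    fixOn S k φ x = 0 := if_neg h

theorem fixOn_eq {S S' : Set W} {k k' x y : W → Bool} {φ ψ : (W → Bool) → ℂ}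
    (h : Agree S k x ↔ Agree S' k' y) (h' : φ x = ψ y) : fixOn S k φ x = fixOn S' k' ψ y := by
  by_cases hx : Agree S k x
  · rw [fixOn_pos hx, fixOn_pos (h.1 hx), h']
  · rw [fixOn_neg hx, fixOn_neg fun hy => hx (h.2 hy)]

theorem fixOn_congr {S : Set W} {k k' : W → Bool} (h : ∀ w ∈ S, k w = k' w) (φ : (W → Bool) → ℂ) :
    fixOn S k φ = fixOn S k' φ := by
  funext x
  have : Agree S k x ↔ Agree S k' x :=
    forall₂_congr fun w hw => by rw [h w hw]
  exact fixOn_eq this rfl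

/-- The state does not depend on the wires in `S`. -/
def IndepSet (S : Set W) (φ : (W → Bool) → ℂ) : Prop :=
  ∀ x, ∀ i ∈ S, ∀ b, φ (Function.update x i b) = φ x

theorem comp_swap_eq_update (x : W → Bool) (a b : W) :
    x ∘ Equiv.swap a b = Function.update (Function.update x a (x b)) b (x a) := by
  funext w
  by_cases hb : w = b
  · subst hb; simp
  · by_cases ha : w = a
    · subst ha; simp [Function.update_of_ne hb]
    · simp [Function.update_of_ne hb, Function.update_of_ne ha, Equiv.swap_apply_of_ne_of_ne ha hb]

theorem IndepSet.swap {S : Set W} {φ : (W → Bool) → ℂ} (h : IndepSet S φ) {a b : W} (ha : a ∈ S)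
    (hb : b ∈ S) (x : W → Bool) : φ (x ∘ Equiv.swap a b) = φ x := by
  rw [comp_swap_eq_update, h _ b hb, h _ a ha]

theorem forall_swap_iff {S : Set W} {a b : W} (ha : a ∈ S) (hb : b ∈ S) (x k : W → Bool) :
    Agree S k (x ∘ Equiv.swap a b) ↔ Agree S (k ∘ Equiv.swap a b) x := by
  have hS : ∀ w ∈ S, Equiv.swap a b w ∈ S := by
    intro w hw
    by_cases h1 : w = a
    · subst h1; simpa using hb
    · by_cases h2 : w = b
      · subst h2; simpa using ha
      · rwa [Equiv.swap_apply_of_ne_of_ne h1 h2]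
  constructor
  · intro h w hw
    simpa using h _ (hS w hw)
  · intro h w hw
    simpa using h _ (hS w hw)

theorem act_swapGate_fixOn {S : Set W} {k : W → Bool} {φ : (W → Bool) → ℂ} (hφ : IndepSet S φ) {a b : W}
    (ha : a ∈ S) (hb : b ∈ S) (hab : a ≠ b) :
    act (swapGate G a b) (fixOn S k φ) = fixOn S (k ∘ Equiv.swap a b) φ := by
  rw [act_swapGate hab]
  funext x
  exact fixOn_eq (forall_swap_iff ha hb x k) (hφ.swap ha hb x)

/-- With control and targets all classical, the gate merely rearranges the recorded values and no
superposition arises. The coin-driven choices of the learner are made of such gates. -/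
theorem act_cswap_fixOn {S : Set W} {k : W → Bool} {φ : (W → Bool) → ℂ} (hφ : IndepSet S φ) {c a b : W}
    (hc : c ∈ S) (ha : a ∈ S) (hb : b ∈ S) (hca : c ≠ a) (hcb : c ≠ b) (hab : a ≠ b) :
    act (cswap G c a b) (fixOn S k φ) = fixOn S (if k c then k ∘ Equiv.swap a b else k) φ := by
  rw [act_cswap hca hcb hab]
  funext x
  have hsw := fixOn_eq (forall_swap_iff ha hb x k) (hφ.swap ha hb x)
  rw [hsw]
  have hkc : (k ∘ Equiv.swap a b) c = k c := by
    simp [Equiv.swap_apply_of_ne_of_ne hca hcb]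
  -- Off the recorded value of the control both candidate states vanish, because the swap does not
  -- move `c`.
  by_cases hx : x c = k c
  · rw [hx]
    cases k c <;> simp
  · have h1 : ¬ Agree S (k ∘ Equiv.swap a b) x := fun h => hx ((h c hc).trans hkc)
    have h2 : ¬ Agree S k x := fun h => hx (h c hc)
    cases k c <;> simp [fixOn_neg h1, fixOn_neg h2]

/-- A controlled swap whose control has a fixed value. -/
theorem act_cswap_fixOn_ctrl {S : Set W} {k : W → Bool} (φ : (W → Bool) → ℂ) {c a b : W}
    (hc : c ∈ S) (ha : a ∉ S) (hb : b ∉ S) (hab : a ≠ b) :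
    act (cswap G c a b) (fixOn S k φ) =
      fixOn S k (if k c then fun x => φ (x ∘ Equiv.swap a b) else φ) := by
  have hca : c ≠ a := fun h => ha (h ▸ hc)
  have hcb : c ≠ b := fun h => hb (h ▸ hc)
  rw [act_cswap hca hcb hab]
  funext x
  have hS : Agree S k (x ∘ Equiv.swap a b) ↔ Agree S k x := by
    refine forall₂_congr fun w hw => ?_
    rw [Function.comp, Equiv.swap_apply_of_ne_of_ne (ne_of_mem_of_not_mem hw ha)
      (ne_of_mem_of_not_mem hw hb)]
  by_cases hx : Agree S k x
  · rw [hx c hc, fixOn_pos hx, fixOn_pos (hS.2 hx), fixOn_pos hx]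
    cases k c <;> simp
  · rw [fixOn_neg hx, fixOn_neg fun h => hx (hS.1 h), fixOn_neg hx]
    simp

theorem act_notGates_fixOn {S : Set W} {φ : (W → Bool) → ℂ} (hφ : IndepSet S φ) (l : List W)
    (hl : l.Nodup) (hS : ∀ w ∈ l, w ∈ S) : ∀ k : W → Bool,
    act (l.flatMap fun w => notGate G w) (fixOn S k φ) =
      fixOn S (fun w => if w ∈ l then !k w else k w) φ := by
  induction l with
  | nil => intro k; simp [act_nil]
  | cons i l ih =>
    intro k
    have hi : i ∈ S := hS i List.mem_cons_self
    rw [List.nodup_cons] at hl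
    have h1 : act (notGate G i) (fixOn S k φ) = fixOn S (Function.update k i (!k i)) φ := by
      rw [act_notGate]
      funext x
      have : Agree S k (Function.update x i (!x i)) ↔ Agree S (Function.update k i (!k i)) x := by
        refine forall₂_congr fun w _ => ?_
        by_cases h : w = i
        · subst h
          simp only [Function.update_self]
          cases x w <;> cases k w <;> simp
        · simp [Function.update_of_ne h]
      exact fixOn_eq this (hφ x i hi _)
    rw [List.flatMap_cons, act_append, h1, ih hl.2 fun w hw => hS w (List.mem_cons_of_mem _ hw)]
    refine fixOn_congr (fun w _ => ?_) φ
    by_cases h : w = i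
    · subst h; simp [hl.1]
    · simp [h]

theorem GateApp.act_fixOn {S : Set W} {k : W → Bool} (φ : (W → Bool) → ℂ) {a : GateApp G W}
    (h : ∀ w ∈ a.wires, w ∉ S) : a.act (fixOn S k φ) = fixOn S k (a.act φ) := by
  funext x
  cases a with
  | one g i =>
    have hi : i ∉ S := h i (by simp [GateApp.wires])
    have : ∀ b, Agree S k (Function.update x i b) ↔ Agree S k x := by
      intro b
      refine forall₂_congr fun w hw => ?_
      rw [Function.update_of_ne (ne_of_mem_of_not_mem hw hi)]
    by_cases hx : Agree S k x
    · rw [fixOn_pos hx]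
      simp only [GateApp.act, fixOn_pos ((this _).2 hx)]
    · rw [fixOn_neg hx]
      simp only [GateApp.act, fixOn_neg fun h => hx ((this _).1 h), mul_zero, Finset.sum_const_zero]
  | two g i j hij =>
    have hi : i ∉ S := h i (by simp [GateApp.wires])
    have hj : j ∉ S := h j (by simp [GateApp.wires])
    have : ∀ b b', Agree S k (Function.update (Function.update x i b) j b') ↔ Agree S k x := by
      intro b b'
      refine forall₂_congr fun w hw => ?_
      rw [Function.update_of_ne (ne_of_mem_of_not_mem hw hj),
        Function.update_of_ne (ne_of_mem_of_not_mem hw hi)]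
    by_cases hx : Agree S k x
    · rw [fixOn_pos hx]
      simp only [GateApp.act, fixOn_pos ((this _ _).2 hx)]
    · rw [fixOn_neg hx]
      simp only [GateApp.act, fixOn_neg fun h => hx ((this _ _).1 h), mul_zero, Finset.sum_const_zero]

theorem act_fixOn {S : Set W} {k : W → Bool} (L : List (GateApp G W))
    (h : ∀ a ∈ L, ∀ w ∈ a.wires, w ∉ S) : ∀ φ : (W → Bool) → ℂ,
    act L (fixOn S k φ) = fixOn S k (act L φ) := by
  induction L with
  | nil => intro φ; rfl
  | cons a L ih =>
    intro φ
    rw [act_cons, act_cons, GateApp.act_fixOn φ (h a List.mem_cons_self),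
      ih fun b hb => h b (List.mem_cons_of_mem _ hb)]

theorem act_sum {ι : Type} (s : Finset ι) (L : List (GateApp G W)) : ∀ φ : ι → (W → Bool) → ℂ,
    act L (fun x => ∑ i ∈ s, φ i x) = fun x => ∑ i ∈ s, act L (φ i) x := by
  induction L with
  | nil => intro φ; rfl
  | cons a L ih =>
    intro φ
    have : a.act (fun x => ∑ i ∈ s, φ i x) = fun x => ∑ i ∈ s, a.act (φ i) x := by
      funext x
      cases a with
      | one g i =>
        simp only [GateApp.act, Finset.mul_sum]
        rw [Finset.sum_comm]
      | two g i j h =>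
        simp only [GateApp.act, Fintype.sum_bool, Finset.mul_sum, ← Finset.sum_add_distrib]
    rw [act_cons, this, ih]
    rfl

/-- Here `st` interprets a classical record as a quantum state. If every group of gates acts on such
states by updating the record, the analysis of the circuit reduces to a fold over records. -/
theorem act_flatMap_foldl {ι σ : Type} {l : List ι} {F : ι → List (GateApp G W)}
    {st : σ → (W → Bool) → ℂ} {step : σ → ι → σ}
    (h : ∀ i ∈ l, ∀ s, act (F i) (st s) = st (step s i)) : ∀ s,
    act (l.flatMap F) (st s) = st (l.foldl step s) := by
  induction l with
  | nil => intro s; rfl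
  | cons i l ih =>
    intro s
    rw [List.flatMap_cons, act_append, h i List.mem_cons_self, List.foldl_cons]
    exact ih (fun j hj => h j (List.mem_cons_of_mem _ hj)) _

/-- Hadamard gates turn wires in the state zero into fair coins. -/
theorem act_hadamards {Γ : Type} [Fintype Γ] [DecidableEq Γ] {S : Set W} {co : Γ → W}
    (hco : Function.Injective co) (hS : ∀ g, co g ∈ S) {φ : (W → Bool) → ℂ} (hφ : IndepSet S φ)
    {l : List Γ} (hl : l.Nodup) (hmem : ∀ g, g ∈ l) :
    act (l.map fun g => GateApp.one (hIdx G) (co g)) (fixOn S (fun _ => false) φ) =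
      fun x => ((Real.sqrt 2 : ℂ)⁻¹) ^ Fintype.card Γ *
        ∑ v : Γ → Bool, fixOn S (Function.extend co v fun _ => false) φ x := by
  classical
  -- `A` collects the wires already turned into coins. They are no longer fixed, and each further
  -- coin costs a factor `1/√2`.
  have key : ∀ l' : List Γ, l'.Nodup → ∀ A : Set W, (∀ g ∈ l', co g ∉ A) →
      act (l'.map fun g => GateApp.one (hIdx G) (co g)) (fixOn (S \ A) (fun _ => false) φ) =
        fun x => ((Real.sqrt 2 : ℂ)⁻¹) ^ l'.length *
          fixOn (S \ (A ∪ {w | ∃ g ∈ l', co g = w})) (fun _ => false) φ x := by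
    intro l'
    induction l' with
    | nil => intro _ A _; simp [act_nil]
    | cons g l' ih =>
      intro hnd A hA
      rw [List.nodup_cons] at hnd
      have hg : co g ∉ A := hA g List.mem_cons_self
      have h1 : act [GateApp.one (hIdx G) (co g)] (fixOn (S \ A) (fun _ => false) φ) =
          fun x => (Real.sqrt 2 : ℂ)⁻¹ * fixOn (S \ (A ∪ {co g})) (fun _ => false) φ x := by
        rw [act_hadamard]
        funext x
        have ht : fixOn (S \ A) (fun _ => false) φ (Function.update x (co g) true) = 0 := by
          rw [fixOn, if_neg]
          intro h
          simpa using h (co g) ⟨hS g, hg⟩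
        have hf : Agree (S \ A) (fun _ => false) (Function.update x (co g) false) ↔
            Agree (S \ (A ∪ {co g})) (fun _ => false) x := by
          constructor
          · rintro h w ⟨hw, hw'⟩
            have hne : w ≠ co g := fun h => hw' (Or.inr h)
            have := h w ⟨hw, fun h => hw' (Or.inl h)⟩
            rwa [Function.update_of_ne hne] at this
          · rintro h w ⟨hw, hw'⟩
            by_cases hne : w = co g
            · subst hne; simp
            · rw [Function.update_of_ne hne]
              exact h w ⟨hw, fun h => h.elim hw' hne⟩
        rw [ht, mul_zero, add_zero, fixOn_eq hf (hφ x _ (hS g) _)]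
      have h2 := ih hnd.2 (A ∪ {co g}) fun g' hg' h => h.elim (hA g' (List.mem_cons_of_mem _ hg'))
        fun h => hnd.1 (hco h ▸ hg')
      have happ := act_append [GateApp.one (hIdx G) (co g)]
        (l'.map fun g => GateApp.one (hIdx G) (co g)) (fixOn (S \ A) (fun _ => false) φ)
      rw [List.singleton_append] at happ
      have hset : A ∪ {co g} ∪ {w | ∃ g ∈ l', co g = w} = A ∪ {w | ∃ g' ∈ g :: l', co g' = w} := by
        ext w
        simp only [Set.mem_union, Set.mem_singleton_iff, Set.mem_ofPred_eq, List.mem_cons,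
          exists_eq_or_imp, eq_comm (a := w), or_assoc]
      rw [List.map_cons, happ, h1, act_smul, h2, hset]
      funext x
      rw [List.length_cons, pow_succ]
      ring
  have h := key l hl ∅ fun _ _ => id
  rw [Set.sdiff_empty] at h
  rw [h]
  funext x
  have hlen : l.length = Fintype.card Γ := by
    rw [← List.toFinset_card_of_nodup hl, ← Finset.card_univ]
    congr 1
    ext g; simp [hmem]
  rw [hlen]
  congr 1
  -- A state that is left free on the coin wires is the sum of its parts over all coin values; at
  -- `x` only the part with the values of `x` survives.
  rw [Finset.sum_eq_single fun g => x (co g)]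
  · have : Agree (S \ (∅ ∪ {w | ∃ g ∈ l, co g = w})) (fun _ => false) x ↔
        Agree S (Function.extend co (fun g => x (co g)) fun _ => false) x := by
      constructor
      · intro h w hw
        by_cases hc : ∃ g, co g = w
        · obtain ⟨g, rfl⟩ := hc
          rw [hco.extend_apply]
        · rw [Function.extend_apply' _ _ _ hc]
          exact h w ⟨hw, by simpa [hmem] using hc⟩
      · rintro h w ⟨hw, hw'⟩
        rw [h w hw, Function.extend_apply']
        simpa [hmem] using hw'
    exact fixOn_eq this rfl
  · intro v _ hv
    rw [fixOn, if_neg]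
    intro hx
    apply hv
    funext g
    rw [hx (co g) (hS g), hco.extend_apply]
  · simp

/-- Circuits on disjoint groups of wires act separately on the factors of a product state. -/
theorem act_groups {ι L : Type} [Fintype ι] [DecidableEq ι] [DecidableEq L] {emb : ι → L → W}
    (hemb : ∀ i, Function.Injective (emb i)) (hdisj : ∀ i j, i ≠ j → ∀ a b, emb i a ≠ emb j b)
    {Λ : ι → List (GateApp G L)} {g g' : ι → (L → Bool) → ℂ} (hg : ∀ i, act (Λ i) (g i) = g' i)
    {A : (W → Bool) → ℂ} (hA : ∀ i, IndepOf (emb i) A) (l : List ι) (hl : l.Nodup) : ∀ s : Finset ι,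
    (∀ i ∈ l, i ∉ s) →
    act (l.flatMap fun i => relabel (emb i) (hemb i) (Λ i))
      (fun x => A x * ∏ i, (if i ∈ s then g' i else g i) (x ∘ emb i)) =
      fun x => A x * ∏ i, (if i ∈ s ∨ i ∈ l then g' i else g i) (x ∘ emb i) := by
  induction l with
  | nil => intro s _; simp [act_nil]
  | cons i l ih =>
    intro s hs
    rw [List.nodup_cons] at hl
    have his : i ∉ s := hs i List.mem_cons_self
    have hsplit : ∀ (g₀ : (L → Bool) → ℂ) (x : W → Bool),
        A x * (g₀ (x ∘ emb i) * ∏ j ∈ Finset.univ.erase i, (if j ∈ s then g' j else g j) (x ∘ emb j)) =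
        g₀ (x ∘ emb i) *
          (A x * ∏ j ∈ Finset.univ.erase i, (if j ∈ s then g' j else g j) (x ∘ emb j)) := by
      intro g₀ x; ring
    -- The factors of the other groups do not see the wires of group `i`, so they act as a scalar
    -- for its circuit.
    have hχ : IndepOf (emb i) fun x =>
        A x * ∏ j ∈ Finset.univ.erase i, (if j ∈ s then g' j else g j) (x ∘ emb j) := by
      intro x a b
      beta_reduce
      rw [hA i]
      congr 1
      refine Finset.prod_congr rfl fun j hj => ?_
      refine congrArg _ (funext fun c => ?_)
      exact Function.update_of_ne (hdisj j i (Finset.ne_of_mem_erase hj) c a) _ _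
    have h1 : act (relabel (emb i) (hemb i) (Λ i))
        (fun x => A x * ∏ j, (if j ∈ s then g' j else g j) (x ∘ emb j)) =
        fun x => A x * ∏ j, (if j ∈ insert i s then g' j else g j) (x ∘ emb j) := by
      have e1 : (fun x => A x * ∏ j, (if j ∈ s then g' j else g j) (x ∘ emb j)) = fun x =>
          g i (x ∘ emb i) *
          (A x * ∏ j ∈ Finset.univ.erase i, (if j ∈ s then g' j else g j) (x ∘ emb j)) := by
        funext x
        rw [← hsplit, ← Finset.mul_prod_erase _ _ (Finset.mem_univ i), if_neg his]
      have e2 : (fun x => A x * ∏ j, (if j ∈ insert i s then g' j else g j) (x ∘ emb j)) = fun x =>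
          g' i (x ∘ emb i) *
          (A x * ∏ j ∈ Finset.univ.erase i, (if j ∈ s then g' j else g j) (x ∘ emb j)) := by
        funext x
        rw [← hsplit, ← Finset.mul_prod_erase _ _ (Finset.mem_univ i), if_pos (Finset.mem_insert_self _ _)]
        congr 2
        refine Finset.prod_congr rfl fun j hj => ?_
        simp [Finset.ne_of_mem_erase hj]
      rw [e1, e2, act_relabel _ _ _ hχ, hg]
    rw [List.flatMap_cons, act_append, h1, ih hl.2 (insert i s)]
    · funext x
      congr 1
      refine Finset.prod_congr rfl fun j _ => ?_
      have : (j ∈ insert i s ∨ j ∈ l) ↔ (j ∈ s ∨ j ∈ i :: l) := by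
        simp only [Finset.mem_insert, List.mem_cons]; tauto
      simp only [this]
    · intro j hj
      rw [Finset.mem_insert]
      rintro (rfl | h)
      · exact hl.1 hj
      · exact hs j (List.mem_cons_of_mem _ hj) h

end Fixed

/-! ### Norms of product states -/

section Norms

variable {W W' : Type} [Fintype W] [Fintype W'] [DecidableEq W] [DecidableEq W']

open scoped Classical in
/-- Sums over assignments factor into a part on the range of `f` and a part off the range. -/
theorem sum_range_mul {f : W → W'} (hf : Function.Injective f) (F : (W → Bool) → ℝ)
    (H : (W' → Bool) → ℝ) (hH : ∀ x y : W' → Bool, (∀ w, w ∉ Set.range f → x w = y w) → H x = H y) :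
    ∑ x : W' → Bool, F (x ∘ f) * H x =
      (∑ z, F z) * ∑ u : {w // w ∉ Set.range f} → Bool, H fun w =>
        if h : w ∉ Set.range f then u ⟨w, h⟩ else false := by
  let e : (W' → Bool) ≃ (W → Bool) × ({w // w ∉ Set.range f} → Bool) :=
    { toFun := fun x => (x ∘ f, fun w => x w)
      invFun := fun p w => if h : w ∉ Set.range f then p.2 ⟨w, h⟩
        else p.1 (not_not.1 h).choose
      left_inv := fun x => by
        funext w
        by_cases h : w ∉ Set.range f
        · simp [h]
        · simp only [h, dite_false]
          exact congrArg x (not_not.1 h).choose_spec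
      right_inv := fun p => by
        refine Prod.ext ?_ ?_
        · funext w
          have h : ¬ f w ∉ Set.range f := fun h => h ⟨w, rfl⟩
          simp only [Function.comp, h, dite_false]
          exact congrArg p.1 (hf (not_not.1 h).choose_spec)
        · funext w
          simp [w.2] }
  rw [← e.symm.sum_comp, Fintype.sum_prod_type, Finset.sum_mul]
  refine Finset.sum_congr rfl fun z _ => ?_
  rw [Finset.mul_sum]
  refine Finset.sum_congr rfl fun u _ => ?_
  have h1 : (e.symm (z, u)) ∘ f = z := congrArg Prod.fst (e.apply_symm_apply (z, u))
  have h2 : ∀ w : {w // w ∉ Set.range f}, e.symm (z, u) w = u w :=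
    fun w => congrFun (congrArg Prod.snd (e.apply_symm_apply (z, u))) w
  rw [h1]
  congr 1
  refine hH _ _ fun w hw => ?_
  rw [h2 ⟨w, hw⟩, dif_pos hw]

/-- At most one summand is nonzero, so there is no interference. It is applied to the branches of
different coin outcomes. -/
theorem norm_sq_sum_of_disjoint {ι : Type} [Fintype ι] (f : ι → ℂ)
    (h : ∀ i j, f i ≠ 0 → f j ≠ 0 → i = j) : ‖∑ i, f i‖ ^ 2 = ∑ i, ‖f i‖ ^ 2 := by
  classical
  by_cases h0 : ∃ i, f i ≠ 0
  · obtain ⟨i, hi⟩ := h0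
    have hz : ∀ j, j ≠ i → f j = 0 := fun j hj => by
      by_contra hfj
      exact hj (h j i hfj hi)
    rw [Finset.sum_eq_single i (fun j _ hj => hz j hj) (by simp),
      Finset.sum_eq_single i (fun j _ hj => by simp [hz j hj]) (by simp)]
  · push Not at h0
    simp [h0]

end Norms

/-! ### Selected exchanges of registers -/

section Exchange

variable {G : GateSet} {W : Type} [DecidableEq W] {I J : Type}

/-- The product of the transpositions of `f i` and `g i`, for `i` in a list. -/
def exchange (f g : I → W) (l : List I) : Equiv.Perm W :=
  l.foldl (fun σ i => Equiv.swap (f i) (g i) * σ) 1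

theorem exchange_concat (f g : I → W) (l : List I) (i : I) :
    exchange f g (l ++ [i]) = Equiv.swap (f i) (g i) * exchange f g l := by
  simp [exchange, List.foldl_append]

theorem exchange_of_ne (f g : I → W) (w : W) (hf : ∀ i, w ≠ f i) (hg : ∀ i, w ≠ g i) (l : List I) :
    exchange f g l w = w := by
  induction l using List.reverseRecOn with
  | nil => rfl
  | append_singleton l i ih =>
    rw [exchange_concat, Equiv.Perm.mul_apply, ih, Equiv.swap_apply_of_ne_of_ne (hf i) (hg i)]

theorem exchange_apply {f g : I → W} (hf : Function.Injective f) (hg : Function.Injective g)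
    (hfg : ∀ i j, f i ≠ g j) [DecidableEq I] {l : List I} (hl : l.Nodup) (i : I) :
    exchange f g l (f i) = (if i ∈ l then g i else f i) ∧
      exchange f g l (g i) = if i ∈ l then f i else g i := by
  induction l using List.reverseRecOn with
  | nil => exact ⟨rfl, rfl⟩
  | append_singleton l j ih =>
    rw [List.nodup_append] at hl
    obtain ⟨h1, h2⟩ := ih hl.1
    rw [exchange_concat, Equiv.Perm.mul_apply, Equiv.Perm.mul_apply, h1, h2]
    by_cases hij : i = j
    · subst hij
      have : i ∉ l := fun h => hl.2.2 i h i (by simp) rfl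
      simp [this]
    · have e1 : Equiv.swap (f j) (g j) (f i) = f i :=
        Equiv.swap_apply_of_ne_of_ne (hf.ne hij) (hfg _ _)
      have e2 : Equiv.swap (f j) (g j) (g i) = g i :=
        Equiv.swap_apply_of_ne_of_ne (hfg _ _).symm (hg.ne hij)
      by_cases hi : i ∈ l <;> simp [hi, hij, e1, e2]

/-- One classical control decides about a whole bundle of swaps of quantum wires, so the bundle acts
as a single permutation of wires or not at all. -/
theorem act_exchange {S : Set W} {k : W → Bool} {c : W} {f g : I → W} (hc : c ∈ S)
    (hf : ∀ i, f i ∉ S) (hg : ∀ i, g i ∉ S) (hfg : ∀ i j, f i ≠ g j) (l : List I)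
    (φ : (W → Bool) → ℂ) :
    act (l.flatMap fun i => cswap G c (f i) (g i)) (fixOn S k φ) =
      fixOn S k (if k c then fun x => φ (x ∘ exchange f g l) else φ) := by
  induction l using List.reverseRecOn with
  | nil => simp [act_nil, exchange]
  | append_singleton l i ih =>
    rw [List.flatMap_append, act_append, ih, List.flatMap_cons, List.flatMap_nil, List.append_nil,
      act_cswap_fixOn_ctrl _ hc (hf i) (hg i) (hfg i i)]
    congr 1
    cases k c
    · simp
    · simp only [if_true]
      funext x
      rw [exchange_concat]
      rfl

/-- Among several exchanges, those that belong to the value `j₀` of a one-hot register are made. -/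
theorem act_selected_exchange [DecidableEq J] {S : Set W} {k : W → Bool} {c : J → W} {f g : J → I → W}
    (hc : ∀ j, c j ∈ S) (hf : ∀ j i, f j i ∉ S) (hg : ∀ j i, g j i ∉ S)
    (hfg : ∀ j i i', f j i ≠ g j i') {j₀ : J} (hk : ∀ j, k (c j) = decide (j = j₀)) (l : List I)
    (φ : (W → Bool) → ℂ) {lJ : List J} (hlJ : lJ.Nodup) :
    act (lJ.flatMap fun j => l.flatMap fun i => cswap G (c j) (f j i) (g j i)) (fixOn S k φ) =
      fixOn S k (if j₀ ∈ lJ then fun x => φ (x ∘ exchange (f j₀) (g j₀) l) else φ) := by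
  induction lJ generalizing φ with
  | nil => simp [act_nil]
  | cons j lJ ih =>
    rw [List.nodup_cons] at hlJ
    rw [List.flatMap_cons, act_append, act_exchange (hc j) (hf j) (hg j) (hfg j), hk, ih _ hlJ.2]
    congr 1
    by_cases h : j = j₀
    · subst h; simp [hlJ.1]
    · simp [h, Ne.symm h]

end Exchange

/-! ### Updates of an assignment along a list -/

section Foldl

variable {I B : Type} [DecidableEq I]

theorem foldl_update (τ : I → B → B) (l : List I) (hl : l.Nodup) : ∀ f : I → B,
    l.foldl (fun f i => Function.update f i (τ i (f i))) f = fun i => if i ∈ l then τ i (f i) else f i := by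
  induction l with
  | nil => intro f; simp
  | cons i l ih =>
    intro f
    rw [List.nodup_cons] at hl
    rw [List.foldl_cons, ih hl.2]
    funext j
    by_cases hj : j = i
    · subst hj; simp [hl.1]
    · simp [hj]

theorem foldl_update_same {A : Type} (τ : A → B → B) (i : I) (l : List A) : ∀ f : I → B,
    l.foldl (fun f a => Function.update f i (τ a (f i))) f =
      Function.update f i (l.foldl (fun b a => τ a b) (f i)) := by
  induction l with
  | nil => intro f; simp
  | cons a l ih => intro f; rw [List.foldl_cons, ih]; simp

end Foldl

/-! ### The registers of the learner -/

/-- The wires of the learner: the copies of the unknown state, its output, the coins for the bricks and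
for the position of the unknown state, the one-hot position register, the one-hot descriptions of the
bricks, the public key and its dummy wires, and the remaining wires of the forger. -/
inductive Wire (G : GateSet) (n t q R anc : ℕ) : Type where
  | inp (c : Fin q) (i : Fin n)
  | out (d : DescIdx G n)
  | coin (a : Bool × Fin t) (s : Slot n) (r : Fin R) (p : Brick G × Brick G)
  | hcoin (v : Fin (t - 1))
  | heap (v : Fin (2 * t + 1))
  | desc (a : Bool × Fin t) (d : DescIdx G n)
  | key (c : Fin q) (a : Bool × Fin t) (i : Fin n)
  | dum (c : Fin q) (a : Bool × Fin t) (b : Bool)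
  | msg
  | fmsg
  | fsig (j : Fin t) (d : DescIdx G n)
  | fanc (i : Fin anc)

namespace Wire

variable {G : GateSet} {n t q R anc : ℕ}

noncomputable instance : DecidableEq (Wire G n t q R anc) := Classical.decEq _

/-- The wires that carry classical data before the forger runs. -/
def IsClassical : Wire G n t q R anc → Prop
  | .coin .. | .hcoin _ | .heap _ | .desc .. | .msg => True
  | _ => False

variable (G n t q R anc) in
/-- The wires that carry classical data before the forger runs. -/
def classical : Set (Wire G n t q R anc) := {w | w.IsClassical}

theorem coin_mem {a : Bool × Fin t} {s : Slot n} {r : Fin R} {p : Brick G × Brick G} :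
    (.coin a s r p : Wire G n t q R anc) ∈ classical G n t q R anc := trivial
theorem hcoin_mem {v : Fin (t - 1)} : (.hcoin v : Wire G n t q R anc) ∈ classical G n t q R anc := trivial
theorem heap_mem {v : Fin (2 * t + 1)} : (.heap v : Wire G n t q R anc) ∈ classical G n t q R anc := trivial
theorem desc_mem {a : Bool × Fin t} {d : DescIdx G n} :
    (.desc a d : Wire G n t q R anc) ∈ classical G n t q R anc := trivial

/-- The coins. -/
abbrev Coins (G : GateSet) (n t R : ℕ) : Type :=
  (((Bool × Fin t) × Slot n) × Fin R × (Brick G × Brick G)) ⊕ Fin (t - 1)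

instance : DecidableEq ((Bool × Fin t) × Slot n) := inferInstance
instance : DecidableEq (Brick G × Brick G) := inferInstance
instance : DecidableEq (Fin R × (Brick G × Brick G)) := inferInstance
instance : DecidableEq (Coins G n t R) := inferInstance

/-- The wire of a coin. -/
def ofCoin : Coins G n t R → Wire G n t q R anc
  | .inl ((a, s), r, p) => .coin a s r p
  | .inr v => .hcoin v

theorem ofCoin_injective : Function.Injective (ofCoin : Coins G n t R → Wire G n t q R anc) := by
  rintro (⟨⟨a, s⟩, r, p⟩ | v) (⟨⟨a', s'⟩, r', p'⟩ | v') h <;> simp_all [ofCoin]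

open scoped Classical in
/-- The values of the classical wires, for given coins, bricks, position and message. -/
noncomputable def values (m : Bool) (v : Coins G n t R → Bool) (pos : (Bool × Fin t) × Slot n → Brick G)
    (h : ℕ) : Wire G n t q R anc → Bool
  | .coin a s r p => v (.inl ((a, s), r, p))
  | .hcoin i => v (.inr i)
  | .heap i => decide (i.val = h)
  | .desc a d => decide (pos (a, d.1) = d.2)
  | .msg => m
  | _ => false

end Wire

/-! ### Enumerations -/

section Enumerations

variable (G : GateSet) (n t R : ℕ)

def keyList : List (Bool × Fin t) := List.product [false, true] (List.finRange t)

def slotList : List (Slot n) :=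
  (List.finRange (depth n)).sigma fun l => List.finRange ((n - l.val % 2) / 2)

def posList : List ((Bool × Fin t) × Slot n) := List.product (keyList t) (slotList n)

/-- Any fixed order will do. The number of bricks does not depend on `n`, so the list can be
hard-wired into the program that writes the learner. -/
noncomputable def brickList : List (Brick G) := Finset.univ.toList

open scoped Classical in
noncomputable def pairList : List (Brick G × Brick G) :=
  (List.product (brickList G) (brickList G)).filter fun p => p.1 ≠ p.2

noncomputable def coinList : List (Wire.Coins G n t R) :=
  (List.product (posList n t)
    (List.product (List.finRange R) (List.product (brickList G) (brickList G)))).map .inl ++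
    (List.finRange (t - 1)).map .inr

variable {G n t R}

theorem mem_keyList (a : Bool × Fin t) : a ∈ keyList t := by
  obtain ⟨b, j⟩ := a
  rw [keyList, List.pair_mem_product]
  cases b <;> simp

theorem nodup_keyList : (keyList t).Nodup := List.Nodup.product (by simp) (List.nodup_finRange t)

theorem mem_slotList (s : Slot n) : s ∈ slotList n := by
  obtain ⟨l, j⟩ := s
  simp [slotList]

theorem nodup_slotList : (slotList n).Nodup :=
  List.Nodup.sigma (List.nodup_finRange _) fun _ => List.nodup_finRange _

theorem mem_posList (i : (Bool × Fin t) × Slot n) : i ∈ posList n t := by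
  obtain ⟨a, s⟩ := i
  rw [posList, List.pair_mem_product]
  exact ⟨mem_keyList a, mem_slotList s⟩

theorem nodup_posList : (posList n t).Nodup := nodup_keyList.product nodup_slotList

theorem mem_brickList (b : Brick G) : b ∈ brickList G := by simp [brickList]

theorem nodup_brickList : (brickList G).Nodup := Finset.nodup_toList _

theorem mem_pairList {p : Brick G × Brick G} : p ∈ pairList G ↔ p.1 ≠ p.2 := by
  obtain ⟨b, b'⟩ := p
  simp [pairList, mem_brickList]

theorem nodup_pairList : (pairList G).Nodup :=
  (List.Nodup.product nodup_brickList nodup_brickList).filter _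

theorem mem_coinList (g : Wire.Coins G n t R) : g ∈ coinList G n t R := by
  rcases g with ⟨⟨a, s⟩, r, p, p'⟩ | v
  · simp [coinList, mem_posList, mem_brickList]
  · simp [coinList]

theorem nodup_coinList : (coinList G n t R).Nodup := by
  refine List.nodup_append.2 ⟨?_, ?_, ?_⟩
  · exact (nodup_posList.product ((List.nodup_finRange R).product
      (nodup_brickList.product nodup_brickList))).map Sum.inl_injective
  · exact (List.nodup_finRange _).map Sum.inr_injective
  · simp only [List.mem_map]
    rintro _ ⟨_, _, rfl⟩ _ ⟨_, _, rfl⟩ h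
    cases h

end Enumerations

/-! ### The classical part of the learner -/

section ClassicalPart

variable {G : GateSet} {n t q R anc : ℕ}

variable (G) in
/-- The brick with which the random walks start. -/
noncomputable def brick₀ : Brick G := Classical.arbitrary _

variable (G n t q R anc) in
/-- The wires that are flipped at the beginning. -/
noncomputable def setupList (m : Bool) (ht : 0 < t) : List (Wire G n t q R anc) :=
  ((posList n t).map fun i => .desc i.1 (i.2, brick₀ G)) ++
    .heap ⟨0, by omega⟩ :: if m then [.msg] else []

variable (G n t q R anc) in
noncomputable def setupGates (m : Bool) (ht : 0 < t) : List (GateApp G (Wire G n t q R anc)) :=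
  ((coinList G n t R).map fun g => GateApp.one (hIdx G) (.ofCoin g)) ++
    (setupList G n t q R anc m ht).flatMap fun w => notGate G w

variable (G n t q R anc) in
-- A swap of the description wires of two bricks transposes these bricks in the one-hot register.
-- For each slot of each block this realizes `R` rounds of the random walk `swaps`.
noncomputable def walkGates : List (GateApp G (Wire G n t q R anc)) :=
  (posList n t).flatMap fun i => (List.finRange R).flatMap fun r =>
    (pairList G).flatMap fun p => cswap G (.coin i.1 i.2 r p) (.desc i.1 (i.2, p.1)) (.desc i.1 (i.2, p.2))

variable (G n t q R anc) in
-- The token is the single wire with value one. It moves from `v` to the left child unconditionally,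
-- and a coin then decides whether it goes over to the right child, as in `heapStep`.
noncomputable def heapGates : List (GateApp G (Wire G n t q R anc)) :=
  (List.finRange (t - 1)).flatMap fun v =>
    swapGate G (.heap ⟨v.val, by omega⟩) (.heap ⟨2 * v.val + 1, by omega⟩) ++
      cswap G (.hcoin v) (.heap ⟨2 * v.val + 1, by omega⟩) (.heap ⟨2 * v.val + 2, by omega⟩)

theorem nodup_setupList (m : Bool) (ht : 0 < t) : (setupList G n t q R anc m ht).Nodup := by
  rw [setupList, List.nodup_append]
  refine ⟨?_, ?_, ?_⟩
  · refine nodup_posList.map ?_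
    rintro ⟨a, s⟩ ⟨a', s'⟩ h
    simp_all
  · cases m <;> simp
  · intro a ha b hb
    obtain ⟨i, _, rfl⟩ := List.mem_map.1 ha
    cases m <;> simp at hb <;> aesop

theorem setupList_classical {m : Bool} {ht : 0 < t} :
    ∀ w ∈ setupList G n t q R anc m ht, w ∈ Wire.classical G n t q R anc := by
  intro w hw
  rw [setupList, List.mem_append] at hw
  rcases hw with hw | hw
  · obtain ⟨i, _, rfl⟩ := List.mem_map.1 hw
    trivial
  · cases m <;> simp at hw
    · subst hw; trivial
    · rcases hw with rfl | rfl <;> trivial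

theorem foldl_perm_apply {A B : Type} (τ : A → Equiv.Perm B) (l : List A) : ∀ (σ : Equiv.Perm B) (b : B),
    l.foldl (fun b a => τ a b) (σ b) = l.foldl (fun σ a => τ a * σ) σ b := by
  induction l with
  | nil => intro σ b; rfl
  | cons a l ih => intro σ b; exact ih (τ a * σ) b

theorem foldl_finRange_walk {U B : Type} (f : U → Equiv.Perm B) : ∀ (R : ℕ) (u : Fin R → U) (b : B),
    (List.finRange R).foldl (fun b r => f (u r) b) b = walk f R u b := by
  intro R
  induction R with
  | zero => intro u b; rfl
  | succ R ih =>
    intro u b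
    rw [List.finRange_succ, List.foldl_cons, List.foldl_map, walk, Equiv.Perm.mul_apply, ← ih]
    rfl

/-- The bricks that the random walks reach. -/
noncomputable def walkEnd (v : Wire.Coins G n t R → Bool) (i : (Bool × Fin t) × Slot n) : Brick G :=
  walk (fun u => swaps u (pairList G)) R (fun r p => v (.inl (i, r, p))) (brick₀ G)

variable {φ : (Wire G n t q R anc → Bool) → ℂ} (hφ : IndepSet (Wire.classical G n t q R anc) φ)
include hφ

/-- From here on each coin outcome `v` is a separate branch; all branches have the same amplitude
and initially differ only in the coins. -/
theorem act_setupGates (m : Bool) (ht : 0 < t) :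
    act (setupGates G n t q R anc m ht) (fixOn (Wire.classical G n t q R anc) (fun _ => false) φ) =
      fun x => ((Real.sqrt 2 : ℂ)⁻¹) ^ Fintype.card (Wire.Coins G n t R) *
        ∑ v : Wire.Coins G n t R → Bool,
          fixOn (Wire.classical G n t q R anc) (Wire.values m v (fun _ => brick₀ G) 0) φ x := by
  classical
  rw [setupGates, act_append, act_hadamards Wire.ofCoin_injective _ hφ nodup_coinList mem_coinList,
    act_smul, act_sum]
  · funext x
    congr 1
    refine Finset.sum_congr rfl fun v _ => ?_
    rw [act_notGates_fixOn hφ _ (nodup_setupList m ht) setupList_classical]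
    refine congrFun (fixOn_congr (fun w hw => ?_) φ) x
    have hext : ∀ g, Function.extend Wire.ofCoin v (fun _ => false)
        (Wire.ofCoin g : Wire G n t q R anc) = v g := fun g => Wire.ofCoin_injective.extend_apply _ _ _
    have hext' : ∀ w : Wire G n t q R anc, (∀ g, Wire.ofCoin g ≠ w) →
        Function.extend Wire.ofCoin v (fun _ => false) w = false := fun w h =>
      Function.extend_apply' _ _ _ fun ⟨g, hg⟩ => h g hg
    cases w with
    | coin a s r p =>
      have h1 : (Wire.coin a s r p : Wire G n t q R anc) ∉ setupList G n t q R anc m ht := by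
        cases m <;> simp [setupList]
      rw [if_neg h1]
      exact hext (.inl ((a, s), r, p))
    | hcoin i =>
      have h1 : (Wire.hcoin i : Wire G n t q R anc) ∉ setupList G n t q R anc m ht := by
        cases m <;> simp [setupList]
      rw [if_neg h1]
      exact hext (.inr i)
    | heap i =>
      rw [hext' _ (by rintro (_ | _) h <;> cases h)]
      have h1 : (Wire.heap i : Wire G n t q R anc) ∈ setupList G n t q R anc m ht ↔ i.val = 0 := by
        rw [Fin.val_eq_zero_iff]
        cases m <;> simp [setupList]
      by_cases hi : i.val = 0
      · rw [if_pos (h1.2 hi)]; simp [Wire.values, hi]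
      · rw [if_neg (mt h1.1 hi)]; simp [Wire.values, hi]
    | desc a d =>
      rw [hext' _ (by rintro (_ | _) h <;> cases h)]
      have h1 : (Wire.desc a d : Wire G n t q R anc) ∈ setupList G n t q R anc m ht ↔ brick₀ G = d.2 := by
        obtain ⟨s, b⟩ := d
        rw [setupList, List.mem_append, List.mem_map]
        constructor
        · rintro (⟨i, _, h⟩ | h)
          · cases h; rfl
          · cases m <;> simp at h
        · intro h
          exact Or.inl ⟨(a, s), mem_posList _, by rw [h]⟩
      by_cases hi : brick₀ G = d.2
      · rw [if_pos (h1.2 hi)]; simp [Wire.values, hi]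
      · rw [if_neg (mt h1.1 hi)]; simp [Wire.values, hi]
    | msg =>
      rw [hext' _ (by rintro (_ | _) h <;> cases h)]
      have h1 : (Wire.msg : Wire G n t q R anc) ∈ setupList G n t q R anc m ht ↔ m = true := by
        cases m <;> simp [setupList]
      cases m
      · rw [if_neg (by simp [h1])]; rfl
      · rw [if_pos (by simp [h1])]; rfl
    | _ => exact hw.elim
  · rintro (_ | _) <;> trivial

/-- In a one-hot register, permuting the wires is the same as permuting the value that the register
holds. -/
theorem act_walkGates_step (m : Bool) (v : Wire.Coins G n t R → Bool)
    (pos : (Bool × Fin t) × Slot n → Brick G) (h : ℕ) (i : (Bool × Fin t) × Slot n) (r : Fin R)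
    {p : Brick G × Brick G} (hp : p.1 ≠ p.2) :
    act (cswap G (.coin i.1 i.2 r p) (.desc i.1 (i.2, p.1)) (.desc i.1 (i.2, p.2)))
      (fixOn (Wire.classical G n t q R anc) (Wire.values m v pos h) φ) =
    fixOn (Wire.classical G n t q R anc) (Wire.values m v (Function.update pos i
      ((if v (.inl (i, r, p)) then Equiv.swap p.1 p.2 else 1 : Equiv.Perm (Brick G)) (pos i))) h) φ := by
  rw [act_cswap_fixOn hφ Wire.coin_mem Wire.desc_mem Wire.desc_mem (by simp) (by simp) (by simpa using hp)]
  have hv : (Wire.values m v pos h (Wire.coin i.1 i.2 r p : Wire G n t q R anc)) = v (.inl (i, r, p)) := rfl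
  rw [hv]
  refine fixOn_congr (fun w hw => ?_) φ
  cases hb : v (.inl (i, r, p))
  · simp
  · simp only [if_true, Function.comp]
    obtain ⟨a, s⟩ := i
    obtain ⟨p1, p2⟩ := p
    cases w with
    | desc a' d =>
      obtain ⟨s', b⟩ := d
      by_cases hi : (a', s') = (a, s)
      · obtain ⟨rfl, rfl⟩ := Prod.mk.inj hi
        have h1 : Equiv.swap (Wire.desc a' (s', p1)) (Wire.desc a' (s', p2))
            (Wire.desc a' (s', b) : Wire G n t q R anc) = Wire.desc a' (s', Equiv.swap p1 p2 b) := by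
          by_cases e1 : b = p1
          · subst e1; simp
          · by_cases e2 : b = p2
            · subst e2; simp
            · rw [Equiv.swap_apply_of_ne_of_ne e1 e2, Equiv.swap_apply_of_ne_of_ne] <;> simp [e1, e2]
        simp only [h1]
        simp only [Wire.values, Function.update_self]
        refine decide_eq_decide.2 ?_
        rw [Equiv.swap_apply_eq_iff]
      · rw [Equiv.swap_apply_of_ne_of_ne]
        · simp only [Wire.values]
          rw [Function.update_of_ne hi]
        · intro h'; apply hi; simp_all
        · intro h'; apply hi; simp_all
    | _ => first | exact hw.elim | (rw [Equiv.swap_apply_of_ne_of_ne (by simp) (by simp)]; rfl)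

theorem act_walkGates (m : Bool) (v : Wire.Coins G n t R → Bool) (h : ℕ) :
    act (walkGates G n t q R anc)
      (fixOn (Wire.classical G n t q R anc) (Wire.values m v (fun _ => brick₀ G) h) φ) =
    fixOn (Wire.classical G n t q R anc) (Wire.values m v (walkEnd v) h) φ := by
  have h1 : ∀ i r (pos : (Bool × Fin t) × Slot n → Brick G),
      act ((pairList G).flatMap fun p =>
        cswap G (.coin i.1 i.2 r p) (.desc i.1 (i.2, p.1)) (.desc i.1 (i.2, p.2)))
        (fixOn (Wire.classical G n t q R anc) (Wire.values m v pos h) φ) =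
      fixOn (Wire.classical G n t q R anc) (Wire.values m v
        (Function.update pos i (swaps (fun p => v (.inl (i, r, p))) (pairList G) (pos i))) h) φ := by
    intro i r pos
    rw [act_flatMap_foldl (st := fun pos => fixOn (Wire.classical G n t q R anc) (Wire.values m v pos h) φ)
      (fun p hp pos => act_walkGates_step hφ m v pos h i r (mem_pairList.1 hp)), foldl_update_same, swaps,
      ← foldl_perm_apply]
    rfl
  have h2 : ∀ i (pos : (Bool × Fin t) × Slot n → Brick G),
      act ((List.finRange R).flatMap fun r => (pairList G).flatMap fun p =>
        cswap G (.coin i.1 i.2 r p) (.desc i.1 (i.2, p.1)) (.desc i.1 (i.2, p.2)))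
        (fixOn (Wire.classical G n t q R anc) (Wire.values m v pos h) φ) =
      fixOn (Wire.classical G n t q R anc) (Wire.values m v
        (Function.update pos i (walk (fun u => swaps u (pairList G)) R
          (fun r p => v (.inl (i, r, p))) (pos i))) h) φ := by
    intro i pos
    rw [act_flatMap_foldl (st := fun pos => fixOn (Wire.classical G n t q R anc) (Wire.values m v pos h) φ)
      (fun r _ pos => h1 i r pos),
      foldl_update_same (fun r b => swaps (fun p => v (.inl (i, r, p))) (pairList G) b),
      ← foldl_finRange_walk]
  rw [walkGates,
    act_flatMap_foldl (st := fun pos => fixOn (Wire.classical G n t q R anc) (Wire.values m v pos h) φ)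
      (fun i _ pos => h2 i pos),
    foldl_update (fun i b => walk (fun u => swaps u (pairList G)) R (fun r p => v (.inl (i, r, p))) b) _
      nodup_posList]
  congr 2
  funext ⟨a, s⟩
  simp [mem_posList, walkEnd]

theorem act_heapGates (m : Bool) (v : Wire.Coins G n t R → Bool)
    (pos : (Bool × Fin t) × Slot n → Brick G) :
    act (heapGates G n t q R anc)
      (fixOn (Wire.classical G n t q R anc) (Wire.values m v pos 0) φ) =
    fixOn (Wire.classical G n t q R anc)
      (Wire.values m v pos (heapWalk (t - 1) fun i => v (.inr i))) φ := by
  have hsw : ∀ (h x y : ℕ) (hx : x < 2 * t + 1) (hy : y < 2 * t + 1), ∀ w,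
      (Wire.values m v pos h ∘ Equiv.swap (Wire.heap ⟨x, hx⟩) (Wire.heap ⟨y, hy⟩) :
        Wire G n t q R anc → Bool) w = Wire.values m v pos (Equiv.swap x y h) w := by
    intro h x y hx hy w
    simp only [Function.comp]
    cases w with
    | heap i =>
      have h1 : Equiv.swap (Wire.heap ⟨x, hx⟩) (Wire.heap ⟨y, hy⟩) (Wire.heap i : Wire G n t q R anc) =
          Wire.heap (Equiv.swap ⟨x, hx⟩ ⟨y, hy⟩ i) := by
        by_cases e1 : i = ⟨x, hx⟩
        · subst e1; simp
        · by_cases e2 : i = ⟨y, hy⟩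
          · subst e2; simp
          · rw [Equiv.swap_apply_of_ne_of_ne e1 e2, Equiv.swap_apply_of_ne_of_ne] <;> simp [e1, e2]
      have h2 : (Equiv.swap (⟨x, hx⟩ : Fin (2 * t + 1)) ⟨y, hy⟩ i).val = Equiv.swap x y i.val := by
        by_cases e1 : i = ⟨x, hx⟩
        · subst e1; simp
        · by_cases e2 : i = ⟨y, hy⟩
          · subst e2; simp
          · rw [Equiv.swap_apply_of_ne_of_ne e1 e2, Equiv.swap_apply_of_ne_of_ne
              (fun h => e1 (Fin.ext h)) (fun h => e2 (Fin.ext h))]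
      rw [h1]
      simp only [Wire.values, h2]
      refine decide_eq_decide.2 ?_
      rw [Equiv.swap_apply_eq_iff]
    | _ => rw [Equiv.swap_apply_of_ne_of_ne (by simp) (by simp)]; rfl
  have h1 : ∀ (i : Fin (t - 1)) (h : ℕ),
      act (swapGate G (.heap ⟨i.val, by omega⟩) (.heap ⟨2 * i.val + 1, by omega⟩) ++
        cswap G (.hcoin i) (.heap ⟨2 * i.val + 1, by omega⟩) (.heap ⟨2 * i.val + 2, by omega⟩))
        (fixOn (Wire.classical G n t q R anc) (Wire.values m v pos h) φ) =
      fixOn (Wire.classical G n t q R anc) (Wire.values m v pos (heapStep i.val (v (.inr i)) h)) φ := by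
    intro i h
    rw [act_append, act_swapGate_fixOn hφ Wire.heap_mem Wire.heap_mem (by simp; omega),
      fixOn_congr (fun w _ => hsw h _ _ _ _ w),
      act_cswap_fixOn hφ Wire.hcoin_mem Wire.heap_mem Wire.heap_mem (by simp) (by simp) (by simp)]
    have hv : ∀ h', Wire.values m v pos h' (Wire.hcoin i : Wire G n t q R anc) = v (.inr i) := fun _ => rfl
    rw [hv, heapStep]
    cases v (.inr i)
    · rfl
    · exact fixOn_congr (fun w _ => hsw _ _ _ _ _ w) φ
  have h2 : ∀ (M : ℕ) (u : Fin M → Bool),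
      (List.finRange M).foldl (fun h i => heapStep i.val (u i) h) 0 = heapWalk M u := by
    intro M
    induction M with
    | zero => intro u; rfl
    | succ M ih =>
      intro u
      rw [List.finRange_succ_last, List.foldl_append, List.foldl_map, heapWalk]
      simp only [List.foldl_cons, List.foldl_nil, Fin.val_last, Fin.val_castSucc]
      rw [ih fun i => u i.castSucc]
  rw [heapGates,
    act_flatMap_foldl (st := fun h => fixOn (Wire.classical G n t q R anc) (Wire.values m v pos h) φ)
      (fun i _ h => h1 i h), h2 (t - 1) fun i => v (.inr i)]

end ClassicalPart

/-! ### The preparation of the public key -/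

open scoped Classical in
/-- The all-zeros state. -/
noncomputable def zeroKet {W : Type} : (W → Bool) → ℂ := fun x => if ∀ w, x w = false then 1 else 0

theorem zeroKet_eq_single {W : Type} [Fintype W] [DecidableEq W] :
    (zeroKet : (W → Bool) → ℂ) = Pi.single (fun _ => false) 1 := by
  funext x
  rw [zeroKet, Pi.single_apply]
  by_cases h : x = fun _ => false
  · rw [if_pos h, if_pos fun w => congrFun h w]
  · rw [if_neg h, if_neg fun h' => h (funext h')]

theorem sum_norm_sq_zeroKet {W : Type} [Fintype W] [DecidableEq W] :
    ∑ x : W → Bool, ‖(zeroKet : (W → Bool) → ℂ) x‖ ^ 2 = 1 := by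
  rw [zeroKet_eq_single, Finset.sum_eq_single fun _ => false]
  · simp
  · intro x _ hx; simp [hx]
  · simp

theorem zeroKet_sum {L L' : Type} (x : L ⊕ L' → Bool) :
    zeroKet x = zeroKet (x ∘ Sum.inl) * zeroKet (x ∘ Sum.inr) := by
  simp only [zeroKet]
  by_cases h1 : ∀ w, (x ∘ Sum.inl) w = false
  · by_cases h2 : ∀ w, (x ∘ Sum.inr) w = false
    · rw [if_pos h1, if_pos h2, if_pos, mul_one]
      rintro (w | w)
      · exact h1 w
      · exact h2 w
    · rw [if_pos h1, if_neg h2, if_neg, mul_zero]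
      exact fun h => h2 fun w => h (.inr w)
  · rw [if_neg h1, if_neg, zero_mul]
    exact fun h => h1 fun w => h (.inl w)

/-! ### Preparation of a single block. -/

section Local

variable {G : GateSet} {n : ℕ}

theorem relabel_brick_gates {W W' : Type} [DecidableEq W] [DecidableEq W'] (f : W → W')
    (hf : Function.Injective f) (b : Brick G) {i j : W} (h : i ≠ j) :
    relabel f hf (b.gates i j h) = b.gates (f i) (f j) (hf.ne h) := by
  rcases b with ⟨g, g'⟩ | ⟨g, _ | _⟩
  · cases g <;> cases g' <;> rfl
  · rfl
  · rfl

/-- The first wire of a slot. -/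
def Slot.fst (s : Slot n) : Fin n := ⟨s.1.val % 2 + 2 * s.2.val, by have := s.2.isLt; omega⟩

/-- The second wire of a slot. -/
def Slot.snd (s : Slot n) : Fin n := ⟨s.1.val % 2 + 2 * s.2.val + 1, by have := s.2.isLt; omega⟩

theorem Slot.fst_ne_snd (s : Slot n) : s.fst ≠ s.snd := by simp [Slot.fst, Slot.snd, Fin.ext_iff]

theorem flatMap_ite_eq {α β : Type} [DecidableEq α] (F : α → List β) (a : α) (l : List α) (hl : l.Nodup)
    (ha : a ∈ l) : (l.flatMap fun b => if a = b then F b else []) = F a := by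
  obtain ⟨l₁, l₂, rfl⟩ := List.append_of_mem ha
  rw [List.nodup_append] at hl
  have h1 : ∀ b ∈ l₁, (if a = b then F b else []) = [] := fun b hb =>
    if_neg fun h => hl.2.2 b hb a List.mem_cons_self h.symm
  have h2 : ∀ b ∈ l₂, (if a = b then F b else []) = [] := fun b hb =>
    if_neg fun (h : a = b) => (List.nodup_cons.1 hl.2.1).1 (h ▸ hb)
  rw [List.flatMap_append, List.flatMap_cons, if_pos rfl, List.flatMap_eq_nil_iff.2 h1,
    List.flatMap_eq_nil_iff.2 h2]
  simp

/-- The gates of a circuit of the ensemble in the order of its slots. -/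
theorem flatMap_slotList (C : Ckt G n) :
    ((slotList n).flatMap fun s => (brickList G).flatMap fun b =>
      if C s = b then b.gates s.fst s.snd s.fst_ne_snd else []) = C.layers.flatMap Layer.gates := by
  have h1 : ∀ s : Slot n, ((brickList G).flatMap fun b =>
      if C s = b then b.gates s.fst s.snd s.fst_ne_snd else []) =
        (C s).gates s.fst s.snd s.fst_ne_snd := fun s =>
    flatMap_ite_eq (fun b => b.gates s.fst s.snd s.fst_ne_snd) (C s) _ nodup_brickList (mem_brickList _)
  simp only [h1]
  rw [Ckt.layers, List.ofFn_eq_map, List.flatMap_map, slotList, List.sigma, List.flatMap_assoc]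
  refine List.flatMap_congr fun l _ => ?_
  rw [List.flatMap_map]
  rfl

/-- The gates that apply a brick either to the wires of its slot or to two dummy wires. -/
noncomputable def brickOrDummy (C : Ckt G n) (s : Slot n) (b : Brick G) : List (GateApp G (Fin n ⊕ Bool)) :=
  if C s = b then b.gates (.inl s.fst) (.inl s.snd) (by simpa using s.fst_ne_snd)
    else b.gates (.inr false) (.inr true) (by simp)

/-- In every slot every brick is applied once. Only the brick that stands there in `C` hits the
block; all others are diverted to the dummy wires. -/
noncomputable def prepLocal (C : Ckt G n) : List (GateApp G (Fin n ⊕ Bool)) :=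
  (slotList n).flatMap fun s => (brickList G).flatMap fun b => brickOrDummy C s b

theorem act_flatMap_prod {ι L L' : Type} [DecidableEq L] [DecidableEq L'] (l : List ι)
    {F : ι → List (GateApp G (L ⊕ L'))} {A : ι → List (GateApp G L)} {B : ι → List (GateApp G L')}
    (h : ∀ i φ χ, act (F i) (fun x => φ (x ∘ Sum.inl) * χ (x ∘ Sum.inr)) =
      fun x => act (A i) φ (x ∘ Sum.inl) * act (B i) χ (x ∘ Sum.inr)) : ∀ φ χ,
    act (l.flatMap F) (fun x => φ (x ∘ Sum.inl) * χ (x ∘ Sum.inr)) =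
      fun x => act (l.flatMap A) φ (x ∘ Sum.inl) * act (l.flatMap B) χ (x ∘ Sum.inr) := by
  induction l with
  | nil => intro φ χ; rfl
  | cons i l ih =>
    intro φ χ
    simp only [List.flatMap_cons, act_append]
    rw [h, ih]

/-- The dummy wires after the preparation. -/
noncomputable def dummyKet (C : Ckt G n) : (Bool → Bool) → ℂ :=
  act ((slotList n).flatMap fun s => (brickList G).flatMap fun b =>
    if C s = b then [] else b.gates false true (by simp)) zeroKet

/-- Block and dummy wires never interact, so their state stays a product. The block receives the
bricks of `C` in their order, while the dummy wires end in some state determined by `C` that plays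
no further role. -/
theorem act_prepLocal (C : Ckt G n) :
    act (prepLocal C) zeroKet = fun x => C.ket (x ∘ Sum.inl) * dummyKet C (x ∘ Sum.inr) := by
  have hI : ∀ χ : (Bool → Bool) → ℂ,
      IndepOf (Sum.inl : Fin n → Fin n ⊕ Bool) fun x => χ (x ∘ Sum.inr) := by
    intro χ x i b
    refine congrArg χ (funext fun w => ?_)
    simp
  have hI' : ∀ χ : (Fin n → Bool) → ℂ,
      IndepOf (Sum.inr : Bool → Fin n ⊕ Bool) fun x => χ (x ∘ Sum.inl) := by
    intro χ x i b
    refine congrArg χ (funext fun w => ?_)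
    simp
  have h0 : (zeroKet : (Fin n ⊕ Bool → Bool) → ℂ) =
      fun x => zeroKet (x ∘ Sum.inl) * zeroKet (x ∘ Sum.inr) := funext zeroKet_sum
  rw [h0, prepLocal, act_flatMap_prod (slotList n) (fun s => act_flatMap_prod (brickList G) fun b φ χ => ?_)]
  · funext x
    congr 2
    rw [flatMap_slotList, zeroKet_eq_single, Ckt.ket, layersKet, layersMat, circMat_mulVec]
  · by_cases h : C s = b
    · rw [brickOrDummy, if_pos h, if_pos h, if_pos h, act_nil,
        ← relabel_brick_gates Sum.inl Sum.inl_injective b s.fst_ne_snd, act_relabel _ _ _ (hI χ)]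
    · rw [brickOrDummy, if_neg h, if_neg h, if_neg h, act_nil,
        ← relabel_brick_gates Sum.inr Sum.inr_injective b (i := false) (j := true) (by simp)]
      have h2 := act_relabel Sum.inr Sum.inr_injective (b.gates false true (by simp)) (hI' φ) χ
      simp only [mul_comm] at h2 ⊢
      exact h2

end Local

/-! ### Preparation of all copies of the public key. -/

section Prep

variable {G : GateSet} {n t q R anc : ℕ}

/-- The wires on which a copy of a block of the public key is prepared. -/
def Wire.block (c : Fin q × Bool × Fin t) : Fin n ⊕ Bool → Wire G n t q R anc
  | .inl i => .key c.1 c.2 i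
  | .inr b => .dum c.1 c.2 b

theorem Wire.block_injective (c : Fin q × Bool × Fin t) :
    Function.Injective (Wire.block c : Fin n ⊕ Bool → Wire G n t q R anc) := by
  rintro (i | b) (i' | b') h <;> simp_all [Wire.block]

theorem Wire.block_ne {c c' : Fin q × Bool × Fin t} (h : c ≠ c') (a b : Fin n ⊕ Bool) :
    (Wire.block c a : Wire G n t q R anc) ≠ Wire.block c' b := by
  obtain ⟨c, d⟩ := c
  obtain ⟨c', d'⟩ := c'
  rintro h'
  apply h
  cases a <;> cases b <;> simp_all [Wire.block]

theorem Wire.block_notMem (c : Fin q × Bool × Fin t) (a : Fin n ⊕ Bool) :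
    (Wire.block c a : Wire G n t q R anc) ∉ Wire.classical G n t q R anc := by
  cases a <;> exact id

variable (R anc) in
/-- Exchanges the wires of a slot with the dummy wires if a given brick stands in the slot. -/
noncomputable def slotSwap (c : Fin q × Bool × Fin t) (s : Slot n) (b : Brick G) :
    List (GateApp G (Wire G n t q R anc)) :=
  [false, true].flatMap fun e => cswap G (.desc c.2 (s, b)) (.block c (.inl (bif e then s.snd else s.fst)))
    (.block c (.inr e))

variable (R anc) in
-- Controlled versions of the gates of the set need not be available. Instead the brick is always
-- applied to the dummy wires, and controlled swaps decide whether these hold the wires of the slot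
-- at that moment.
noncomputable def prepStep (c : Fin q × Bool × Fin t) (s : Slot n) (b : Brick G) :
    List (GateApp G (Wire G n t q R anc)) :=
  slotSwap R anc c s b ++ b.gates (.dum c.1 c.2 false) (.dum c.1 c.2 true) (by simp) ++ slotSwap R anc c s b

variable (G n t q R anc) in
noncomputable def prepGates : List (GateApp G (Wire G n t q R anc)) :=
  (List.product (List.finRange q) (keyList t)).flatMap fun c => (slotList n).flatMap fun s =>
    (brickList G).flatMap fun b => prepStep R anc c s b

theorem act_prepStep (m : Bool) (v : Wire.Coins G n t R → Bool)
    (pos : (Bool × Fin t) × Slot n → Brick G) (h : ℕ) (c : Fin q × Bool × Fin t) (s : Slot n) (b : Brick G)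
    (φ : (Wire G n t q R anc → Bool) → ℂ) :
    act (prepStep R anc c s b) (fixOn (Wire.classical G n t q R anc) (Wire.values m v pos h) φ) =
      fixOn (Wire.classical G n t q R anc) (Wire.values m v pos h)
        (act (relabel (Wire.block c) (Wire.block_injective c) (brickOrDummy (fun s => pos (c.2, s)) s b)) φ) := by
  have hinj : Function.Injective fun e : Bool => bif e then s.snd else s.fst := by
    have := s.fst_ne_snd
    intro e e' h
    cases e <;> cases e' <;> simp_all [eq_comm]
  let f : Bool → Wire G n t q R anc := fun e => .block c (.inl (bif e then s.snd else s.fst))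
  let g : Bool → Wire G n t q R anc := fun e => .block c (.inr e)
  have hf : Function.Injective f := (Wire.block_injective c).comp (Sum.inl_injective.comp hinj)
  have hg : Function.Injective g := (Wire.block_injective c).comp Sum.inr_injective
  have hfg : ∀ i j, f i ≠ g j := fun i j h => by cases (Wire.block_injective c) h
  have hsw : ∀ ψ, act (slotSwap R anc c s b)
      (fixOn (Wire.classical G n t q R anc) (Wire.values m v pos h) ψ) =
      fixOn (Wire.classical G n t q R anc) (Wire.values m v pos h)
        (if decide (pos (c.2, s) = b) then fun x => ψ (x ∘ exchange f g [false, true]) else ψ) :=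
    fun ψ => act_exchange (f := f) (g := g) Wire.desc_mem (fun i => Wire.block_notMem _ _)
      (fun i => Wire.block_notMem _ _) hfg [false, true] ψ
  have hgates : ∀ a ∈ (b.gates (.dum c.1 c.2 false) (.dum c.1 c.2 true) (by simp) :
      List (GateApp G (Wire G n t q R anc))), ∀ w ∈ a.wires, w ∉ Wire.classical G n t q R anc := by
    intro a ha w hw
    rcases Brick.mem_gates_wires (by simp) ha hw with rfl | rfl <;> exact id
  rw [prepStep, act_append, act_append, hsw, act_fixOn _ hgates, hsw]
  by_cases hb : pos (c.2, s) = b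
  · rw [brickOrDummy, if_pos hb, decide_eq_true hb, if_pos rfl, if_pos rfl]
    have hex := exchange_apply hf hg hfg (l := [false, true]) (by simp)
    -- The two transpositions are disjoint, so the exchange is an involution and the second round of
    -- swaps undoes the first.
    have hinv : (exchange f g [false, true]).symm = exchange f g [false, true] := by
      ext w
      rw [Equiv.symm_apply_eq]
      by_cases h1 : ∃ i, w = f i
      · obtain ⟨i, rfl⟩ := h1
        rw [(hex i).1, if_pos (by cases i <;> simp), (hex i).2, if_pos (by cases i <;> simp)]
      · by_cases h2 : ∃ i, w = g i
        · obtain ⟨i, rfl⟩ := h2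
          rw [(hex i).2, if_pos (by cases i <;> simp), (hex i).1, if_pos (by cases i <;> simp)]
        · push Not at h1 h2
          rw [exchange_of_ne f g w h1 h2, exchange_of_ne f g w h1 h2]
    -- Conjugation by the exchange moves the brick from the dummy wires to the wires of the slot.
    have hre : relabel (exchange f g [false, true]) (exchange f g [false, true]).injective
        (b.gates (g false) (g true) (hg.ne (by simp))) =
        relabel (Wire.block c) (Wire.block_injective c) (b.gates (.inl s.fst) (.inl s.snd)
          (by simpa using s.fst_ne_snd)) := by
      rw [relabel_brick_gates, relabel_brick_gates]
      congr 1
      · exact (hex false).2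
      · exact (hex true).2
    rw [← hre, act_relabel_perm, hinv]
    rfl
  · rw [brickOrDummy, if_neg hb, decide_eq_false hb, relabel_brick_gates]
    rfl

theorem act_flatMap_fixOn {ι W : Type} [DecidableEq W] {S : Set W} {k : W → Bool} (l : List ι)
    {F F' : ι → List (GateApp G W)} (h : ∀ i φ, act (F i) (fixOn S k φ) = fixOn S k (act (F' i) φ)) : ∀ φ,
    act (l.flatMap F) (fixOn S k φ) = fixOn S k (act (l.flatMap F') φ) := by
  induction l with
  | nil => intro φ; rfl
  | cons i l ih => intro φ; rw [List.flatMap_cons, List.flatMap_cons, act_append, act_append, h, ih]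

theorem act_prepGates (m : Bool) (v : Wire.Coins G n t R → Bool)
    (pos : (Bool × Fin t) × Slot n → Brick G) (h : ℕ) {A : (Wire G n t q R anc → Bool) → ℂ}
    (hA : ∀ c, IndepOf (Wire.block c) A) :
    act (prepGates G n t q R anc) (fixOn (Wire.classical G n t q R anc) (Wire.values m v pos h)
      fun x => A x * ∏ c, zeroKet (x ∘ Wire.block c)) =
    fixOn (Wire.classical G n t q R anc) (Wire.values m v pos h)
      fun x => A x * ∏ c : Fin q × Bool × Fin t, (Ckt.ket (fun s => pos (c.2, s)) (fun i => x (.key c.1 c.2 i)) *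
        dummyKet (fun s => pos (c.2, s)) fun b => x (.dum c.1 c.2 b)) := by
  have h1 := act_flatMap_fixOn (S := Wire.classical G n t q R anc) (k := Wire.values m v pos h)
    (List.product (List.finRange q) (keyList t)) fun c => act_flatMap_fixOn (slotList n) fun s =>
      act_flatMap_fixOn (brickList G) fun b => act_prepStep m v pos h c s b
  rw [prepGates, h1]
  congr 1
  have h2 := act_groups (emb := fun c : Fin q × Bool × Fin t => (Wire.block c : _ → Wire G n t q R anc))
    (fun c => Wire.block_injective c) (fun c c' hc => Wire.block_ne hc)
    (fun c => act_prepLocal fun s => pos (c.2, s)) hA (List.product (List.finRange q) (keyList t))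
    ((List.nodup_finRange q).product nodup_keyList) ∅ (by simp)
  have hmem : ∀ c, c ∈ List.product (List.finRange q) (keyList t) := fun ⟨c, a⟩ =>
    List.pair_mem_product.2 ⟨List.mem_finRange c, mem_keyList a⟩
  simp only [Finset.notMem_empty, if_false, false_or, hmem, if_true] at h2
  simp only [prepLocal, relabel_flatMap] at h2
  exact h2

end Prep

/-! ### Norms of product states -/

section ProductNorms

theorem sum_prod_blocks {ι κ : Type} [Fintype ι] [DecidableEq ι] [Fintype κ] [DecidableEq κ]
    (f : ι → (κ → Bool) → ℝ) :
    ∑ x : ι × κ → Bool, ∏ i, f i (fun k => x (i, k)) = ∏ i, ∑ y, f i y := by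
  rw [Finset.prod_univ_sum, Fintype.piFinset_univ, ← (Equiv.curry ι κ Bool).sum_comp]
  rfl

theorem sum_norm_sq_copies {κ : Type} [Fintype κ] [DecidableEq κ] (q : ℕ) {φ : (κ → Bool) → ℂ}
    (h : ∑ x, ‖φ x‖ ^ 2 = 1) : ∑ x, ‖copies q φ x‖ ^ 2 = 1 := by
  simp only [copies, norm_prod, ← Finset.prod_pow]
  rw [sum_prod_blocks fun _ y => ‖φ y‖ ^ 2]
  simp [h]

theorem sum_norm_sq_pkGen {G : GateSet} {n t : ℕ} (sk : SecretKey G n t) :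
    ∑ x, ‖pkGen sk x‖ ^ 2 = 1 := by
  simp only [pkGen, norm_prod, ← Finset.prod_pow]
  rw [sum_prod_blocks fun a y => ‖(sk a).ket y‖ ^ 2]
  exact Finset.prod_eq_one fun a _ => sum_norm_sq_layersKet _

/-- The sum over the assignments that take given values on one part of the wires. -/
theorem sum_sum_elim {L L' : Type} [Fintype L] [Fintype L'] [DecidableEq L] [DecidableEq L']
    (f : (L → Bool) → (L' → Bool) → ℝ) :
    ∑ x : L ⊕ L' → Bool, f (x ∘ Sum.inl) (x ∘ Sum.inr) = ∑ y, ∑ z, f y z := by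
  rw [← (Equiv.sumArrowEquivProdArrow L L' Bool).symm.sum_comp, Fintype.sum_prod_type]
  rfl

theorem sum_norm_sq_forgerInput {G : GateSet} {n t q : ℕ} (sk : SecretKey G n t) (m : Bool) :
    ∑ x, ‖(forgerInput sk m : (Fin q × (Bool × Fin t) × Fin n ⊕ Unit ⊕ SigIdx G n t → Bool) → ℂ) x‖ ^ 2
      = 1 := by
  let g : Unit ⊕ SigIdx G n t → Bool := Sum.elim (fun _ => m) (sign sk m)
  have h1 : ∀ x : Fin q × (Bool × Fin t) × Fin n ⊕ Unit ⊕ SigIdx G n t → Bool,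
      ‖forgerInput sk m x‖ ^ 2 = ‖copies q (pkGen sk) (x ∘ Sum.inl)‖ ^ 2 *
        if x ∘ Sum.inr = g then 1 else 0 := by
    intro x
    have h2 : (x ∘ Sum.inr = g) ↔ x (.inr (.inl ())) = m ∧ (fun i => x (.inr (.inr i))) = sign sk m := by
      constructor
      · intro h
        exact ⟨congrFun h (.inl ()), funext fun i => congrFun h (.inr i)⟩
      · rintro ⟨h, h'⟩
        funext w
        rcases w with ⟨⟩ | i
        · exact h
        · exact congrFun h' i
    rw [forgerInput]
    by_cases h : x ∘ Sum.inr = g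
    · rw [if_pos h, if_pos (h2.1 h), mul_one]; rfl
    · rw [if_neg h, if_neg (mt h2.2 h)]; simp
  simp only [h1]
  rw [sum_sum_elim fun y z => ‖copies q (pkGen sk) y‖ ^ 2 * if z = g then 1 else 0]
  simp only [← Finset.mul_sum, Finset.sum_ite_eq', Finset.mem_univ, if_true, mul_one]
  exact sum_norm_sq_copies q (sum_norm_sq_pkGen sk)

end ProductNorms

/-! ### The probabilities of an algorithm -/

section OutProb

variable {G : GateSet} {In Out : ℕ → Type} [∀ n, Enc (In n)] [∀ n, Enc (Out n)]
    [∀ n, Fintype (In n)] [∀ n, DecidableEq (In n)] [∀ n, Fintype (Out n)] [∀ n, DecidableEq (Out n)]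

/-- A state of the input register, extended by zeros. -/
noncomputable def withAncillas {I A : Type} (φ : (I → Bool) → ℂ) : (I ⊕ A → Bool) → ℂ :=
  fun z => φ (z ∘ Sum.inl) * zeroKet (z ∘ Sum.inr)

theorem QPT.outProb_eq (A : QPT G In Out) (n : ℕ) (φ : (In n → Bool) → ℂ) (y : Out n → Bool) :
    A.outProb n φ y = ∑ x : In n ⊕ Out n ⊕ Fin (A.anc n) → Bool,
      if (fun o => x (.inr (.inl o))) = y then ‖act (A.circ n) (withAncillas φ) x‖ ^ 2 else 0 := by
  rw [QPT.outProb]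
  refine Finset.sum_congr rfl fun x _ => ?_
  rw [circMat_mulVec]
  congr 4
  funext z
  rw [withAncillas, zeroKet]
  by_cases h : ∀ w, z (.inr w) = false
  · rw [if_pos h, if_pos (show ∀ w, (z ∘ Sum.inr) w = false from h), mul_one]; rfl
  · rw [if_neg h, if_neg (show ¬ ∀ w, (z ∘ Sum.inr) w = false from h), mul_zero]

theorem sum_norm_sq_withAncillas {I A : Type} [Fintype I] [DecidableEq I] [Fintype A] [DecidableEq A]
    (φ : (I → Bool) → ℂ) : ∑ x : I ⊕ A → Bool, ‖withAncillas φ x‖ ^ 2 = ∑ x, ‖φ x‖ ^ 2 := by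
  simp only [withAncillas, norm_mul, mul_pow]
  rw [sum_sum_elim fun y z => ‖φ y‖ ^ 2 * ‖(zeroKet : (A → Bool) → ℂ) z‖ ^ 2]
  simp [← Finset.mul_sum, sum_norm_sq_zeroKet]

theorem QPT.outProb_nonneg (A : QPT G In Out) (n : ℕ) (φ : (In n → Bool) → ℂ) (y : Out n → Bool) :
    0 ≤ A.outProb n φ y := by
  refine Finset.sum_nonneg fun x _ => ?_
  split_ifs <;> positivity

theorem QPT.sum_outProb (A : QPT G In Out) (n : ℕ) (φ : (In n → Bool) → ℂ) :
    ∑ y, A.outProb n φ y = ∑ x, ‖φ x‖ ^ 2 := by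
  simp only [QPT.outProb_eq]
  rw [Finset.sum_comm]
  simp only [Finset.sum_ite_eq, Finset.mem_univ, if_true]
  rw [sum_norm_sq_act, sum_norm_sq_withAncillas]

end OutProb

/-! ### The insertion of the unknown state, the forger, and the extraction of its output -/

section Branch

variable {G : GateSet} {n t q R anc : ℕ}

/-- The wires of the forger. -/
abbrev ForgerWire (G : GateSet) (n t q anc : ℕ) : Type :=
  (Fin q × (Bool × Fin t) × Fin n ⊕ Unit ⊕ SigIdx G n t) ⊕ (Unit ⊕ SigIdx G n t) ⊕ Fin anc

instance : DecidableEq (Fin q × (Bool × Fin t) × Fin n ⊕ Unit ⊕ SigIdx G n t) := inferInstance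
instance : DecidableEq (Unit ⊕ SigIdx G n t) := inferInstance
instance : DecidableEq (ForgerWire G n t q anc) := inferInstance

/-- The places of the wires of the forger among those of the learner. -/
def Wire.ofForger (m : Bool) : ForgerWire G n t q anc → Wire G n t q R anc
  | .inl (.inl (c, a, i)) => .key c a i
  | .inl (.inr (.inl ())) => .msg
  | .inl (.inr (.inr (j, d))) => .desc (m, j) d
  | .inr (.inl (.inl ())) => .fmsg
  | .inr (.inl (.inr (j, d))) => .fsig j d
  | .inr (.inr i) => .fanc i

theorem Wire.ofForger_injective (m : Bool) :
    Function.Injective (Wire.ofForger m : ForgerWire G n t q anc → Wire G n t q R anc) := by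
  rintro ((⟨c, a, i⟩ | ⟨⟨⟩⟩ | ⟨j, d⟩) | (⟨⟨⟩⟩ | ⟨j, d⟩) | i)
    ((⟨c', a', i'⟩ | ⟨⟨⟩⟩ | ⟨j', d'⟩) | (⟨⟨⟩⟩ | ⟨j', d'⟩) | i') h <;>
  simp_all [Wire.ofForger]

/-- The position wire that selects a block. -/
def Wire.leaf (j : Fin t) : Wire G n t q R anc := .heap ⟨t - 1 + j.val, by omega⟩

variable (G n t q R anc) in
-- The copies of the unknown state change places with the copies of the block `(!m, j)` that the
-- token selects. The half `!m` is the one to be forged, and the half `m` must stay known so that it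
-- can be signed.
noncomputable def insertGates (m : Bool) : List (GateApp G (Wire G n t q R anc)) :=
  (List.finRange t).flatMap fun j => (List.product (List.finRange q) (List.finRange n)).flatMap fun i =>
    cswap G (.leaf j) (.inp i.1 i.2) (.key i.1 (!m, j) i.2)

def descList (G : GateSet) (n : ℕ) (l : List (Brick G)) : List (DescIdx G n) := List.product (slotList n) l

variable (G n t q R anc) in
-- The same token sends the forged description of the selected block to the output wires.
noncomputable def extractGates : List (GateApp G (Wire G n t q R anc)) :=
  (List.finRange t).flatMap fun j => (descList G n (brickList G)).flatMap fun d =>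
    cswap G (.leaf j) (.fsig j d) (.out d)

/-- The state of the nonclassical wires before the preparation, up to the blocks. -/
noncomputable def inputPart (m : Bool) (C : Ckt G n) (x : Wire G n t q R anc → Bool) : ℂ :=
  copies q C.ket (fun i => x (.inp i.1 i.2)) *
    (zeroKet (fun d => x (.out d)) * zeroKet fun w => x (.ofForger m (.inr w)))

theorem inputPart_indepOf (m : Bool) (C : Ckt G n) (c : Fin q × Bool × Fin t) :
    IndepOf (Wire.block c) (inputPart (t := t) (q := q) (R := R) (anc := anc) m C) := by
  intro x i b
  have h : ∀ w : Wire G n t q R anc, (∀ c a i, w ≠ .key c a i) → (∀ c a b, w ≠ .dum c a b) →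
      Function.update x (Wire.block c i) b w = x w := by
    intro w h1 h2
    refine Function.update_of_ne ?_ _ _
    cases i
    · exact h1 _ _ _
    · exact h2 _ _ _
  rw [inputPart, inputPart]
  congr 1
  · congr 1; funext i; exact h _ (by simp) (by simp)
  · congr 2
    · funext d; exact h _ (by simp) (by simp)
    · funext w
      rcases w with (⟨⟨⟩⟩ | ⟨j, d⟩) | i <;> exact h _ (by simp [Wire.ofForger]) (by simp [Wire.ofForger])

/-- The secret key in which one circuit is replaced. -/
def insertKey (pos : (Bool × Fin t) × Slot n → Brick G) (a : Bool × Fin t) (C : Ckt G n) : SecretKey G n t :=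
  Function.update (fun a s => pos (a, s)) a C

variable (q R anc) in
/-- The state after the preparation. -/
noncomputable def preparedState (m : Bool) (C : Ckt G n) (v : Wire.Coins G n t R → Bool)
    (pos : (Bool × Fin t) × Slot n → Brick G) (h : ℕ) : (Wire G n t q R anc → Bool) → ℂ :=
  fixOn (Wire.classical G n t q R anc) (Wire.values m v pos h)
    fun x => inputPart m C x * ∏ c : Fin q × Bool × Fin t,
      (Ckt.ket (fun s => pos (c.2, s)) (fun i => x (.key c.1 c.2 i)) *
        dummyKet (fun s => pos (c.2, s)) fun b => x (.dum c.1 c.2 b))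

/-- The classical wires that the forger does not get. -/
def Wire.hidden (m : Bool) : Set (Wire G n t q R anc) :=
  {w | w ∈ Wire.classical G n t q R anc ∧ w ∉ Set.range (Wire.ofForger m)}

/-- The part of the state that the forger does not touch. -/
noncomputable def hiddenState (m : Bool) (v : Wire.Coins G n t R → Bool)
    (pos : (Bool × Fin t) × Slot n → Brick G) (j : Fin t) : (Wire G n t q R anc → Bool) → ℂ :=
  fixOn (Wire.hidden m) (Wire.values m v pos (t - 1 + j.val)) fun x =>
    zeroKet (fun d => x (.out d)) *
      ((∏ c : Fin q, Ckt.ket (fun s => pos ((!m, j), s)) fun i => x (.inp c i)) *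
        ∏ c : Fin q × Bool × Fin t, dummyKet (fun s => pos (c.2, s)) fun b => x (.dum c.1 c.2 b))

theorem hiddenState_indepOf (m : Bool) (v : Wire.Coins G n t R → Bool)
    (pos : (Bool × Fin t) × Slot n → Brick G) (j : Fin t) :
    IndepOf (Wire.ofForger m) (hiddenState (q := q) (anc := anc) m v pos j) := by
  intro x i b
  have h : ∀ w : Wire G n t q R anc, w ∉ Set.range (Wire.ofForger m) →
      Function.update x (Wire.ofForger m i) b w = x w := by
    intro w hw
    exact Function.update_of_ne (fun h => hw ⟨i, h.symm⟩) _ _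
  have hr : ∀ w : Wire G n t q R anc, (∀ c i, w = .inp c i → w ∉ Set.range (Wire.ofForger m)) ∧
      (∀ d, w = .out d → w ∉ Set.range (Wire.ofForger m)) ∧
      ∀ c a b, w = .dum c a b → w ∉ Set.range (Wire.ofForger m) := by
    intro w
    refine ⟨?_, ?_, ?_⟩ <;> intros <;> subst w <;>
      rintro ⟨(⟨c, a, i⟩ | ⟨⟨⟩⟩ | ⟨j, d⟩) | (⟨⟨⟩⟩ | ⟨j, d⟩) | i, h⟩ <;> cases h
  refine fixOn_eq (forall₂_congr fun w hw => by rw [h w hw.2]) ?_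
  congr 1
  · congr 1; funext d; exact h _ ((hr _).2.1 d rfl)
  · congr 1
    · refine Finset.prod_congr rfl fun c _ => congrArg _ (funext fun i => ?_)
      exact h _ ((hr _).1 c i rfl)
    · refine Finset.prod_congr rfl fun c _ => congrArg _ (funext fun b => ?_)
      exact h _ ((hr _).2.2 _ _ b rfl)

/-- The one-hot descriptions of the half `m` already are the signature that the forger expects, so
no further computation is needed. The inserted circuit belongs to the other half and leaves the
signature unchanged. -/
theorem agree_classical_iff (m : Bool) (v : Wire.Coins G n t R → Bool)
    (pos : (Bool × Fin t) × Slot n → Brick G) (h : ℕ) (j : Fin t) (C : Ckt G n)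
    (x : Wire G n t q R anc → Bool) :
    Agree (Wire.classical G n t q R anc) (Wire.values m v pos h) x ↔
      Agree (Wire.hidden m) (Wire.values m v pos h) x ∧ x .msg = m ∧
        (fun i : SigIdx G n t => x (.desc (m, i.1) i.2)) = sign (insertKey pos (!m, j) C) m := by
  have hs : ∀ i : SigIdx G n t, sign (insertKey pos (!m, j) C) m i =
      Wire.values m v pos h (Wire.desc (m, i.1) i.2 : Wire G n t q R anc) := by
    intro i
    have : (m, i.1) ≠ (!m, j) := fun h => by
      have := congrArg Prod.fst h
      cases m <;> cases this
    have hC : insertKey pos (!m, j) C (m, i.1) = fun s => pos ((m, i.1), s) :=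
      Function.update_of_ne this _ _
    rw [sign, hC]
    exact decide_eq_decide.2 Iff.rfl
  constructor
  · intro h
    refine ⟨fun w hw => h w hw.1, h .msg trivial, funext fun i => ?_⟩
    rw [hs]
    exact h _ Wire.desc_mem
  · rintro ⟨h1, h2, h3⟩ w hw
    by_cases hr : w ∈ Set.range (Wire.ofForger m)
    · obtain ⟨(⟨c, a, i⟩ | ⟨⟨⟩⟩ | ⟨j, d⟩) | (⟨⟨⟩⟩ | ⟨j, d⟩) | i, rfl⟩ := hr
      · exact hw.elim
      · exact h2
      · exact (congrFun h3 (j, d)).trans (hs (j, d))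
      · exact hw.elim
      · exact hw.elim
      · exact hw.elim
    · exact h1 w ⟨hw, hr⟩

/-- After the exchange the key copies are those of a key containing `C`, and the state that the
learner had prepared for that block rests on the input wires. What remains besides the exact input
of the forger lives on wires that the forger does not touch. -/
theorem act_insertGates (m : Bool) (C : Ckt G n) (v : Wire.Coins G n t R → Bool)
    (pos : (Bool × Fin t) × Slot n → Brick G) (j : Fin t) :
    act (insertGates G n t q R anc m) (preparedState q R anc m C v pos (t - 1 + j.val)) =
      fun x => withAncillas (forgerInput (insertKey pos (!m, j) C) m) (x ∘ Wire.ofForger m) *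
        hiddenState m v pos j x := by
  let f : Fin t → Fin q × Fin n → Wire G n t q R anc := fun _ i => .inp i.1 i.2
  let g : Fin t → Fin q × Fin n → Wire G n t q R anc := fun j i => .key i.1 (!m, j) i.2
  let l := List.product (List.finRange q) (List.finRange n)
  have hl : l.Nodup := (List.nodup_finRange q).product (List.nodup_finRange n)
  have hmem : ∀ i, i ∈ l := fun ⟨c, i⟩ =>
    List.pair_mem_product.2 ⟨List.mem_finRange c, List.mem_finRange i⟩
  have h1 := act_selected_exchange (G := G) (S := Wire.classical G n t q R anc)
    (k := Wire.values m v pos (t - 1 + j.val)) (c := Wire.leaf) (f := f) (g := g)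
    (fun j => Wire.heap_mem) (fun j i => id) (fun j i => id) (fun j i i' h => by cases h) (j₀ := j)
    (fun i => by simp [Wire.leaf, Wire.values, Fin.ext_iff]) l
    (fun x => inputPart m C x * ∏ c : Fin q × Bool × Fin t,
      (Ckt.ket (fun s => pos (c.2, s)) (fun i => x (.key c.1 c.2 i)) *
        dummyKet (fun s => pos (c.2, s)) fun b => x (.dum c.1 c.2 b))) (List.nodup_finRange t)
  rw [if_pos (List.mem_finRange j)] at h1
  rw [preparedState, insertGates]
  refine h1.trans ?_
  clear h1
  have hfi : Function.Injective (f j) := by rintro ⟨c, i⟩ ⟨c', i'⟩ h; cases h; rfl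
  have hgi : Function.Injective (g j) := by rintro ⟨c, i⟩ ⟨c', i'⟩ h; cases h; rfl
  have hex := exchange_apply hfi hgi (fun i i' h => by cases h) hl
  have e1 : ∀ c i, exchange (f j) (g j) l (.inp c i) = .key c (!m, j) i := fun c i => by
    have := (hex (c, i)).1
    rwa [if_pos (hmem _)] at this
  have e2 : ∀ c i, exchange (f j) (g j) l (.key c (!m, j) i) = .inp c i := fun c i => by
    have := (hex (c, i)).2
    rwa [if_pos (hmem _)] at this
  have e3 : ∀ c a i, a ≠ (!m, j) → exchange (f j) (g j) l (.key c a i) = .key c a i := fun c a i ha =>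
    exchange_of_ne _ _ _ (fun i h => by cases h) (fun i h => by cases h; exact ha rfl) _
  have e4 : ∀ d, exchange (f j) (g j) l (.out d) = .out d := fun d =>
    exchange_of_ne _ _ _ (fun i h => by cases h) (fun i h => by cases h) _
  have e5 : ∀ c a b, exchange (f j) (g j) l (.dum c a b) = .dum c a b := fun c a b =>
    exchange_of_ne _ _ _ (fun i h => by cases h) (fun i h => by cases h) _
  have e6 : ∀ w, exchange (f j) (g j) l (.ofForger m (.inr w)) = .ofForger m (.inr w) := fun w => by
    rcases w with (⟨⟨⟩⟩ | ⟨j, d⟩) | i <;>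
      exact exchange_of_ne _ _ _ (fun i h => by cases h) (fun i h => by cases h) _
  funext x
  -- Within one copy only the factor of the block `(!m, j)` changes: the state of `C` comes in and
  -- the prepared state goes out to the input wires.
  have hkeys : ∀ c : Fin q, C.ket (fun i => x (.key c (!m, j) i)) *
      ∏ a : Bool × Fin t, Ckt.ket (fun s => pos (a, s))
        (fun i => x (exchange (f j) (g j) l (.key c a i))) =
      (∏ a : Bool × Fin t, (insertKey pos (!m, j) C a).ket fun i => x (.key c a i)) *
        Ckt.ket (fun s => pos ((!m, j), s)) fun i => x (.inp c i) := by
    intro c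
    rw [← Finset.mul_prod_erase _ _ (Finset.mem_univ ((!m, j) : Bool × Fin t)),
      ← Finset.mul_prod_erase (a := ((!m, j) : Bool × Fin t)) Finset.univ
        (fun a => (insertKey pos (!m, j) C a).ket fun i => x (.key c a i)) (Finset.mem_univ _)]
    have h1 : ∀ a ∈ Finset.univ.erase ((!m, j) : Bool × Fin t),
        Ckt.ket (fun s => pos (a, s)) (fun i => x (exchange (f j) (g j) l (.key c a i))) =
        (insertKey pos (!m, j) C a).ket fun i => x (.key c a i) := by
      intro a ha
      have ha := Finset.ne_of_mem_erase ha
      simp only [insertKey, Function.update_of_ne ha, e3 c a _ ha]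
    have h2 : insertKey pos (!m, j) C (!m, j) = C := Function.update_self _ _ _
    rw [Finset.prod_congr rfl h1, h2]
    simp only [e2]
    ring
  have hmain : inputPart m C (x ∘ exchange (f j) (g j) l) * ∏ c : Fin q × Bool × Fin t,
      (Ckt.ket (fun s => pos (c.2, s)) (fun i => (x ∘ exchange (f j) (g j) l) (.key c.1 c.2 i)) *
        dummyKet (fun s => pos (c.2, s)) fun b => (x ∘ exchange (f j) (g j) l) (.dum c.1 c.2 b)) =
      copies q (pkGen (insertKey pos (!m, j) C)) (fun i => x (.key i.1 i.2.1 i.2.2)) *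
        zeroKet (fun w => x (.ofForger m (.inr w))) *
      (zeroKet (fun d => x (.out d)) *
      ((∏ c : Fin q, Ckt.ket (fun s => pos ((!m, j), s)) fun i => x (.inp c i)) *
        ∏ c : Fin q × Bool × Fin t, dummyKet (fun s => pos (c.2, s)) fun b => x (.dum c.1 c.2 b))) := by
    have hk := Finset.prod_congr (s₁ := Finset.univ) rfl fun c _ => hkeys c
    rw [Finset.prod_mul_distrib, Finset.prod_mul_distrib] at hk
    simp only [inputPart, copies, Function.comp, e1, e4, e5, e6, pkGen, Finset.prod_mul_distrib]
    rw [Fintype.prod_prod_type (f := fun c : Fin q × Bool × Fin t => Ckt.ket (fun s => pos (c.2, s))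
      fun i => x (exchange (f j) (g j) l (.key c.1 c.2 i)))]
    linear_combination (zeroKet (fun w => x (.ofForger m (.inr w))) * (zeroKet (fun d => x (.out d)) *
      ∏ c : Fin q × Bool × Fin t, dummyKet (fun s => pos (c.2, s)) fun b => x (.dum c.1 c.2 b))) * hk
  have hag := agree_classical_iff m v pos (t - 1 + j.val) j C x
  by_cases hx : Agree (Wire.classical G n t q R anc) (Wire.values m v pos (t - 1 + j.val)) x
  · have h2 := hag.1 hx
    rw [fixOn_pos hx, hmain, hiddenState, fixOn_pos h2.1, withAncillas, forgerInput]
    congr 2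
    rw [if_pos ⟨h2.2.1, h2.2.2⟩]
    rfl
  · rw [fixOn_neg hx]
    symm
    by_cases h1 : Agree (Wire.hidden m) (Wire.values m v pos (t - 1 + j.val)) x
    · have h2 : ¬ (x .msg = m ∧ (fun i : SigIdx G n t => x (.desc (m, i.1) i.2)) =
          sign (insertKey pos (!m, j) C) m) := fun h => hx (hag.2 ⟨h1, h⟩)
      rw [withAncillas, forgerInput]
      have h3 : ¬ (((x ∘ Wire.ofForger m) ∘ Sum.inl) (.inr (.inl ())) = m ∧
          (fun i => ((x ∘ Wire.ofForger m) ∘ Sum.inl) (.inr (.inr i))) =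
            sign (insertKey pos (!m, j) C) m) := h2
      rw [if_neg h3, zero_mul, zero_mul]
    · rw [hiddenState, fixOn_neg h1, mul_zero]

end Branch

/-! ### Circuits that leave given wires alone. -/

section Avoids

variable {G : GateSet} {W : Type} [DecidableEq W]

/-- No gate of the circuit acts on a wire in `S`. -/
def Avoids (S : Set W) (L : List (GateApp G W)) : Prop := ∀ a ∈ L, ∀ w ∈ a.wires, w ∉ S

theorem Avoids.append {S : Set W} {L L' : List (GateApp G W)} (h : Avoids S L) (h' : Avoids S L') :
    Avoids S (L ++ L') := fun a ha => (List.mem_append.1 ha).elim (h a) (h' a)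

theorem Avoids.flatMap {ι : Type} {S : Set W} {l : List ι} {F : ι → List (GateApp G W)}
    (h : ∀ i, Avoids S (F i)) : Avoids S (l.flatMap F) := fun a ha => by
  obtain ⟨i, _, hi⟩ := List.mem_flatMap.1 ha
  exact h i a hi

theorem Avoids.one {S : Set W} {i : W} (hi : i ∉ S) (g : Fin G.num1) : Avoids S [GateApp.one g i] := by
  intro a ha w hw
  rw [List.mem_singleton] at ha
  subst ha
  simp only [GateApp.wires, List.mem_singleton] at hw
  exact hw ▸ hi

theorem Avoids.cnot {S : Set W} {i j : W} (hi : i ∉ S) (hj : j ∉ S) : Avoids S (cnot G i j) := by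
  intro a ha w hw
  rw [QSig.cnot] at ha
  split_ifs at ha
  · rw [List.mem_singleton] at ha
    subst ha
    simp only [GateApp.wires, List.mem_cons, List.not_mem_nil, or_false] at hw
    rcases hw with rfl | rfl <;> assumption
  · simp at ha

theorem Avoids.cswap {S : Set W} {c a b : W} (hc : c ∉ S) (ha : a ∉ S) (hb : b ∉ S) :
    Avoids S (cswap G c a b) := by
  have h1 : ∀ {i j : W} (g : Fin G.num1), i ∉ S → j ∉ S →
      Avoids S (QSig.cnot G i j ++ [.one g j] ++ QSig.cnot G i j) := fun g hi hj =>
    ((Avoids.cnot hi hj).append (Avoids.one hj g)).append (Avoids.cnot hi hj)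
  refine ((Avoids.cnot hb ha).append (((Avoids.one hb _).append ?_).append (Avoids.one hb _))).append
    (Avoids.cnot hb ha)
  refine ((((Avoids.one hc _).append ((Avoids.one ha _).append (Avoids.one hb _))).append
    (h1 _ hc ha)).append (h1 _ ha hb)).append (h1 _ hc hb) |>.append ?_
  exact ((Avoids.cnot hc hb).append (h1 _ ha hb)).append (Avoids.cnot hc hb)

theorem Avoids.brick {S : Set W} {i j : W} (h : i ≠ j) (hi : i ∉ S) (hj : j ∉ S) (b : Brick G) :
    Avoids S (b.gates i j h) := by
  intro a ha w hw
  rcases Brick.mem_gates_wires h ha hw with rfl | rfl <;> assumption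

theorem Avoids.relabel {W' : Type} [DecidableEq W'] {S : Set W'} {f : W → W'} (hf : Function.Injective f)
    (h : ∀ w, f w ∉ S) (L : List (GateApp G W)) : Avoids S (relabel f hf L) := by
  intro a ha w hw
  obtain ⟨a, _, rfl⟩ := List.mem_map.1 ha
  cases a with
  | one g i =>
    simp only [GateApp.map, GateApp.wires, List.mem_singleton] at hw
    exact hw ▸ h _
  | two g i j hij =>
    simp only [GateApp.map, GateApp.wires, List.mem_cons, List.not_mem_nil, or_false] at hw
    rcases hw with rfl | rfl <;> exact h _

end Avoids

/-! ### One branch of the learner, from the prepared registers to the output. -/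

section Branch

variable {G : GateSet} {n t q R anc : ℕ}

theorem Avoids.prepGates {S : Set (Wire G n t q R anc)} (h : ∀ w ∈ S, ∃ g, w = .ofCoin g) :
    Avoids S (prepGates G n t q R anc) := by
  have hd : ∀ a d, .desc a d ∉ S := fun a d hw => by
    obtain ⟨_ | _, hg⟩ := h _ hw <;> cases hg
  have hk : ∀ c w, .block c w ∉ S := fun c w hw => by
    obtain ⟨_ | _, hg⟩ := h _ hw <;> cases w <;> cases hg
  have hs : ∀ c s b, Avoids S (slotSwap R anc (n := n) c s b) := fun c s b =>
    Avoids.flatMap fun e => Avoids.cswap (hd _ _) (hk _ _) (hk _ _)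
  exact Avoids.flatMap fun c => Avoids.flatMap fun s => Avoids.flatMap fun b =>
    ((hs c s b).append (Avoids.brick _ (hk c (.inr false)) (hk c (.inr true)) b)).append (hs c s b)

theorem Avoids.insertGates {S : Set (Wire G n t q R anc)} (h : ∀ w ∈ S, ∃ g, w = .ofCoin g) (m : Bool) :
    Avoids S (insertGates G n t q R anc m) :=
  Avoids.flatMap fun j => Avoids.flatMap fun i => Avoids.cswap
    (fun hw => by obtain ⟨_ | _, hg⟩ := h _ hw <;> cases hg)
    (fun hw => by obtain ⟨_ | _, hg⟩ := h _ hw <;> cases hg)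
    (fun hw => by obtain ⟨_ | _, hg⟩ := h _ hw <;> cases hg)

theorem Avoids.extractGates {S : Set (Wire G n t q R anc)} (h : ∀ w ∈ S, ∃ g, w = .ofCoin g) :
    Avoids S (extractGates G n t q R anc) :=
  Avoids.flatMap fun j => Avoids.flatMap fun i => Avoids.cswap
    (fun hw => by obtain ⟨_ | _, hg⟩ := h _ hw <;> cases hg)
    (fun hw => by obtain ⟨_ | _, hg⟩ := h _ hw <;> cases hg)
    (fun hw => by obtain ⟨_ | _, hg⟩ := h _ hw <;> cases hg)

theorem Avoids.ofForger {S : Set (Wire G n t q R anc)} (h : ∀ w ∈ S, ∃ g, w = .ofCoin g) (m : Bool)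
    (L : List (GateApp G (ForgerWire G n t q anc))) :
    Avoids S (QSig.relabel (Wire.ofForger m) (Wire.ofForger_injective m) L) :=
  Avoids.relabel _ (fun w hw => by
    obtain ⟨_ | _, hg⟩ := h _ hw <;>
    rcases w with (⟨c, a, i⟩ | ⟨⟨⟩⟩ | ⟨j, d⟩) | (⟨⟨⟩⟩ | ⟨j, d⟩) | i <;> cases hg) L

noncomputable instance : Fintype (Wire G n t q R anc) := by
  classical
  exact Fintype.ofInjective (fun w : Wire G n t q R anc => (match w with
    | .inp c i => .inl (.inl (c, i))
    | .out d => .inl (.inr (.inl d))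
    | .coin a s r p => .inl (.inr (.inr (.inl (a, s, r, p))))
    | .hcoin v => .inl (.inr (.inr (.inr (.inl v))))
    | .heap v => .inl (.inr (.inr (.inr (.inr v))))
    | .desc a d => .inr (.inl (.inl (a, d)))
    | .key c a i => .inr (.inl (.inr (.inl (c, a, i))))
    | .dum c a b => .inr (.inl (.inr (.inr (c, a, b))))
    | .msg => .inr (.inr (.inl false))
    | .fmsg => .inr (.inr (.inl true))
    | .fsig j d => .inr (.inr (.inr (.inl (j, d))))
    | .fanc i => .inr (.inr (.inr (.inr i))) :
    (Fin q × Fin n ⊕ DescIdx G n ⊕ ((Bool × Fin t) × Slot n × Fin R × (Brick G × Brick G)) ⊕ Fin (t - 1) ⊕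
      Fin (2 * t + 1)) ⊕ (((Bool × Fin t) × DescIdx G n) ⊕ (Fin q × (Bool × Fin t) × Fin n) ⊕
        (Fin q × (Bool × Fin t) × Bool)) ⊕ Bool ⊕ (Fin t × DescIdx G n) ⊕ Fin anc)) (by
    intro w w' h
    cases w <;> cases w' <;> simp_all)

/-- The probability that a block of the output of the forger has a given value. -/
noncomputable def blockProb (L : List (GateApp G (ForgerWire G n t q anc))) (sk : SecretKey G n t) (m : Bool)
    (j : Fin t) (y : DescIdx G n → Bool) : ℝ :=
  ∑ z : ForgerWire G n t q anc → Bool,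
    if (fun d => z (.inr (.inl (.inr (j, d))))) = y then
      ‖act L (withAncillas (forgerInput sk m)) z‖ ^ 2 else 0

/-- `F` is the indicator of agreement with `k` on `T`, and exactly one assignment of `T` agrees with
`k`. -/
theorem sum_indicator_unique {W : Type} [Fintype W] [DecidableEq W] (T : Set W) (k : W → Bool)
    {F : (W → Bool) → ℝ} (hF : ∀ x, F x = 1 ∧ (∀ w ∈ T, x w = k w) ∨ F x = 0 ∧ ¬ ∀ w ∈ T, x w = k w)
    [DecidablePred (· ∈ T)] : ∑ u : {w // w ∈ T} → Bool, F (fun w => if h : w ∈ T then u ⟨w, h⟩ else false)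
      = 1 := by
  rw [Finset.sum_eq_single fun w : {w // w ∈ T} => k w]
  · rcases hF fun w => if h : w ∈ T then k w else false with h | h
    · exact h.1
    · exact absurd (fun w hw => by simp [hw]) h.2
  · intro u _ hu
    rcases hF fun w => if h : w ∈ T then u ⟨w, h⟩ else false with h | h
    · exact absurd (_root_.funext fun w => by simpa [w.2] using h.2 w w.2) hu
    · exact h.1
  · simp

open scoped Classical in
/-- The initial state of the learner, restricted to a branch. -/
theorem sum_norm_sq_branch (m : Bool) (v : Wire.Coins G n t R → Bool)
    (pos : (Bool × Fin t) × Slot n → Brick G) (h : ℕ) (C : Ckt G n) :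
    ∑ x, ‖fixOn (Wire.classical G n t q R anc) (Wire.values m v pos h)
      (fun x => inputPart m C x * ∏ c, zeroKet (x ∘ Wire.block c)) x‖ ^ 2 = 1 := by
  let f : Fin q × Fin n → Wire G n t q R anc := fun i => .inp i.1 i.2
  have hf : Function.Injective f := by rintro ⟨c, i⟩ ⟨c', i'⟩ h; cases h; rfl
  let H : (Wire G n t q R anc → Bool) → ℝ := fun x =>
    if ∀ w, w ∉ Set.range f → x w = Wire.values m v pos h w then 1 else 0
  have h1 : ∀ x, ‖fixOn (Wire.classical G n t q R anc) (Wire.values m v pos h)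
      (fun x => inputPart m C x * ∏ c, zeroKet (x ∘ Wire.block c)) x‖ ^ 2 =
      ‖copies q C.ket (x ∘ f)‖ ^ 2 * H x := by
    intro x
    have hcl : ∀ w, w ∈ Wire.classical G n t q R anc → w ∉ Set.range f := by
      rintro w hw ⟨i, rfl⟩; exact hw
    by_cases hx : ∀ w, w ∉ Set.range f → x w = Wire.values m v pos h w
    · have e1 : Agree (Wire.classical G n t q R anc) (Wire.values m v pos h) x :=
        fun w hw => hx w (hcl w hw)
      have e2 : ∀ c, zeroKet (x ∘ Wire.block c) = 1 := fun c => if_pos fun w => by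
        rw [Function.comp, hx _ (by rintro ⟨i, hi⟩; cases w <;> cases hi)]
        cases w <;> rfl
      have e3 : zeroKet (fun d => x (.out d)) = 1 := if_pos fun d =>
        hx (.out d) (by rintro ⟨i, hi⟩; cases hi)
      have e4 : zeroKet (fun w => x (.ofForger m (.inr w))) = 1 := if_pos fun w => by
        rcases w with (⟨⟨⟩⟩ | ⟨j, d⟩) | i
        · exact hx .fmsg (by rintro ⟨i, hi⟩; cases hi)
        · exact hx (.fsig j d) (by rintro ⟨i, hi⟩; cases hi)
        · exact hx (.fanc i) (by rintro ⟨i, hi⟩; cases hi)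
      rw [fixOn_pos e1, inputPart, e3, e4, Finset.prod_congr rfl fun c _ => e2 c]
      simp only [H, if_pos hx, Finset.prod_const_one, mul_one]
      rfl
    · simp only [H, if_neg hx, mul_zero]
      by_contra hne
      apply hx
      have hne : fixOn (Wire.classical G n t q R anc) (Wire.values m v pos h)
        (fun x => inputPart m C x * ∏ c, zeroKet (x ∘ Wire.block c)) x ≠ 0 := fun h0 => hne (by simp [h0])
      have hag : Agree (Wire.classical G n t q R anc) (Wire.values m v pos h) x := by
        by_contra hag; exact hne (fixOn_neg hag _)
      rw [fixOn_pos hag, inputPart] at hne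
      have hz : ∀ {W : Type} {z : W → Bool}, (zeroKet z : ℂ) ≠ 0 → ∀ w, z w = false := fun hz => by
        by_contra hw; exact hz (if_neg hw)
      have h4 := Finset.prod_ne_zero_iff.1 (right_ne_zero_of_mul hne)
      have h5 := right_ne_zero_of_mul (left_ne_zero_of_mul hne)
      have h6 := hz (left_ne_zero_of_mul h5)
      have h7 := hz (right_ne_zero_of_mul h5)
      intro w hw
      cases w with
      | inp c i => exact absurd ⟨(c, i), rfl⟩ hw
      | out d => exact h6 d
      | key c a i => exact hz (h4 (c, a) (Finset.mem_univ _)) (.inl i)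
      | dum c a b => exact hz (h4 (c, a) (Finset.mem_univ _)) (.inr b)
      | fmsg => exact h7 (.inl (.inl ()))
      | fsig j d => exact h7 (.inl (.inr (j, d)))
      | fanc i => exact h7 (.inr i)
      | _ => exact hag _ trivial
  rw [Finset.sum_congr rfl fun x _ => h1 x, sum_range_mul hf (fun z => ‖copies q C.ket z‖ ^ 2) H,
    sum_norm_sq_copies q (φ := C.ket) (sum_norm_sq_layersKet C.layers), one_mul]
  · refine Eq.trans ?_ (sum_indicator_unique (Set.range f)ᶜ (Wire.values m v pos h) (F := H) fun x => ?_)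
    · congr
    · by_cases hx : ∀ w, w ∉ Set.range f → x w = Wire.values m v pos h w
      · exact Or.inl ⟨if_pos hx, hx⟩
      · exact Or.inr ⟨if_neg hx, hx⟩
  · intro x y hxy
    have : (∀ w, w ∉ Set.range f → x w = Wire.values m v pos h w) ↔
        ∀ w, w ∉ Set.range f → y w = Wire.values m v pos h w :=
      forall₂_congr fun w hw => by rw [hxy w hw]
    simp only [H, this]

variable (R) in
/-- The part of the learner after the classical preparations. -/
noncomputable def mainGates (m : Bool) (L : List (GateApp G (ForgerWire G n t q anc))) :
    List (GateApp G (Wire G n t q R anc)) :=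
  prepGates G n t q R anc ++ (insertGates G n t q R anc m ++
    (relabel (Wire.ofForger m) (Wire.ofForger_injective m) L ++ extractGates G n t q R anc))

theorem mem_descList (d : DescIdx G n) : d ∈ descList G n (brickList G) :=
  List.pair_mem_product.2 ⟨mem_slotList _, mem_brickList _⟩

theorem nodup_descList : (descList G n (brickList G)).Nodup := nodup_slotList.product nodup_brickList

open scoped Classical in
/-- On a branch in which the position register selects a block, the learner outputs what the forger
claims about this block. -/
theorem branch_outProb (m : Bool) (L : List (GateApp G (ForgerWire G n t q anc)))
    (v : Wire.Coins G n t R → Bool) (pos : (Bool × Fin t) × Slot n → Brick G) (C : Ckt G n) (j : Fin t)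
    (y : DescIdx G n → Bool) :
    (∑ x : Wire G n t q R anc → Bool, if (fun d => x (.out d)) = y then
      ‖act (mainGates R m L)
        (fixOn (Wire.classical G n t q R anc) (Wire.values m v pos (t - 1 + j.val))
          (fun x => inputPart m C x * ∏ c, zeroKet (x ∘ Wire.block c))) x‖ ^ 2 else 0) =
    blockProb L (insertKey pos (!m, j) C) m j y := by
  set Φ : (ForgerWire G n t q anc → Bool) → ℂ := withAncillas (forgerInput (insertKey pos (!m, j) C) m)
    with hΦ
  let χ : (Wire G n t q R anc → Bool) → ℂ := hiddenState m v pos j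
  have hst := act_prepGates (anc := anc) (R := R) m v pos (t - 1 + j.val)
    (A := inputPart m C) (inputPart_indepOf (q := q) m C)
  have hins := act_insertGates (q := q) (anc := anc) m C v pos j
  -- The preparation and the insertion preserve the norm. Since the forger input has norm one, the
  -- hidden factor has norm one too, and the dummy states need not be computed for this.
  have hnorm : (∑ x : Wire G n t q R anc → Bool, ‖Φ (x ∘ Wire.ofForger m) * χ x‖ ^ 2) = 1 := by
    have h1 := sum_norm_sq_act (insertGates G n t q R anc m)
      (preparedState q R anc m C v pos (t - 1 + j.val))
    have h2 := sum_norm_sq_act (prepGates G n t q R anc) (fixOn (Wire.classical G n t q R anc)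
      (Wire.values m v pos (t - 1 + j.val)) fun x => inputPart m C x * ∏ c, zeroKet (x ∘ Wire.block c))
    rw [sum_norm_sq_branch, hst] at h2
    rw [hins] at h1
    exact h1.trans h2
  have hχ : ∀ x y : Wire G n t q R anc → Bool, (∀ w, w ∉ Set.range (Wire.ofForger m) → x w = y w) →
      χ x = χ y := by
    intro x y hxy
    refine fixOn_eq (forall₂_congr fun w hw => by rw [hxy w hw.2]) ?_
    have hr : ∀ w : Wire G n t q R anc, ((∃ c i, w = .inp c i) ∨ (∃ d, w = .out d) ∨
      ∃ c a b, w = .dum c a b) → x w = y w := by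
      intro w hw
      apply hxy
      rcases hw with ⟨c, i, rfl⟩ | ⟨d, rfl⟩ | ⟨c, a, b, rfl⟩ <;>
        rintro ⟨(⟨c, a, i⟩ | ⟨⟨⟩⟩ | ⟨j, d⟩) | (⟨⟨⟩⟩ | ⟨j, d⟩) | i, h⟩ <;> cases h
    congr 1
    · congr 1; funext d; exact hr _ (Or.inr (Or.inl ⟨d, rfl⟩))
    · congr 1
      · refine Finset.prod_congr rfl fun c _ => congrArg _ (funext fun i => ?_)
        exact hr _ (Or.inl ⟨c, i, rfl⟩)
      · refine Finset.prod_congr rfl fun c _ => congrArg _ (funext fun b => ?_)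
        exact hr _ (Or.inr (Or.inr ⟨_, _, b, rfl⟩))
  have hχ1 : (∑ u : {w // w ∉ Set.range (Wire.ofForger m)} → Bool, ‖χ fun w =>
      if h : w ∉ Set.range (Wire.ofForger m) then u ⟨w, h⟩ else false‖ ^ 2) = 1 := by
    have h1 := sum_range_mul (Wire.ofForger_injective (R := R) m) (fun z => ‖Φ z‖ ^ 2)
      (fun x => ‖χ x‖ ^ 2) (fun x y hxy => by rw [hχ x y hxy])
    have h2 : ∑ z, ‖Φ z‖ ^ 2 = 1 :=
      (sum_norm_sq_withAncillas _).trans (sum_norm_sq_forgerInput (insertKey pos (!m, j) C) m)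
    rw [h2, one_mul] at h1
    rw [← h1, ← hnorm]
    exact Finset.sum_congr rfl fun x _ => by rw [norm_mul, mul_pow]
  let f : Fin t → DescIdx G n → Wire G n t q R anc := fun j d => .fsig j d
  let g : Fin t → DescIdx G n → Wire G n t q R anc := fun _ d => .out d
  have hfi : Function.Injective (f j) := by intro d d' h; cases h; rfl
  have hgi : Function.Injective (g j) := by intro d d' h; cases h; rfl
  have hex := exchange_apply hfi hgi (fun i i' h => by cases h) (nodup_descList (G := G) (n := n))
  set σ := exchange (f j) (g j) (descList G n (brickList G)) with hσ
  let S : Set (Wire G n t q R anc) := Set.range Wire.heap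
  let Ψ : (Wire G n t q R anc → Bool) → ℂ := fun x => act L Φ (x ∘ Wire.ofForger m) * χ x
  have hheap : ∀ i : Fin (2 * t + 1), (.heap i : Wire G n t q R anc) ∈ Wire.hidden m := by
    intro i
    refine ⟨trivial, ?_⟩
    rintro ⟨(⟨c, a, i⟩ | ⟨⟨⟩⟩ | ⟨j, d⟩) | (⟨⟨⟩⟩ | ⟨j, d⟩) | i, h⟩ <;> cases h
  -- The position wires are hidden from the forger, so after its run they still hold the token at
  -- `j` and can control the extraction.
  have hfix : Ψ = fixOn S (Wire.values m v pos (t - 1 + j.val)) Ψ := by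
    funext x
    by_cases hx : Agree S (Wire.values m v pos (t - 1 + j.val)) x
    · rw [fixOn_pos hx]
    · rw [fixOn_neg hx]
      have : ¬ Agree (Wire.hidden m) (Wire.values m v pos (t - 1 + j.val)) x := by
        intro h
        apply hx
        rintro _ ⟨i, rfl⟩
        exact h _ (hheap i)
      simp only [Ψ, χ, hiddenState]
      rw [fixOn_neg this, mul_zero]
  have hext : act (extractGates G n t q R anc) Ψ = fun x => Ψ (x ∘ σ) := by
    have h1 := act_selected_exchange (G := G) (S := S)
      (k := Wire.values m v pos (t - 1 + j.val)) (c := Wire.leaf) (f := f) (g := g)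
      (fun j => ⟨_, rfl⟩) (fun j i => by rintro ⟨_, h⟩; cases h) (fun j i => by rintro ⟨_, h⟩; cases h)
      (fun j i i' h => by cases h) (j₀ := j)
      (fun i => by simp [Wire.leaf, Wire.values, Fin.ext_iff]) (descList G n (brickList G)) Ψ
      (List.nodup_finRange t)
    rw [if_pos (List.mem_finRange j), ← hfix] at h1
    refine h1.trans ?_
    funext x
    by_cases hx : Agree S (Wire.values m v pos (t - 1 + j.val)) x
    · rw [fixOn_pos hx]
    · rw [fixOn_neg hx, hfix, fixOn_neg]
      intro h
      apply hx
      rintro _ ⟨i, rfl⟩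
      have := h _ ⟨i, rfl⟩
      rwa [Function.comp, hσ, exchange_of_ne _ _ _ (fun _ h => by cases h) (fun _ h => by cases h)] at this
  have hall : act (mainGates R m L) (fixOn (Wire.classical G n t q R anc)
      (Wire.values m v pos (t - 1 + j.val)) fun x => inputPart m C x * ∏ c, zeroKet (x ∘ Wire.block c)) =
      fun x => Ψ (x ∘ σ) := by
    rw [mainGates, act_append, act_append, act_append, hst]
    refine Eq.trans ?_ hext
    congr 1
    refine (congrArg _ hins).trans ?_
    exact act_relabel _ _ _ (hiddenState_indepOf m v pos j) _
  rw [hall]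
  have e1 : ∀ d, σ.symm (.out d) = .fsig j d := fun d => by
    rw [Equiv.symm_apply_eq]
    have := (hex d).1
    rw [if_pos (mem_descList d)] at this
    exact this.symm
  -- Replacing `x` by `x ∘ σ⁻¹` turns the output wires into the wires of block `j` of the forged
  -- signature.
  rw [← (Equiv.arrowCongr σ (Equiv.refl Bool)).sum_comp]
  have h1 : ∀ x : Wire G n t q R anc → Bool,
      (if (fun d => (Equiv.arrowCongr σ (Equiv.refl Bool)) x (.out d)) = y then
        ‖Ψ ((Equiv.arrowCongr σ (Equiv.refl Bool)) x ∘ σ)‖ ^ 2 else 0) =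
      (if (fun d => (x ∘ Wire.ofForger m) (.inr (.inl (.inr (j, d))))) = y then
        ‖act L Φ (x ∘ Wire.ofForger m)‖ ^ 2 else 0) * ‖χ x‖ ^ 2 := by
    intro x
    have e2 : (fun d => (Equiv.arrowCongr σ (Equiv.refl Bool)) x (.out d)) =
        fun d => (x ∘ Wire.ofForger m) (.inr (.inl (.inr (j, d)))) := by
      funext d
      simp only [Equiv.arrowCongr_apply, Function.comp, e1, Equiv.refl_apply]
      rfl
    have e3 : (Equiv.arrowCongr σ (Equiv.refl Bool)) x ∘ σ = x := by
      funext w; simp [Equiv.arrowCongr_apply]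
    rw [e2, e3, ite_mul, zero_mul]
    simp only [Ψ, norm_mul, mul_pow]
  rw [Finset.sum_congr rfl fun x _ => h1 x,
    sum_range_mul (Wire.ofForger_injective (R := R) m)
      (fun z => if (fun d => z (.inr (.inl (.inr (j, d))))) = y then ‖act L Φ z‖ ^ 2 else 0)
      (fun x => ‖χ x‖ ^ 2) (fun x y hxy => by rw [hχ x y hxy]), hχ1, mul_one]
  rw [blockProb]

end Branch

/-! ### The output of the learner -/

section Learner

variable {G : GateSet} {n t q R anc : ℕ}

/-- Independent near-uniform choices are near-uniform. -/
theorem avg_near_uniform {I U B : Type} [Fintype I] [DecidableEq I] [Fintype U] [Fintype B] [DecidableEq B]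
    {δ : ℝ} (f : U → B) (h : ∀ b, (1 - δ) / Fintype.card B ≤ avg fun u => if f u = b then (1 : ℝ) else 0)
    (hδ1 : δ ≤ 1) (hδ2 : (Fintype.card I : ℝ) * δ ≤ 1 / 2) {F : (I → B) → ℝ} (hF : ∀ x, 0 ≤ F x) :
    (1 / 2) * avg F ≤ avg fun u : I → U => F fun i => f (u i) := by
  have h1 : ∀ u : I → U, F (fun i => f (u i)) =
      ∑ x : I → B, F x * ∏ i, if f (u i) = x i then (1 : ℝ) else 0 := by
    intro u
    rw [Finset.sum_eq_single fun i => f (u i)]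
    · simp
    · intro x _ hx
      obtain ⟨i, hi⟩ := Function.ne_iff.1 hx
      rw [Finset.prod_eq_zero (Finset.mem_univ i) (if_neg (Ne.symm hi)), mul_zero]
    · simp
  simp only [h1]
  rw [avg_sum, avg, Finset.sum_div, Finset.mul_sum]
  refine Finset.sum_le_sum fun x _ => ?_
  rw [avg_const_mul, avg_pi fun i u => if f u = x i then (1 : ℝ) else 0]
  have h2 : ∏ _i : I, (1 - δ) / Fintype.card B ≤
      ∏ i : I, avg fun u => if f u = x i then (1 : ℝ) else 0 :=
    Finset.prod_le_prod (fun i _ => div_nonneg (by linarith) (Nat.cast_nonneg _)) fun i _ => h (x i)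
  have h3 := half_le_prod hδ1 hδ2
  rw [Finset.prod_div_distrib] at h2
  have hcard : ∏ _i : I, (Fintype.card B : ℝ) = Fintype.card (I → B) := by
    rw [Fintype.card_fun, Finset.prod_const, Finset.card_univ, Nat.cast_pow]
  rw [hcard] at h2
  calc 1 / 2 * (F x / Fintype.card (I → B)) = F x * (1 / 2 / Fintype.card (I → B)) := by ring
    _ ≤ _ := mul_le_mul_of_nonneg_left ((div_le_div_of_nonneg_right h3 (Nat.cast_nonneg _)).trans h2) (hF x)

/-- Averages over coins: the bricks come close to the uniform distribution and the position register
selects each block with probability at least `1 / (2 t)`. -/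
theorem avg_coins_ge (ht : 0 < t)
    (hδ : (Fintype.card ((Bool × Fin t) × Slot n) : ℝ) *
      (1 - Fintype.card (Brick G) * (Fintype.card (Brick G × Brick G → Bool) : ℝ)⁻¹) ^ R ≤ 1 / 2)
    (hδ1 : (1 - Fintype.card (Brick G) * (Fintype.card (Brick G × Brick G → Bool) : ℝ)⁻¹) ^ R ≤ 1)
    (F : Fin t → ((Bool × Fin t) × Slot n → Brick G) → ℝ) (hF : ∀ j pos, 0 ≤ F j pos) :
    (1 / (4 * t)) * ∑ j, avg (F j) ≤ avg fun v : Wire.Coins G n t R → Bool =>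
      ∑ j : Fin t, if (heapWalk (t - 1) fun i => v (.inr i)) = t - 1 + j.val then F j (walkEnd v) else 0 := by
  classical
  let e := (Equiv.sumArrowEquivProdArrow (((Bool × Fin t) × Slot n) × Fin R × (Brick G × Brick G))
    (Fin (t - 1)) Bool).symm
  let e' : (((Bool × Fin t) × Slot n) → Fin R → (Brick G × Brick G) → Bool) ≃
      (((Bool × Fin t) × Slot n) × Fin R × (Brick G × Brick G) → Bool) :=
    { toFun := fun u i => u i.1 i.2.1 i.2.2
      invFun := fun u i r p => u (i, r, p)
      left_inv := fun u => rfl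
      right_inv := fun u => rfl }
  let f : (Fin R → (Brick G × Brick G) → Bool) → Brick G := fun u =>
    walk (fun u => swaps u (pairList G)) R u (brick₀ G)
  rw [Finset.mul_sum, avg_sum]
  refine Finset.sum_le_sum fun j _ => ?_
  -- The position and the bricks are driven by disjoint sets of coins, hence independent.
  have h1 : (avg fun v : Wire.Coins G n t R → Bool =>
      if (heapWalk (t - 1) fun i => v (.inr i)) = t - 1 + j.val then F j (walkEnd v) else 0) =
      (avg fun u : Fin (t - 1) → Bool => if heapWalk (t - 1) u = t - 1 + j.val then (1 : ℝ) else 0) *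
        avg fun u : ((Bool × Fin t) × Slot n) → Fin R → (Brick G × Brick G) → Bool =>
          F j fun i => f (u i) := by
    rw [← avg_comp_equiv e, avg_prod, ← avg_comp_equiv e', ← avg_const_mul]
    congr 1
    funext u
    rw [mul_comm, ← avg_const_mul]
    congr 1
    funext u'
    rw [mul_ite, mul_one, mul_zero]
    rfl
  rw [h1]
  have h2 : (1 / 2) * avg (F j) ≤ avg fun u : ((Bool × Fin t) × Slot n) → Fin R → (Brick G × Brick G) → Bool =>
      F j fun i => f (u i) :=
    avg_near_uniform f (fun b => walk_mixing (fun u => swaps u (pairList G))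
      (fun b b' => swaps_avg_ge nodup_pairList (fun p hp => mem_pairList.2 hp) b b') R (brick₀ G) b)
      hδ1 hδ (hF j)
  have h3 : 1 / (2 * t : ℝ) ≤
      avg fun u : Fin (t - 1) → Bool => if heapWalk (t - 1) u = t - 1 + j.val then (1 : ℝ) else 0 := by
    refine le_trans ?_ (heapWalk_avg_ge (t - 1) (t - 1 + j.val) (by omega) (by omega))
    apply one_div_le_one_div_of_le (by positivity)
    exact_mod_cast (by omega : t - 1 + j.val + 1 ≤ 2 * t)
  have h4 : 0 ≤ avg (F j) := avg_nonneg fun a => hF j a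
  -- A factor `1/(2t)` for hitting the leaf of `j`, and a factor `1/2` for the bricks being only
  -- nearly uniform.
  calc 1 / (4 * t : ℝ) * avg (F j) = 1 / (2 * t) * (1 / 2 * avg (F j)) := by ring
    _ ≤ _ := mul_le_mul h3 h2 (by positivity) (le_trans (by positivity) h3)

variable (R) in
/-- The circuit of the learner. -/
noncomputable def learnGates (m : Bool) (ht : 0 < t) (L : List (GateApp G (ForgerWire G n t q anc))) :
    List (GateApp G (Wire G n t q R anc)) :=
  setupGates G n t q R anc m ht ++ (walkGates G n t q R anc ++ (heapGates G n t q R anc ++ mainGates R m L))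

/-- The initial state of the learner. -/
noncomputable def learnInit (m : Bool) (C : Ckt G n) : (Wire G n t q R anc → Bool) → ℂ :=
  fixOn (Wire.classical G n t q R anc) (fun _ => false)
    fun x => inputPart m C x * ∏ c, zeroKet (x ∘ Wire.block c)

theorem indepSet_classical (m : Bool) (C : Ckt G n) : IndepSet (Wire.classical G n t q R anc)
    fun x => inputPart m C x * ∏ c, zeroKet (x ∘ Wire.block c) := by
  intro x i hi b
  have h : ∀ w, w ∉ Wire.classical G n t q R anc → Function.update x i b w = x w := fun w hw =>
    Function.update_of_ne (fun (h : w = i) => hw (h ▸ hi)) _ _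
  beta_reduce
  rw [inputPart, inputPart]
  congr 1
  · congr 1
    · congr 1; funext i; exact h _ id
    · congr 2
      · funext d; exact h _ id
      · funext w
        rcases w with (⟨⟨⟩⟩ | ⟨j, d⟩) | i <;> exact h _ id
  · refine Finset.prod_congr rfl fun c _ => congrArg _ (funext fun w => ?_)
    exact h _ (Wire.block_notMem c w)

open scoped Classical in
-- The later gates do not touch the coins, so branches with different coins have disjoint supports
-- and the output probability is the average over the branches. A lower bound suffices, so branches
-- whose token is not at a leaf can be discarded.
theorem learn_outProb_ge (m : Bool) (ht : 0 < t) (L : List (GateApp G (ForgerWire G n t q anc)))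
    (C : Ckt G n) (y : DescIdx G n → Bool) :
    (avg fun v : Wire.Coins G n t R → Bool =>
      ∑ j : Fin t, if (heapWalk (t - 1) fun i => v (.inr i)) = t - 1 + j.val then
        blockProb L (insertKey (walkEnd v) (!m, j) C) m j y else 0) ≤
    ∑ x : Wire G n t q R anc → Bool, if (fun d => x (.out d)) = y then
      ‖act (learnGates R m ht L) (learnInit m C) x‖ ^ 2 else 0 := by
  let φ : (Wire G n t q R anc → Bool) → ℂ := fun x => inputPart m C x * ∏ c, zeroKet (x ∘ Wire.block c)
  have hφ : IndepSet (Wire.classical G n t q R anc) φ := indepSet_classical m C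
  let B : (Wire.Coins G n t R → Bool) → (Wire G n t q R anc → Bool) → ℂ := fun v =>
    act (mainGates R m L) (fixOn (Wire.classical G n t q R anc)
      (Wire.values m v (walkEnd v) (heapWalk (t - 1) fun i => v (.inr i))) φ)
  have hact : act (learnGates R m ht L) (learnInit m C) = fun x =>
      ((Real.sqrt 2 : ℂ)⁻¹) ^ Fintype.card (Wire.Coins G n t R) * ∑ v, B v x := by
    rw [learnGates, act_append, act_append, act_append, learnInit, act_setupGates hφ m ht,
      act_smul, act_smul, act_smul, act_sum, act_sum, act_sum]
    funext x
    congr 1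
    refine Finset.sum_congr rfl fun v _ => ?_
    rw [act_walkGates hφ, act_heapGates hφ]
  -- The main part avoids the coin wires, so the coin outcome of a branch can be read off any point
  -- of its support.
  have hcoin : ∀ v x, B v x ≠ 0 → ∀ g, x (.ofCoin g) = v g := by
    intro v x hx
    have hS : ∀ w ∈ Set.range (Wire.ofCoin : Wire.Coins G n t R → Wire G n t q R anc),
        ∃ g, w = .ofCoin g := fun w ⟨g, hg⟩ => ⟨g, hg.symm⟩
    have hav : Avoids (Set.range (Wire.ofCoin : Wire.Coins G n t R → Wire G n t q R anc)) (mainGates R m L) :=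
      (Avoids.prepGates hS).append ((Avoids.insertGates hS m).append
        ((Avoids.ofForger hS m L).append (Avoids.extractGates hS)))
    set k : Wire G n t q R anc → Bool :=
      Wire.values m v (walkEnd v) (heapWalk (t - 1) fun i => v (.inr i)) with hk
    have h1 : fixOn (Wire.classical G n t q R anc) k φ =
        fixOn (Set.range Wire.ofCoin) k (fixOn (Wire.classical G n t q R anc) k φ) := by
      funext x
      by_cases hx : Agree (Set.range Wire.ofCoin) k x
      · rw [fixOn_pos hx]
      · rw [fixOn_neg hx, fixOn_neg]
        intro h
        apply hx
        rintro _ ⟨g, rfl⟩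
        exact h _ (by rcases g with _ | _ <;> trivial)
    have h2 : B v = fixOn (Set.range Wire.ofCoin) k (act (mainGates R m L)
        (fixOn (Wire.classical G n t q R anc) k φ)) := by
      rw [← act_fixOn _ hav, ← h1]
    rw [h2] at hx
    have hag : Agree (Set.range Wire.ofCoin) k x := by
      by_contra h; exact hx (fixOn_neg h _)
    intro g
    rw [hag _ ⟨g, rfl⟩]
    rcases g with _ | _ <;> rfl
  have hdis : ∀ x, ‖∑ v, B v x‖ ^ 2 = ∑ v, ‖B v x‖ ^ 2 := fun x =>
    norm_sq_sum_of_disjoint (fun v => B v x) fun v v' h h' =>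
      funext fun g => (hcoin v x h g).symm.trans (hcoin v' x h' g)
  -- The squared amplitude of a branch is the probability of its coin outcome.
  have hc : ‖((Real.sqrt 2 : ℂ)⁻¹) ^ Fintype.card (Wire.Coins G n t R)‖ ^ 2 =
      (Fintype.card (Wire.Coins G n t R → Bool) : ℝ)⁻¹ := by
    rw [norm_pow, norm_inv, Complex.norm_real, Real.norm_of_nonneg (Real.sqrt_nonneg 2), ← pow_mul,
      mul_comm, pow_mul, inv_pow, Real.sq_sqrt (by norm_num), Fintype.card_fun, Fintype.card_bool]
    push_cast
    rw [inv_pow]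
  have hP : (∑ x : Wire G n t q R anc → Bool, if (fun d => x (.out d)) = y then
      ‖act (learnGates R m ht L) (learnInit m C) x‖ ^ 2 else 0) =
      avg fun v => ∑ x : Wire G n t q R anc → Bool,
        if (fun d => x (.out d)) = y then ‖B v x‖ ^ 2 else 0 := by
    rw [avg, Finset.sum_comm, div_eq_inv_mul, Finset.mul_sum]
    refine Finset.sum_congr rfl fun x _ => ?_
    by_cases hx : (fun d => x (.out d)) = y
    · simp only [if_pos hx, hact, norm_mul, mul_pow, hdis, hc]
    · simp [if_neg hx]
  rw [hP]
  refine avg_mono fun v => ?_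
  by_cases hj : ∃ j : Fin t, (heapWalk (t - 1) fun i => v (.inr i)) = t - 1 + j.val
  · obtain ⟨j, hj⟩ := hj
    rw [Finset.sum_eq_single j, if_pos hj, ← branch_outProb (R := R) m L v]
    · refine le_of_eq (Finset.sum_congr rfl fun x _ => ?_)
      simp only [B, hj]
      rfl
    · intro j' _ hne
      rw [if_neg]
      rw [hj]
      intro h
      exact hne (Fin.ext (by omega))
    · simp
  · push Not at hj
    rw [Finset.sum_eq_zero fun j _ => if_neg (hj j)]
    exact Finset.sum_nonneg fun x _ => by split_ifs <;> positivity

theorem blockProb_nonneg (L : List (GateApp G (ForgerWire G n t q anc))) (sk : SecretKey G n t) (m : Bool)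
    (j : Fin t) (y : DescIdx G n → Bool) : 0 ≤ blockProb L sk m j y :=
  Finset.sum_nonneg fun x _ => by split_ifs <;> positivity

/-- A uniform circuit planted at one place of an independent uniform key gives a uniform key; what
stood at that place before is averaged away. Hence the forger sees the distribution of the real
experiment. -/
theorem avg_insertKey (a : Bool × Fin t) (F : SecretKey G n t → ℝ) :
    (avg fun C : Ckt G n => avg fun pos : (Bool × Fin t) × Slot n → Brick G => F (insertKey pos a C)) =
      avg F := by
  let e : SecretKey G n t ≃ ((Bool × Fin t) × Slot n → Brick G) := (Equiv.curry _ _ _).symm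
  have h1 : ∀ C : Ckt G n, (avg fun pos : (Bool × Fin t) × Slot n → Brick G => F (insertKey pos a C)) =
      avg fun sk : SecretKey G n t => F (Function.update sk a C) := fun C => (avg_comp_equiv e _).symm
  simp only [h1]
  rw [← avg_comp_equiv (Equiv.funSplitAt a (Ckt G n)).symm F, avg_prod]
  congr 1
  funext C
  rw [← avg_comp_equiv (Equiv.funSplitAt a (Ckt G n)).symm fun sk => F (Function.update sk a C), avg_prod]
  have h2 : ∀ (b : Ckt G n) (r : {i // i ≠ a} → Ckt G n),
      Function.update ((Equiv.funSplitAt a (Ckt G n)).symm (b, r)) a C =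
        (Equiv.funSplitAt a (Ckt G n)).symm (C, r) := by
    intro b r
    funext i
    by_cases hi : i = a
    · subst hi; simp [Equiv.funSplitAt]
    · simp [Equiv.funSplitAt, hi]
  simp only [h2]
  exact avg_const _

open scoped Classical in
/-- The learner does as well as the forger on a random block, up to a factor `4 t`. -/
theorem learn_ge (m : Bool) (ht : 0 < t)
    (hδ : (Fintype.card ((Bool × Fin t) × Slot n) : ℝ) *
      (1 - Fintype.card (Brick G) * (Fintype.card (Brick G × Brick G → Bool) : ℝ)⁻¹) ^ R ≤ 1 / 2)
    (hδ1 : (1 - Fintype.card (Brick G) * (Fintype.card (Brick G × Brick G → Bool) : ℝ)⁻¹) ^ R ≤ 1)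
    (L : List (GateApp G (ForgerWire G n t q anc))) (g : Ckt G n → (DescIdx G n → Bool) → ℝ)
    (hg : ∀ C y, 0 ≤ g C y) :
    (1 / (4 * t)) * ∑ j : Fin t, (avg fun sk : SecretKey G n t =>
      ∑ y, blockProb L sk m j y * g (sk (!m, j)) y) ≤
    avg fun C : Ckt G n => ∑ y, (∑ x : Wire G n t q R anc → Bool, if (fun d => x (.out d)) = y then
      ‖act (learnGates R m ht L) (learnInit m C) x‖ ^ 2 else 0) * g C y := by
  have h1 : ∀ j, (avg fun sk : SecretKey G n t => ∑ y, blockProb L sk m j y * g (sk (!m, j)) y) =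
      avg fun C : Ckt G n => avg fun pos : (Bool × Fin t) × Slot n → Brick G =>
        ∑ y, blockProb L (insertKey pos (!m, j) C) m j y * g C y := by
    intro j
    rw [← avg_insertKey (!m, j)]
    have : ∀ (C : Ckt G n) (pos : (Bool × Fin t) × Slot n → Brick G),
        insertKey pos (!m, j) C (!m, j) = C := fun C pos => Function.update_self _ _ _
    simp only [this]
  simp only [h1]
  rw [← avg_sum, ← avg_const_mul]
  refine avg_mono fun C => ?_
  refine (avg_coins_ge (R := R) ht hδ hδ1 (fun j pos =>
    ∑ y, blockProb L (insertKey pos (!m, j) C) m j y * g C y) fun j pos =>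
      Finset.sum_nonneg fun y _ => mul_nonneg (blockProb_nonneg _ _ _ _ _) (hg C y)).trans ?_
  have h2 : (avg fun v : Wire.Coins G n t R → Bool =>
      ∑ j : Fin t, if (heapWalk (t - 1) fun i => v (.inr i)) = t - 1 + j.val then
        ∑ y, blockProb L (insertKey (walkEnd v) (!m, j) C) m j y * g C y else 0) =
      ∑ y, g C y * avg fun v : Wire.Coins G n t R → Bool =>
        ∑ j : Fin t, if (heapWalk (t - 1) fun i => v (.inr i)) = t - 1 + j.val then
          blockProb L (insertKey (walkEnd v) (!m, j) C) m j y else 0 := by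
    simp only [← avg_const_mul]
    rw [← avg_sum]
    congr 1
    funext v
    simp only [Finset.mul_sum]
    rw [Finset.sum_comm]
    refine Finset.sum_congr rfl fun j _ => ?_
    split_ifs
    · exact Finset.sum_congr rfl fun y _ => mul_comm _ _
    · simp
  rw [h2]
  refine Finset.sum_le_sum fun y _ => ?_
  rw [mul_comm]
  exact mul_le_mul_of_nonneg_right (learn_outProb_ge m ht L C y) (hg C y)

end Learner

/-! ### Placement of the wires of the learner -/

section Placement

variable {G : GateSet} {n t q R anc A : ℕ}

/-- The grouping of the wires is immaterial at the start, as all of them except the inputs are zero;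
in particular the initial state does not depend on `m`. -/
theorem learnInit_eq (m : Bool) (C : Ckt G n) (x : Wire G n t q R anc → Bool) :
    learnInit m C x = copies q C.ket (fun i => x (.inp i.1 i.2)) *
      zeroKet fun w : {w : Wire G n t q R anc // ∀ c i, w ≠ .inp c i} => x w.1 := by
  by_cases hx : ∀ w : {w : Wire G n t q R anc // ∀ c i, w ≠ .inp c i}, x w.1 = false
  · have hx' : ∀ w : Wire G n t q R anc, (∀ c i, w ≠ .inp c i) → x w = false := fun w hw => hx ⟨w, hw⟩
    have e1 : Agree (Wire.classical G n t q R anc) (fun _ => false) x :=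
      fun w hw => hx' w fun c i h => by subst h; exact hw
    have e2 : ∀ c, zeroKet (x ∘ Wire.block c) = 1 := fun c => if_pos fun w =>
      hx' _ (by cases w <;> simp [Wire.block])
    have e3 : zeroKet (fun d => x (.out d)) = 1 := if_pos fun d => hx' _ (by simp)
    have e4 : zeroKet (fun w => x (.ofForger m (.inr w))) = 1 := if_pos fun w => hx' _ (by
      rcases w with (⟨⟨⟩⟩ | ⟨j, d⟩) | i <;> simp [Wire.ofForger])
    rw [learnInit, fixOn_pos e1, inputPart, e3, e4, Finset.prod_congr rfl fun c _ => e2 c, zeroKet, if_pos hx]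
    simp
  · rw [zeroKet, if_neg hx, mul_zero]
    by_contra hne
    apply hx
    have hag : Agree (Wire.classical G n t q R anc) (fun _ => false) x := by
      by_contra hag; exact hne (fixOn_neg hag _)
    rw [learnInit, fixOn_pos hag, inputPart] at hne
    have hz : ∀ {W : Type} {z : W → Bool}, (zeroKet z : ℂ) ≠ 0 → ∀ w, z w = false := fun hz => by
      by_contra hw; exact hz (if_neg hw)
    have h4 := Finset.prod_ne_zero_iff.1 (right_ne_zero_of_mul hne)
    have h5 := right_ne_zero_of_mul (left_ne_zero_of_mul hne)
    have h6 := hz (left_ne_zero_of_mul h5)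
    have h7 := hz (right_ne_zero_of_mul h5)
    rintro ⟨w, hw⟩
    cases w with
    | inp c i => exact absurd rfl (hw c i)
    | out d => exact h6 d
    | key c a i => exact hz (h4 (c, a) (Finset.mem_univ _)) (.inl i)
    | dum c a b => exact hz (h4 (c, a) (Finset.mem_univ _)) (.inr b)
    | fmsg => exact h7 (.inl (.inl ()))
    | fsig j d => exact h7 (.inl (.inr (j, d)))
    | fanc i => exact h7 (.inr i)
    | _ => exact hag _ trivial

instance : DecidableEq (Fin q × Fin n ⊕ DescIdx G n ⊕ Fin A) := inferInstance

open scoped Classical in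
/-- A placement of the wires among the input, the output and the ancillas does not change the
probabilities. -/
theorem sum_relabel_learnGates {f : Wire G n t q R anc → Fin q × Fin n ⊕ DescIdx G n ⊕ Fin A}
    (hf : Function.Injective f) (hinp : ∀ c i, f (.inp c i) = .inl (c, i))
    (hout : ∀ d, f (.out d) = .inr (.inl d)) (m : Bool) (C : Ckt G n) (L : List (GateApp G (Wire G n t q R anc)))
    (y : DescIdx G n → Bool) :
    (∑ x : Fin q × Fin n ⊕ DescIdx G n ⊕ Fin A → Bool, if (fun d => x (.inr (.inl d))) = y then
      ‖act (relabel f hf L) (withAncillas (copies q C.ket)) x‖ ^ 2 else 0) =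
    ∑ x : Wire G n t q R anc → Bool, if (fun d => x (.out d)) = y then
      ‖act L (learnInit m C) x‖ ^ 2 else 0 := by
  let χ : (Fin q × Fin n ⊕ DescIdx G n ⊕ Fin A → Bool) → ℂ := fun x =>
    if ∀ w, w ∉ Set.range f → x w = false then 1 else 0
  have hχ : ∀ x y : Fin q × Fin n ⊕ DescIdx G n ⊕ Fin A → Bool,
      (∀ w, w ∉ Set.range f → x w = y w) → χ x = χ y := by
    intro x y hxy
    have : (∀ w, w ∉ Set.range f → x w = false) ↔ ∀ w, w ∉ Set.range f → y w = false :=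
      forall₂_congr fun w hw => by rw [hxy w hw]
    simp only [χ, this]
  have hind : IndepOf f χ := fun x i b => hχ _ _ fun w hw =>
    Function.update_of_ne (fun h => hw ⟨i, h.symm⟩) _ _
  have hinit : (withAncillas (copies q C.ket) : (Fin q × Fin n ⊕ DescIdx G n ⊕ Fin A → Bool) → ℂ) =
      fun x => learnInit m C (x ∘ f) * χ x := by
    funext x
    rw [learnInit_eq, withAncillas]
    have e1 : (fun i : Fin q × Fin n => (x ∘ f) (.inp i.1 i.2)) = x ∘ Sum.inl := by
      funext i; rw [Function.comp, hinp]; rfl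
    rw [e1, mul_assoc]
    congr 1
    simp only [zeroKet, χ, mul_ite, mul_one, mul_zero]
    by_cases h1 : ∀ w, (x ∘ Sum.inr) w = false
    · rw [if_pos h1, if_pos, if_pos]
      · rintro ⟨w, hw⟩
        rcases h : f w with i | w'
        · exact absurd (hf (h.trans (hinp i.1 i.2).symm)) (hw _ _)
        · simp only [Function.comp, h]; exact h1 w'
      · rintro (w | w) hw
        · exact absurd ⟨_, hinp w.1 w.2⟩ hw
        · exact h1 w
    · rw [if_neg h1]
      symm
      split_ifs with h2 h3
      · exfalso
        apply h1
        intro w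
        by_cases hw : (.inr w) ∈ Set.range f
        · obtain ⟨w', hw'⟩ := hw
          have := h3 ⟨w', fun c i h => by rw [h, hinp] at hw'; cases hw'⟩
          simp only [Function.comp, hw'] at this
          exact this
        · exact h2 _ hw
      · rfl
      · rfl
  have h1 : ∀ x : Fin q × Fin n ⊕ DescIdx G n ⊕ Fin A → Bool, (if (fun d => x (.inr (.inl d))) = y then
      ‖act (relabel f hf L) (withAncillas (copies q C.ket)) x‖ ^ 2 else 0) =
      (if (fun d => (x ∘ f) (.out d)) = y then ‖act L (learnInit m C) (x ∘ f)‖ ^ 2 else 0) * ‖χ x‖ ^ 2 := by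
    intro x
    have e1 : (fun d => x (.inr (.inl d))) = fun d => (x ∘ f) (.out d) := by
      funext d; rw [Function.comp, hout]
    rw [hinit, act_relabel _ _ _ hind, e1, norm_mul, mul_pow, ite_mul, zero_mul]
  rw [Finset.sum_congr rfl fun x _ => h1 x, sum_range_mul hf
    (fun x => if (fun d => x (.out d)) = y then ‖act L (learnInit m C) x‖ ^ 2 else 0) (fun x => ‖χ x‖ ^ 2)
    fun x y hxy => by rw [hχ x y hxy]]
  have h2 := sum_indicator_unique (Set.range f)ᶜ (fun _ => false) (F := fun x => ‖χ x‖ ^ 2) fun x => by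
    by_cases hx : ∀ w, w ∉ Set.range f → x w = false
    · exact Or.inl ⟨by simp only [χ, if_pos hx]; simp, hx⟩
    · exact Or.inr ⟨by simp only [χ, if_neg hx]; simp, hx⟩
  refine (congrArg _ ?_).trans (mul_one _)
  refine Eq.trans ?_ h2
  congr

end Placement

/-! ### Encodings of gates -/

section RawGates

variable {G : GateSet}

/-- Circuits for different `n` have different types. Working with the trees that encode gates and
wires lets a single function on untyped data produce the whole family. -/
def rawOne (g : ℕ) (w : Tr) : Tr := .node .leaf (.node (.unary g) w)

def rawTwo (g : ℕ) (w w' : Tr) : Tr := .node (.node .leaf .leaf) (.node (.unary g) (.node w w'))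

variable (G) in
noncomputable def rawCnot (a b : Tr) : List Tr := [rawTwo (cnotIdx G) a b]

variable (G) in
noncomputable def rawCcz (a b c : Tr) : List Tr :=
  [rawOne (tIdx G) a, rawOne (tIdx G) b, rawOne (tIdx G) c] ++
  (rawCnot G a b ++ [rawOne (G.inv1 (tIdx G)) b] ++ rawCnot G a b) ++
  (rawCnot G b c ++ [rawOne (G.inv1 (tIdx G)) c] ++ rawCnot G b c) ++
  (rawCnot G a c ++ [rawOne (G.inv1 (tIdx G)) c] ++ rawCnot G a c) ++
  (rawCnot G a c ++ (rawCnot G b c ++ [rawOne (tIdx G) c] ++ rawCnot G b c) ++ rawCnot G a c)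

variable (G) in
noncomputable def rawCswap (c a b : Tr) : List Tr :=
  rawCnot G b a ++ ([rawOne (hIdx G) b] ++ rawCcz G c a b ++ [rawOne (hIdx G) b]) ++ rawCnot G b a

variable (G) in
noncomputable def rawNot (i : Tr) : List Tr :=
  [rawOne (hIdx G) i, rawOne (sIdx G) i, rawOne (sIdx G) i, rawOne (hIdx G) i]

variable (G) in
noncomputable def rawSwap (a b : Tr) : List Tr := rawCnot G a b ++ rawCnot G b a ++ rawCnot G a b

def rawBrick (i j : Tr) : Brick G → List Tr
  | .inl (g, g') => (g.toList.map fun a : Fin G.num1 => rawOne a i) ++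
      (g'.toList.map fun a : Fin G.num1 => rawOne a j)
  | .inr (g, false) => [rawTwo g i j]
  | .inr (g, true) => [rawTwo g j i]

variable {W W' : Type} [DecidableEq W] [DecidableEq W'] [Enc W']

/-- The list of the encodings of the gates of a renamed circuit. -/
def encGates (f : W → W') (hf : Function.Injective f) (L : List (GateApp G W)) : List Tr :=
  (relabel f hf L).map Enc.enc

variable {f : W → W'} {hf : Function.Injective f}

theorem encGates_append (L L' : List (GateApp G W)) :
    encGates f hf (L ++ L') = encGates f hf L ++ encGates f hf L' := by
  rw [encGates, relabel_append, List.map_append]; rfl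

theorem encGates_flatMap {ι : Type} (l : List ι) (F : ι → List (GateApp G W)) :
    encGates f hf (l.flatMap F) = l.flatMap fun i => encGates f hf (F i) := by
  rw [encGates, relabel_flatMap, List.map_flatMap]; rfl

theorem encGates_cnot {i j : W} (h : i ≠ j) :
    encGates f hf (cnot G i j) = rawCnot G (Enc.enc (f i)) (Enc.enc (f j)) := by
  rw [cnot, dif_pos h]; rfl

theorem encGates_ccz {a b c : W} (hab : a ≠ b) (hac : a ≠ c) (hbc : b ≠ c) :
    encGates f hf (ccz G a b c) = rawCcz G (Enc.enc (f a)) (Enc.enc (f b)) (Enc.enc (f c)) := by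
  simp only [ccz, encGates_append, encGates_cnot hab, encGates_cnot hac, encGates_cnot hbc]
  rfl

theorem encGates_cswap {c a b : W} (hca : c ≠ a) (hcb : c ≠ b) (hab : a ≠ b) :
    encGates f hf (cswap G c a b) = rawCswap G (Enc.enc (f c)) (Enc.enc (f a)) (Enc.enc (f b)) := by
  simp only [cswap, encGates_append, encGates_ccz hca hcb hab, encGates_cnot hab.symm]
  rfl

theorem encGates_swap {a b : W} (hab : a ≠ b) :
    encGates f hf (swapGate G a b) = rawSwap G (Enc.enc (f a)) (Enc.enc (f b)) := by
  simp only [swapGate, encGates_append, encGates_cnot hab, encGates_cnot hab.symm]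
  rfl

theorem encGates_brick {i j : W} (h : i ≠ j) (b : Brick G) :
    encGates f hf (b.gates i j h) = rawBrick (Enc.enc (f i)) (Enc.enc (f j)) b := by
  rcases b with ⟨g, g'⟩ | ⟨g, _ | _⟩
  · cases g <;> cases g' <;> rfl
  · rfl
  · rfl

theorem enc_list_map {α : Type} [Enc α] (l : List α) : Enc.enc (l.map Enc.enc) = Enc.enc l := by
  induction l with
  | nil => rfl
  | cons a l ih => exact congrArg (Tr.node (Enc.enc a)) ih

theorem flatMap_finRange {α : Type} {k : ℕ} {F : Fin k → List α} {F' : ℕ → List α}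
    (h : ∀ i, F i = F' i.val) : (List.finRange k).flatMap F = (List.range k).flatMap F' := by
  rw [← List.map_coe_finRange_eq_range, List.flatMap_map]
  exact List.flatMap_congr fun i _ => h i

theorem flatMap_product {α β γ : Type} (l : List α) (l' : List β) (F : α × β → List γ) :
    (List.product l l').flatMap F = l.flatMap fun a => l'.flatMap fun b => F (a, b) := by
  rw [List.product, List.flatMap_assoc]
  simp only [List.flatMap_map]

/-- The numbers of the blocks. -/
def keyRange (t : ℕ) : List (ℕ × ℕ) := (List.range 2).flatMap fun b => (List.range t).map fun j => (b, j)

/-- The numbers of the slots. -/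
def slotRange (n : ℕ) : List (ℕ × ℕ) :=
  (List.range (depth n)).flatMap fun l => (List.range ((n - l % 2) / 2)).map fun s => (l, s)

def posRange (n t : ℕ) : List ((ℕ × ℕ) × (ℕ × ℕ)) :=
  (keyRange t).flatMap fun a => (slotRange n).map fun s => (a, s)

theorem flatMap_keyList {α : Type} {t : ℕ} {F : Bool × Fin t → List α} {F' : ℕ × ℕ → List α}
    (h : ∀ a, F a = F' (a.1.toNat, a.2.val)) : (keyList t).flatMap F = (keyRange t).flatMap F' := by
  rw [keyList, flatMap_product, keyRange, List.flatMap_assoc]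
  simp only [List.flatMap_map]
  have h1 : ∀ b : Bool, ((List.finRange t).flatMap fun j => F (b, j)) =
      (List.range t).flatMap fun j => F' (b.toNat, j) := fun b => flatMap_finRange fun j => h (b, j)
  simp only [h1]
  rfl

theorem flatMap_slots {α : Type} {n : ℕ} {F : Slot n → List α} {F' : ℕ × ℕ → List α}
    (h : ∀ s, F s = F' (s.1.val, s.2.val)) : (slotList n).flatMap F = (slotRange n).flatMap F' := by
  rw [slotList, List.sigma, List.flatMap_assoc, slotRange, List.flatMap_assoc]
  refine flatMap_finRange fun l => ?_
  rw [List.flatMap_map, List.flatMap_map]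
  exact flatMap_finRange fun j => h ⟨l, j⟩

theorem flatMap_posList {α : Type} {n t : ℕ} {F : (Bool × Fin t) × Slot n → List α}
    {F' : (ℕ × ℕ) × (ℕ × ℕ) → List α}
    (h : ∀ i, F i = F' ((i.1.1.toNat, i.1.2.val), (i.2.1.val, i.2.2.val))) :
    (posList n t).flatMap F = (posRange n t).flatMap F' := by
  rw [posList, flatMap_product, posRange, List.flatMap_assoc]
  simp only [List.flatMap_map]
  exact flatMap_keyList fun a => flatMap_slots fun s => h (a, s)

end RawGates

/-! ### Polynomial time for encodings of gates -/

section RawPT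

variable {G : GateSet} {Γ : Type} [Enc Γ] {f g h : Γ → Tr}

@[fun_prop]
theorem PT.unary {f : Γ → ℕ} (hf : PT f) : PT fun x => Tr.unary (f x) := PT.enc.comp hf

@[fun_prop]
theorem PT.rawOne (k : ℕ) (hf : PT f) : PT fun x => rawOne k (f x) := by
  unfold QSig.rawOne; fun_prop

@[fun_prop]
theorem PT.rawTwo (k : ℕ) (hf : PT f) (hg : PT g) : PT fun x => rawTwo k (f x) (g x) := by
  unfold QSig.rawTwo; fun_prop

@[fun_prop]
theorem PT.rawCnot (hf : PT f) (hg : PT g) : PT fun x => rawCnot G (f x) (g x) := by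
  unfold QSig.rawCnot; fun_prop

@[fun_prop]
theorem PT.rawCcz (hf : PT f) (hg : PT g) (hh : PT h) : PT fun x => rawCcz G (f x) (g x) (h x) := by
  unfold QSig.rawCcz; fun_prop

@[fun_prop]
theorem PT.rawCswap (hf : PT f) (hg : PT g) (hh : PT h) : PT fun x => rawCswap G (f x) (g x) (h x) := by
  unfold QSig.rawCswap; fun_prop

@[fun_prop]
theorem PT.rawNot (hf : PT f) : PT fun x => rawNot G (f x) := by
  unfold QSig.rawNot; fun_prop

@[fun_prop]
theorem PT.rawSwap (hf : PT f) (hg : PT g) : PT fun x => rawSwap G (f x) (g x) := by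
  unfold QSig.rawSwap; fun_prop

@[fun_prop]
theorem PT.rawBrick (b : Brick G) (hf : PT f) (hg : PT g) : PT fun x => rawBrick (f x) (g x) b := by
  rcases b with ⟨a, a'⟩ | ⟨a, _ | _⟩
  · cases a <;> cases a' <;> simp only [QSig.rawBrick, Option.toList, List.map_cons, List.map_nil,
      List.nil_append, List.append_nil] <;> fun_prop
  · simp only [QSig.rawBrick]; fun_prop
  · simp only [QSig.rawBrick]; fun_prop

@[fun_prop]
theorem PT.keyRange {f : Γ → ℕ} (hf : PT f) : PT fun x => keyRange (f x) := by
  unfold QSig.keyRange; fun_prop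

@[fun_prop]
theorem PT.slotRange {f : Γ → ℕ} (hf : PT f) : PT fun x => slotRange (f x) := by
  unfold QSig.slotRange; fun_prop

@[fun_prop]
theorem PT.posRange {f g : Γ → ℕ} (hf : PT f) (hg : PT g) : PT fun x => posRange (f x) (g x) := by
  unfold QSig.posRange; fun_prop

end RawPT

/-! ### Numbers of wires -/

section Numbering

variable (G : GateSet)

/-- A bound for the numbers that occur in the encoding of a brick. -/
def brickBase : ℕ := G.num1 + G.num2 + 2

variable {G}

/-- The numbers that occur in the encoding of a brick. -/
def brickDigits : Brick G → ℕ × ℕ × ℕ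
  | .inl (g, h) => (0, (g.elim 0 fun a => a.val + 1), h.elim 0 fun a => a.val + 1)
  | .inr (g, o) => (1, g.val, o.toNat)

/-- Positional notation with the numbers that occur in the encoding, so that the number of a brick
can be recovered from its tree (`rawBrickNum`). -/
def brickNum (b : Brick G) : ℕ :=
  (brickBase G * (brickDigits b).1 + (brickDigits b).2.1) * brickBase G + (brickDigits b).2.2

theorem brickDigits_injective : Function.Injective (brickDigits : Brick G → ℕ × ℕ × ℕ) := by
  rintro (⟨_ | g, _ | h⟩ | ⟨g, _ | _⟩) (⟨_ | g', _ | h'⟩ | ⟨g', _ | _⟩) h <;>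
    simp_all [brickDigits, Fin.ext_iff]

theorem brickDigits_lt (b : Brick G) : (brickDigits b).1 < 2 ∧ (brickDigits b).2.1 < brickBase G ∧
    (brickDigits b).2.2 < brickBase G := by
  rcases b with ⟨_ | g, _ | h⟩ | ⟨g, _ | _⟩ <;> simp only [brickDigits, brickBase, Option.elim,
    Bool.toNat_false, Bool.toNat_true] <;> omega

theorem brickNum_lt (b : Brick G) : brickNum b < 2 * brickBase G * brickBase G := by
  obtain ⟨h1, h2, h3⟩ := brickDigits_lt b
  rw [brickNum]
  generalize (brickDigits b).1 = k at *
  generalize (brickDigits b).2.1 = x at *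
  generalize (brickDigits b).2.2 = y at *
  have hk : k ≤ 1 := by omega
  nlinarith [Nat.mul_le_mul_left (brickBase G) hk]

theorem brickNum_injective : Function.Injective (brickNum : Brick G → ℕ) := by
  intro b b' h
  obtain ⟨-, h2, h3⟩ := brickDigits_lt b
  obtain ⟨-, h2', h3'⟩ := brickDigits_lt b'
  apply brickDigits_injective
  rw [brickNum, brickNum] at h
  generalize brickDigits b = d at *
  generalize brickDigits b' = d' at *
  obtain ⟨k, x, y⟩ := d
  obtain ⟨k', x', y'⟩ := d'
  have hK : 0 < brickBase G := by omega
  simp only at h h2 h2' h3 h3'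
  have hy : y = y' := by
    have := congrArg (· % brickBase G) h
    simpa [Nat.mul_add_mod', Nat.mod_eq_of_lt h3, Nat.mod_eq_of_lt h3'] using this
  subst hy
  have h1 := Nat.eq_of_mul_eq_mul_right hK (Nat.add_right_cancel h)
  have hx : x = x' := by
    have := congrArg (· % brickBase G) h1
    simpa [Nat.mul_add_mod, Nat.mod_eq_of_lt h2, Nat.mod_eq_of_lt h2'] using this
  subst hx
  have h2 := Nat.eq_of_mul_eq_mul_left hK (Nat.add_right_cancel h1)
  rw [h2]

theorem enc_brick (b : Brick G) : Enc.enc b = Tr.node (.unary (brickDigits b).1)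
    (.node (.unary (brickDigits b).2.1) (.unary (brickDigits b).2.2)) := by
  rcases b with ⟨_ | g, _ | h⟩ | ⟨g, _ | _⟩ <;> rfl

variable (G) in
/-- The number of a brick, from its encoding. -/
def rawBrickNum (T : Tr) : ℕ :=
  (brickBase G * T.left.toNat + T.right.left.toNat) * brickBase G + T.right.right.toNat

theorem toNat_unary (k : ℕ) : (Tr.unary k).toNat = k := Tr.toNat_enc k

theorem rawBrickNum_enc (b : Brick G) : rawBrickNum G (Enc.enc b) = brickNum b := by
  rw [enc_brick]
  simp only [rawBrickNum, Tr.left, Tr.right, toNat_unary]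
  rfl

variable {n t q R anc : ℕ}

/-- The data that determine a wire. -/
def Wire.digits : Wire G n t q R anc → List ℕ
  -- The tag `10` marks the inputs and outputs of the learner, which receive no ancilla number.
  | .inp _ _ => [10, 0, 0, 0, 0, 0, 0, 0]
  | .out _ => [10, 0, 0, 0, 0, 0, 0, 0]
  | .coin a s r p => [0, a.1.toNat, a.2, s.1, s.2, r, brickNum p.1, brickNum p.2]
  | .hcoin v => [1, v, 0, 0, 0, 0, 0, 0]
  | .heap v => [2, v, 0, 0, 0, 0, 0, 0]
  | .desc a d => [3, a.1.toNat, a.2, d.1.1, d.1.2, brickNum d.2, 0, 0]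
  | .key c a i => [4, c, a.1.toNat, a.2, i, 0, 0, 0]
  | .dum c a b => [5, c, a.1.toNat, a.2, b.toNat, 0, 0, 0]
  | .msg => [6, 0, 0, 0, 0, 0, 0, 0]
  | .fmsg => [7, 0, 0, 0, 0, 0, 0, 0]
  | .fsig j d => [8, j, d.1.1, d.1.2, brickNum d.2, 0, 0, 0]
  | .fanc i => [9, i, 0, 0, 0, 0, 0, 0]

variable (G n t q R anc) in
/-- A bound for these data. -/
def wireBase : ℕ := 2 * t + q + n + depth n + R + anc + 2 * brickBase G * brickBase G + 20

theorem Wire.length_digits (w : Wire G n t q R anc) : w.digits.length = 8 := by cases w <;> rfl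

theorem Bool.toNat_lt_two' (b : Bool) : b.toNat ≤ 1 := by cases b <;> simp

theorem Wire.digits_lt (w : Wire G n t q R anc) : ∀ d ∈ w.digits, d < wireBase G n t q R anc := by
  have hs : ∀ s : Slot n, s.1.val < wireBase G n t q R anc ∧ s.2.val < wireBase G n t q R anc := by
    intro s
    have h1 := s.1.isLt
    have h2 := s.2.isLt
    constructor <;> rw [wireBase] <;> omega
  have hb : ∀ b : Brick G, brickNum b < wireBase G n t q R anc := by
    intro b
    have := brickNum_lt b
    rw [wireBase]; omega
  have ht : ∀ b : Bool, b.toNat < wireBase G n t q R anc := by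
    intro b
    have := Bool.toNat_lt_two' b
    rw [wireBase]; omega
  have hj : ∀ j : Fin t, j.val < wireBase G n t q R anc := by intro j; rw [wireBase]; omega
  have hk : ∀ k ≤ 10, k < wireBase G n t q R anc := by intro k hk; rw [wireBase]; omega
  intro d hd
  cases w <;> simp only [Wire.digits, List.mem_cons, List.not_mem_nil, or_false] at hd
  case inp => rcases hd with rfl | rfl | rfl | rfl | rfl | rfl | rfl | rfl <;> exact hk _ (by norm_num)
  case out => rcases hd with rfl | rfl | rfl | rfl | rfl | rfl | rfl | rfl <;> exact hk _ (by norm_num)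
  case coin a s r p =>
    have hr : r.val < wireBase G n t q R anc := by rw [wireBase]; omega
    rcases hd with rfl | rfl | rfl | rfl | rfl | rfl | rfl | rfl
    exacts [hk _ (by norm_num), ht _, hj _, (hs s).1, (hs s).2, hr, hb _, hb _]
  case hcoin v =>
    have hv : v.val < wireBase G n t q R anc := by rw [wireBase]; omega
    rcases hd with rfl | rfl | rfl | rfl | rfl | rfl | rfl | rfl <;> first | exact hv | exact hk _ (by norm_num)
  case heap v =>
    have hv : v.val < wireBase G n t q R anc := by rw [wireBase]; omega
    rcases hd with rfl | rfl | rfl | rfl | rfl | rfl | rfl | rfl <;> first | exact hv | exact hk _ (by norm_num)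
  case desc a d =>
    rcases hd with rfl | rfl | rfl | rfl | rfl | rfl | rfl | rfl
    exacts [hk _ (by norm_num), ht _, hj _, (hs d.1).1, (hs d.1).2, hb _, hk _ (by norm_num),
      hk _ (by norm_num)]
  case key c a i =>
    have hc : c.val < wireBase G n t q R anc := by rw [wireBase]; omega
    have hi : i.val < wireBase G n t q R anc := by rw [wireBase]; omega
    rcases hd with rfl | rfl | rfl | rfl | rfl | rfl | rfl | rfl
    exacts [hk _ (by norm_num), hc, ht _, hj _, hi, hk _ (by norm_num), hk _ (by norm_num), hk _ (by norm_num)]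
  case dum c a b =>
    have hc : c.val < wireBase G n t q R anc := by rw [wireBase]; omega
    rcases hd with rfl | rfl | rfl | rfl | rfl | rfl | rfl | rfl
    exacts [hk _ (by norm_num), hc, ht _, hj _, ht _, hk _ (by norm_num), hk _ (by norm_num),
      hk _ (by norm_num)]
  case msg => rcases hd with rfl | rfl | rfl | rfl | rfl | rfl | rfl | rfl <;> exact hk _ (by norm_num)
  case fmsg => rcases hd with rfl | rfl | rfl | rfl | rfl | rfl | rfl | rfl <;> exact hk _ (by norm_num)
  case fsig j d =>
    rcases hd with rfl | rfl | rfl | rfl | rfl | rfl | rfl | rfl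
    exacts [hk _ (by norm_num), hj _, (hs d.1).1, (hs d.1).2, hb _, hk _ (by norm_num), hk _ (by norm_num),
      hk _ (by norm_num)]
  case fanc i =>
    have hi : i.val < wireBase G n t q R anc := by rw [wireBase]; omega
    rcases hd with rfl | rfl | rfl | rfl | rfl | rfl | rfl | rfl <;> first | exact hi | exact hk _ (by norm_num)

theorem Slot.ext_val {s s' : Slot n} (h1 : s.1.val = s'.1.val) (h2 : s.2.val = s'.2.val) : s = s' := by
  obtain ⟨l, j⟩ := s
  obtain ⟨l', j'⟩ := s'
  obtain rfl : l = l' := Fin.ext h1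
  obtain rfl : j = j' := Fin.ext h2
  rfl

theorem Bool.toNat_inj' {b b' : Bool} (h : b.toNat = b'.toNat) : b = b' := by
  cases b <;> cases b' <;> simp_all

theorem Wire.digits_injective {w w' : Wire G n t q R anc} (h : w.digits = w'.digits)
    (hw : w.digits.head? ≠ some 10) : w = w' := by
  cases w <;> cases w' <;> simp only [Wire.digits, List.cons.injEq, List.head?_cons, ne_eq,
    not_true_eq_false, OfNat.ofNat_ne_zero, OfNat.zero_ne_ofNat, OfNat.ofNat_ne_one, OfNat.one_ne_ofNat, zero_ne_one,
    one_ne_zero, false_and, true_and, Nat.reduceEqDiff, and_true] at h hw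
  case coin.coin a s r p a' s' r' p' =>
    obtain ⟨h1, h2, h3, h4, h5, h6, h7⟩ := h
    obtain rfl : a = a' := Prod.ext (Bool.toNat_inj' h1) (Fin.ext h2)
    obtain rfl : s = s' := Slot.ext_val h3 h4
    obtain rfl : r = r' := Fin.ext h5
    obtain rfl : p = p' := Prod.ext (brickNum_injective h6) (brickNum_injective h7)
    rfl
  case hcoin.hcoin v v' => rw [Fin.ext h]
  case heap.heap v v' => rw [Fin.ext h]
  case desc.desc a d a' d' =>
    obtain ⟨h1, h2, h3, h4, h5⟩ := h
    obtain rfl : a = a' := Prod.ext (Bool.toNat_inj' h1) (Fin.ext h2)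
    obtain rfl : d = d' := Prod.ext (Slot.ext_val h3 h4) (brickNum_injective h5)
    rfl
  case key.key c a i c' a' i' =>
    obtain ⟨h1, h2, h3, h4⟩ := h
    obtain rfl : a = a' := Prod.ext (Bool.toNat_inj' h2) (Fin.ext h3)
    rw [Fin.ext h1, Fin.ext h4]
  case dum.dum c a b c' a' b' =>
    obtain ⟨h1, h2, h3, h4⟩ := h
    obtain rfl : a = a' := Prod.ext (Bool.toNat_inj' h2) (Fin.ext h3)
    rw [Fin.ext h1, Bool.toNat_inj' h4]
  case msg.msg => rfl
  case fmsg.fmsg => rfl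
  case fsig.fsig j d j' d' =>
    obtain ⟨h1, h2, h3, h4⟩ := h
    obtain rfl : d = d' := Prod.ext (Slot.ext_val h2 h3) (brickNum_injective h4)
    rw [Fin.ext h1]
  case fanc.fanc i i' => rw [Fin.ext h]

/-- The place of a wire of the learner. -/
def Wire.place (w : Wire G n t q R anc) :
    Fin q × Fin n ⊕ DescIdx G n ⊕ Fin (wireBase G n t q R anc ^ 8) :=
  match w with
  | .inp c i => .inl (c, i)
  | .out d => .inr (.inl d)
  | w => .inr (.inr ⟨Nat.ofDigits (wireBase G n t q R anc) w.digits,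
      w.length_digits ▸ Nat.ofDigits_lt_base_pow_length (by rw [wireBase]; omega) w.digits_lt⟩)

theorem Wire.place_eq {w : Wire G n t q R anc} (h : w.digits.head? ≠ some 10) :
    w.place = .inr (.inr ⟨Nat.ofDigits (wireBase G n t q R anc) w.digits,
      w.length_digits ▸ Nat.ofDigits_lt_base_pow_length (by rw [wireBase]; omega) w.digits_lt⟩) := by
  cases w <;> first | rfl | exact absurd rfl h

/-- An ancilla is numbered by its eight digits in base `wireBase`; the length being fixed, the
number determines the digits and these determine the wire. Most numbers stay unused, but their count
`wireBase ^ 8` is polynomial. -/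
theorem Wire.place_injective : Function.Injective (Wire.place : Wire G n t q R anc → _) := by
  have key : ∀ w w' : Wire G n t q R anc, w.place = w'.place → w.digits.head? ≠ some 10 → w = w' := by
    intro w w' h hw
    by_cases hw' : w'.digits.head? = some 10
    · rw [Wire.place_eq hw] at h
      cases w' <;> first | (simp [Wire.digits] at hw'; done) | cases h
    · rw [Wire.place_eq hw, Wire.place_eq hw'] at h
      exact Wire.digits_injective (Nat.ofDigits_inj_of_len_eq (by rw [wireBase]; omega)
        (w.length_digits.trans w'.length_digits.symm) w.digits_lt w'.digits_lt
        (congrArg Fin.val (Sum.inr_injective (Sum.inr_injective h)))) hw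
  intro w w' h
  by_cases hw : w.digits.head? = some 10
  · by_cases hw' : w'.digits.head? = some 10
    · cases w <;> first | (simp [Wire.digits] at hw; done) | skip
      all_goals
        cases w' <;> first | (simp [Wire.digits] at hw'; done) | simp_all [Wire.place]
    · exact (key w' w h.symm hw').symm
  · exact key w w' h hw

end Numbering

/-! ### The encoding of the circuit of the learner -/

section RawLearner

variable {G : GateSet}

def rawTrue : Tr := .node .leaf .leaf

/-- The encoding of an ancilla with given data. -/
def rawAnc (M k a b c d e f g : ℕ) : Tr :=
  .node rawTrue (.node rawTrue (.unary (Nat.ofDigits M [k, a, b, c, d, e, f, g])))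

/-- The encoding of an input wire. -/
def rawInp (c i : ℕ) : Tr := .node .leaf (.node (.unary c) (.unary i))

/-- The encoding of an output wire. -/
def rawOut (d : (ℕ × ℕ) × Tr) : Tr :=
  .node rawTrue (.node .leaf (.node (.node (.unary d.1.1) (.unary d.1.2)) d.2))

variable (G) in
-- This and the following functions mirror the parts of the learner with numbers and trees in place
-- of dependent types, which brings them within reach of the closure rules of `PT`. Lists of bricks
-- enter as constants.
noncomputable def rawSetup (m : Bool) (n t R M : ℕ) : List Tr :=
  ((posRange n t).flatMap fun i => (List.range R).flatMap fun r =>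
    ((List.product (brickList G) (brickList G)).map fun p => (brickNum p.1, brickNum p.2)).flatMap fun p =>
      [rawOne (hIdx G) (rawAnc M 0 i.1.1 i.1.2 i.2.1 i.2.2 r p.1 p.2)]) ++
  ((List.range (t - 1)).flatMap fun v => [rawOne (hIdx G) (rawAnc M 1 v 0 0 0 0 0 0)]) ++
  (((posRange n t).flatMap fun i => rawNot G (rawAnc M 3 i.1.1 i.1.2 i.2.1 i.2.2 (brickNum (brick₀ G)) 0 0)) ++
  (rawNot G (rawAnc M 2 0 0 0 0 0 0 0) ++ if m = true then rawNot G (rawAnc M 6 0 0 0 0 0 0 0) else []))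

variable (G) in
noncomputable def rawWalk (n t R M : ℕ) : List Tr :=
  (posRange n t).flatMap fun i => (List.range R).flatMap fun r =>
    ((pairList G).map fun p => (brickNum p.1, brickNum p.2)).flatMap fun p =>
      rawCswap G (rawAnc M 0 i.1.1 i.1.2 i.2.1 i.2.2 r p.1 p.2)
        (rawAnc M 3 i.1.1 i.1.2 i.2.1 i.2.2 p.1 0 0) (rawAnc M 3 i.1.1 i.1.2 i.2.1 i.2.2 p.2 0 0)

variable (G) in
noncomputable def rawHeap (t M : ℕ) : List Tr :=
  (List.range (t - 1)).flatMap fun v =>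
    rawSwap G (rawAnc M 2 v 0 0 0 0 0 0) (rawAnc M 2 (2 * v + 1) 0 0 0 0 0 0) ++
    rawCswap G (rawAnc M 1 v 0 0 0 0 0 0) (rawAnc M 2 (2 * v + 1) 0 0 0 0 0 0)
      (rawAnc M 2 (2 * v + 2) 0 0 0 0 0 0)

variable (G) in
noncomputable def rawSlotSwap (M c : ℕ) (i : (ℕ × ℕ) × (ℕ × ℕ)) (b : ℕ) : List Tr :=
  rawCswap G (rawAnc M 3 i.1.1 i.1.2 i.2.1 i.2.2 b 0 0)
    (rawAnc M 4 c i.1.1 i.1.2 (i.2.1 % 2 + 2 * i.2.2) 0 0 0) (rawAnc M 5 c i.1.1 i.1.2 0 0 0 0) ++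
  rawCswap G (rawAnc M 3 i.1.1 i.1.2 i.2.1 i.2.2 b 0 0)
    (rawAnc M 4 c i.1.1 i.1.2 (i.2.1 % 2 + 2 * i.2.2 + 1) 0 0 0) (rawAnc M 5 c i.1.1 i.1.2 1 0 0 0)

noncomputable def rawPrepStep (M c : ℕ) (i : (ℕ × ℕ) × (ℕ × ℕ)) (b : Brick G) : List Tr :=
  rawSlotSwap G M c i (brickNum b) ++
    rawBrick (rawAnc M 5 c i.1.1 i.1.2 0 0 0 0) (rawAnc M 5 c i.1.1 i.1.2 1 0 0 0) b ++
    rawSlotSwap G M c i (brickNum b)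

variable (G) in
noncomputable def rawPrepSteps (M c : ℕ) (i : (ℕ × ℕ) × (ℕ × ℕ)) : List Tr :=
  (brickList G).flatMap fun b => rawPrepStep M c i b

variable (G) in
noncomputable def rawPrep (n t q M : ℕ) : List Tr :=
  (List.range q).flatMap fun c => (posRange n t).flatMap fun i => rawPrepSteps G M c i

variable (G) in
noncomputable def rawInsert (m : Bool) (n t q M : ℕ) : List Tr :=
  (List.range t).flatMap fun j => (List.range q).flatMap fun c => (List.range n).flatMap fun i =>
    rawCswap G (rawAnc M 2 (t - 1 + j) 0 0 0 0 0 0) (rawInp c i) (rawAnc M 4 c (!m).toNat j i 0 0 0)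

variable (G) in
noncomputable def rawExtract (n t M : ℕ) : List Tr :=
  (List.range t).flatMap fun j => (slotRange n).flatMap fun s =>
    ((brickList G).map fun b => (Enc.enc b, brickNum b)).flatMap fun b =>
      rawCswap G (rawAnc M 2 (t - 1 + j) 0 0 0 0 0 0) (rawAnc M 8 j s.1 s.2 b.2 0 0 0) (rawOut (s, b.1))

variable (G) in
/-- The encoding of the place of a wire of the forger, from the encoding of the wire. -/
def rawForgerInput (m : Bool) (M : ℕ) (T : Tr) : Tr :=
  if T.left.isNode = true then
    if T.right.left.isNode = true then
      rawAnc M 3 m.toNat T.right.right.left.toNat T.right.right.right.left.left.toNat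
        T.right.right.right.left.right.toNat (rawBrickNum G T.right.right.right.right) 0 0
    else rawAnc M 6 0 0 0 0 0 0 0
  else rawAnc M 4 T.right.left.toNat T.right.right.left.left.toNat T.right.right.left.right.toNat
    T.right.right.right.toNat 0 0 0

variable (G) in
def rawForgerOutput (M : ℕ) (T : Tr) : Tr :=
  if T.left.isNode = true then rawAnc M 9 T.right.toNat 0 0 0 0 0 0
  else if T.right.left.isNode = true then
    rawAnc M 8 T.right.right.left.toNat T.right.right.right.left.left.toNat
      T.right.right.right.left.right.toNat (rawBrickNum G T.right.right.right.right) 0 0 0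
  else rawAnc M 7 0 0 0 0 0 0 0

variable (G) in
def rawForgerWire (m : Bool) (M : ℕ) (T : Tr) : Tr :=
  if T.left.isNode = true then rawForgerOutput G M T.right else rawForgerInput G m M T.right

variable (G) in
def rawForgerGate (m : Bool) (M : ℕ) (T : Tr) : Tr :=
  if T.left.isNode = true then
    .node rawTrue (.node T.right.left
      (.node (rawForgerWire G m M T.right.right.left) (rawForgerWire G m M T.right.right.right)))
  else .node .leaf (.node T.right.left (rawForgerWire G m M T.right.right))

variable (G) in
noncomputable def rawLearn (m : Bool) (n t q R M : ℕ) (L : List Tr) : List Tr :=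
  rawSetup G m n t R M ++ (rawWalk G n t R M ++ (rawHeap G t M ++ (rawPrep G n t q M ++
    (rawInsert G m n t q M ++ (L.map (rawForgerGate G m M) ++ rawExtract G n t M)))))

variable {n t q R anc : ℕ}

/-- The encodings of the gates of a circuit of the learner at their places. -/
abbrev encPlaced (L : List (GateApp G (Wire G n t q R anc))) : List Tr :=
  encGates Wire.place Wire.place_injective L

theorem encPlaced_setup (m : Bool) (ht : 0 < t) : encPlaced (setupGates G n t q R anc m ht) =
    rawSetup G m n t R (wireBase G n t q R anc) := by
  rw [encPlaced, setupGates, encGates_append, List.map_eq_flatMap, encGates_flatMap, coinList,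
    List.flatMap_append, List.flatMap_map, List.flatMap_map, flatMap_product, setupList,
    List.flatMap_append, List.flatMap_map, List.flatMap_cons, encGates_append, encGates_append,
    encGates_flatMap, rawSetup]
  congr 1
  · congr 1
    · refine flatMap_posList fun i => ?_
      rw [flatMap_product]
      refine flatMap_finRange fun r => ?_
      rw [List.flatMap_map]
      rfl
    · exact flatMap_finRange fun v => rfl
  · congr 1
    · exact flatMap_posList fun i => rfl
    · congr 1
      cases m
      · rfl
      · simp only [if_true, List.flatMap_cons, List.flatMap_nil, List.append_nil]
        rfl

theorem encPlaced_walk : encPlaced (walkGates G n t q R anc) = rawWalk G n t R (wireBase G n t q R anc) := by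
  rw [encPlaced, walkGates, encGates_flatMap]
  refine flatMap_posList fun i => ?_
  rw [encGates_flatMap]
  refine flatMap_finRange fun r => ?_
  rw [encGates_flatMap, List.flatMap_map]
  refine List.flatMap_congr fun p hp => ?_
  rw [encGates_cswap (by simp) (by simp) (by simpa using mem_pairList.1 hp)]
  rfl

theorem encPlaced_heap : encPlaced (heapGates G n t q R anc) = rawHeap G t (wireBase G n t q R anc) := by
  rw [encPlaced, heapGates, encGates_flatMap]
  refine flatMap_finRange fun v => ?_
  rw [encGates_append, encGates_swap (by simp; omega), encGates_cswap (by simp) (by simp) (by simp)]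
  rfl

theorem encPlaced_slotSwap (c : Fin q × Bool × Fin t) (s : Slot n) (b : Brick G) :
    encPlaced (slotSwap R anc c s b) = rawSlotSwap G (wireBase G n t q R anc) c.1
      ((c.2.1.toNat, c.2.2.val), (s.1.val, s.2.val)) (brickNum b) := by
  rw [encPlaced, slotSwap, encGates_flatMap, List.flatMap_cons, List.flatMap_cons, List.flatMap_nil,
    List.append_nil, encGates_cswap (by simp [Wire.block]) (by simp [Wire.block]) (by simp [Wire.block]),
    encGates_cswap (by simp [Wire.block]) (by simp [Wire.block]) (by simp [Wire.block])]
  rfl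

theorem encPlaced_prep : encPlaced (prepGates G n t q R anc) = rawPrep G n t q (wireBase G n t q R anc) := by
  rw [encPlaced, prepGates, encGates_flatMap, flatMap_product]
  refine flatMap_finRange fun c => ?_
  rw [posRange, List.flatMap_assoc]
  refine flatMap_keyList fun a => ?_
  rw [encGates_flatMap, List.flatMap_map]
  refine flatMap_slots fun s => ?_
  rw [encGates_flatMap]
  refine List.flatMap_congr fun b _ => ?_
  rw [prepStep, encGates_append, encGates_append, encGates_brick, rawPrepStep]
  congr 1
  · congr 1
    exact encPlaced_slotSwap (c, a) s b
  · exact encPlaced_slotSwap (c, a) s b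

theorem encPlaced_insert (m : Bool) : encPlaced (insertGates G n t q R anc m) =
    rawInsert G m n t q (wireBase G n t q R anc) := by
  rw [encPlaced, insertGates, encGates_flatMap]
  refine flatMap_finRange fun j => ?_
  rw [encGates_flatMap, flatMap_product]
  refine flatMap_finRange fun c => flatMap_finRange fun i => ?_
  rw [encGates_cswap (by simp [Wire.leaf]) (by simp [Wire.leaf]) (by simp)]
  rfl

theorem encPlaced_extract : encPlaced (extractGates G n t q R anc) =
    rawExtract G n t (wireBase G n t q R anc) := by
  rw [encPlaced, extractGates, encGates_flatMap]
  refine flatMap_finRange fun j => ?_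
  rw [encGates_flatMap, descList, flatMap_product]
  refine flatMap_slots fun s => ?_
  rw [List.flatMap_map]
  refine List.flatMap_congr fun b _ => ?_
  rw [encGates_cswap (by simp [Wire.leaf]) (by simp [Wire.leaf]) (by simp)]
  rfl

/-- The circuit of the forger is available only through its encoding, so its wires must be renamed
on trees: the tags of the nested sums tell the kind of the wire, and its numbers are read off the
subtrees. -/
theorem enc_place_ofForger (m : Bool) (w : ForgerWire G n t q anc) :
    Enc.enc (Wire.place (Wire.ofForger m w : Wire G n t q R anc)) =
      rawForgerWire G m (wireBase G n t q R anc) (Enc.enc w) := by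
  have hb : ∀ b : Bool, (Enc.enc b).toNat = b.toNat := fun b => by cases b <;> rfl
  have hn : ∀ k : ℕ, (Tr.unary k).toNat = k := Tr.toNat_enc
  rcases w with (⟨c, a, i⟩ | ⟨⟨⟩⟩ | ⟨j, s, b⟩) | (⟨⟨⟩⟩ | ⟨j, s, b⟩) | i
  · have h1 : Enc.enc (Sum.inl (Sum.inl (c, a, i)) : ForgerWire G n t q anc) =
        .node .leaf (.node .leaf (.node (.unary c) (.node (.node (Enc.enc a.1) (.unary a.2)) (.unary i)))) := rfl
    rw [h1]
    simp only [rawForgerWire, rawForgerInput, Tr.left, Tr.right, Tr.isNode, hb, hn]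
    rfl
  · rfl
  · have h1 : Enc.enc (Sum.inl (Sum.inr (Sum.inr (j, s, b))) : ForgerWire G n t q anc) =
        .node .leaf (.node rawTrue (.node rawTrue (.node (.unary j)
          (.node (.node (.unary s.1) (.unary s.2)) (Enc.enc b))))) := rfl
    rw [h1]
    simp only [rawForgerWire, rawForgerInput, rawTrue, Tr.left, Tr.right, Tr.isNode, hn, rawBrickNum_enc]
    rfl
  · rfl
  · have h1 : Enc.enc (Sum.inr (Sum.inl (Sum.inr (j, s, b))) : ForgerWire G n t q anc) =
        .node rawTrue (.node .leaf (.node rawTrue (.node (.unary j)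
          (.node (.node (.unary s.1) (.unary s.2)) (Enc.enc b))))) := rfl
    rw [h1]
    simp only [rawForgerWire, rawForgerOutput, rawTrue, Tr.left, Tr.right, Tr.isNode, hn, rawBrickNum_enc]
    rfl
  · have h1 : Enc.enc (Sum.inr (Sum.inr i) : ForgerWire G n t q anc) =
        .node rawTrue (.node rawTrue (.unary i)) := rfl
    rw [h1]
    simp only [rawForgerWire, rawForgerOutput, rawTrue, Tr.left, Tr.right, Tr.isNode, hn]
    rfl

theorem encPlaced_forger (m : Bool) (L : List (GateApp G (ForgerWire G n t q anc))) :
    encPlaced (R := R) (relabel (Wire.ofForger m) (Wire.ofForger_injective m) L) =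
      (L.map Enc.enc).map (rawForgerGate G m (wireBase G n t q R anc)) := by
  rw [encPlaced, encGates, relabel_relabel, relabel, List.map_map, List.map_map]
  refine List.map_congr_left fun a _ => ?_
  cases a with
  | one g w =>
    refine Eq.trans ?_ (congrArg (fun T => Tr.node .leaf (Tr.node (.unary g) T)) (enc_place_ofForger m w))
    rfl
  | two g w w' h =>
    refine Eq.trans ?_ (congrArg₂ (fun T T' => Tr.node rawTrue (Tr.node (.unary g) (.node T T')))
      (enc_place_ofForger m w) (enc_place_ofForger m w'))
    rfl

theorem encPlaced_learn (m : Bool) (ht : 0 < t) (L : List (GateApp G (ForgerWire G n t q anc))) :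
    encPlaced (learnGates R m ht L) =
      rawLearn G m n t q R (wireBase G n t q R anc) (L.map Enc.enc) := by
  rw [encPlaced, learnGates, mainGates, rawLearn]
  simp only [encGates_append]
  have h1 := encPlaced_setup (G := G) (n := n) (q := q) (R := R) (anc := anc) m ht
  have h2 := encPlaced_walk (G := G) (n := n) (t := t) (q := q) (R := R) (anc := anc)
  have h3 := encPlaced_heap (G := G) (n := n) (t := t) (q := q) (R := R) (anc := anc)
  have h4 := encPlaced_prep (G := G) (n := n) (t := t) (q := q) (R := R) (anc := anc)
  have h5 := encPlaced_insert (G := G) (n := n) (t := t) (q := q) (R := R) (anc := anc) m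
  have h6 := encPlaced_forger (R := R) m L
  have h7 := encPlaced_extract (G := G) (n := n) (t := t) (q := q) (R := R) (anc := anc)
  rw [encPlaced] at h1 h2 h3 h4 h5 h6 h7
  rw [h1, h2, h3, h4, h5, h6, h7]

end RawLearner

/-! ### The learner is a polynomial-time algorithm -/

section RawLearnerPT

variable {G : GateSet} {Γ : Type} [Enc Γ]

@[fun_prop]
theorem PT.rawAnc {M k a b c d e f g : Γ → ℕ} (hM : PT M) (hk : PT k) (ha : PT a) (hb : PT b) (hc : PT c)
    (hd : PT d) (he : PT e) (hf : PT f) (hg : PT g) :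
    PT fun x => rawAnc (M x) (k x) (a x) (b x) (c x) (d x) (e x) (f x) (g x) := by
  unfold QSig.rawAnc
  simp only [Nat.ofDigits_cons, Nat.ofDigits_nil]
  fun_prop

@[fun_prop]
theorem PT.rawInp {c i : Γ → ℕ} (hc : PT c) (hi : PT i) : PT fun x => rawInp (c x) (i x) := by
  unfold QSig.rawInp; fun_prop

@[fun_prop]
theorem PT.rawOut {d : Γ → (ℕ × ℕ) × Tr} (hd : PT d) : PT fun x => rawOut (d x) := by
  unfold QSig.rawOut; fun_prop

@[fun_prop]
theorem PT.rawSetup (m : Bool) {n t R M : Γ → ℕ} (hn : PT n) (ht : PT t) (hR : PT R) (hM : PT M) :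
    PT fun x => rawSetup G m (n x) (t x) (R x) (M x) := by
  unfold QSig.rawSetup
  cases m <;> simp only [if_true, Bool.false_eq_true, if_false] <;> fun_prop

@[fun_prop]
theorem PT.rawWalk {n t R M : Γ → ℕ} (hn : PT n) (ht : PT t) (hR : PT R) (hM : PT M) :
    PT fun x => rawWalk G (n x) (t x) (R x) (M x) := by
  unfold QSig.rawWalk; fun_prop

@[fun_prop]
theorem PT.rawHeap {t M : Γ → ℕ} (ht : PT t) (hM : PT M) : PT fun x => rawHeap G (t x) (M x) := by
  unfold QSig.rawHeap; fun_prop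

@[fun_prop]
theorem PT.rawSlotSwap {M c : Γ → ℕ} {i : Γ → (ℕ × ℕ) × (ℕ × ℕ)} (b : ℕ) (hM : PT M) (hc : PT c) (hi : PT i) :
    PT fun x => rawSlotSwap G (M x) (c x) (i x) b := by
  unfold QSig.rawSlotSwap; fun_prop

@[fun_prop]
theorem PT.rawPrepSteps {M c : Γ → ℕ} {i : Γ → (ℕ × ℕ) × (ℕ × ℕ)} (hM : PT M) (hc : PT c) (hi : PT i) :
    PT fun x => rawPrepSteps G (M x) (c x) (i x) := by
  unfold QSig.rawPrepSteps
  refine PT.flatMap_const _ fun b => ?_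
  unfold QSig.rawPrepStep
  fun_prop

@[fun_prop]
theorem PT.rawPrep {n t q M : Γ → ℕ} (hn : PT n) (ht : PT t) (hq : PT q) (hM : PT M) :
    PT fun x => rawPrep G (n x) (t x) (q x) (M x) := by
  unfold QSig.rawPrep; fun_prop

@[fun_prop]
theorem PT.rawInsert (m : Bool) {n t q M : Γ → ℕ} (hn : PT n) (ht : PT t) (hq : PT q) (hM : PT M) :
    PT fun x => rawInsert G m (n x) (t x) (q x) (M x) := by
  unfold QSig.rawInsert; fun_prop

@[fun_prop]
theorem PT.rawExtract {n t M : Γ → ℕ} (hn : PT n) (ht : PT t) (hM : PT M) :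
    PT fun x => rawExtract G (n x) (t x) (M x) := by
  unfold QSig.rawExtract; fun_prop

@[fun_prop]
theorem PT.rawBrickNum {T : Γ → Tr} (hT : PT T) : PT fun x => rawBrickNum G (T x) := by
  unfold QSig.rawBrickNum; fun_prop

@[fun_prop]
theorem PT.rawForgerInput (m : Bool) {M : Γ → ℕ} {T : Γ → Tr} (hM : PT M) (hT : PT T) :
    PT fun x => rawForgerInput G m (M x) (T x) := by
  unfold QSig.rawForgerInput; fun_prop

@[fun_prop]
theorem PT.rawForgerOutput {M : Γ → ℕ} {T : Γ → Tr} (hM : PT M) (hT : PT T) :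
    PT fun x => rawForgerOutput G (M x) (T x) := by
  unfold QSig.rawForgerOutput; fun_prop

@[fun_prop]
theorem PT.rawForgerWire (m : Bool) {M : Γ → ℕ} {T : Γ → Tr} (hM : PT M) (hT : PT T) :
    PT fun x => rawForgerWire G m (M x) (T x) := by
  unfold QSig.rawForgerWire; fun_prop

@[fun_prop]
theorem PT.rawForgerGate (m : Bool) {M : Γ → ℕ} {T : Γ → Tr} (hM : PT M) (hT : PT T) :
    PT fun x => rawForgerGate G m (M x) (T x) := by
  unfold QSig.rawForgerGate rawTrue; fun_prop

@[fun_prop]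
theorem PT.rawLearn (m : Bool) {n t q R M : Γ → ℕ} {L : Γ → List Tr} (hn : PT n) (ht : PT t) (hq : PT q)
    (hR : PT R) (hM : PT M) (hL : PT L) :
    PT fun x => rawLearn G m (n x) (t x) (q x) (R x) (M x) (L x) := by
  unfold QSig.rawLearn; fun_prop

@[fun_prop]
theorem PT.wireBase {n t q R anc : Γ → ℕ} (hn : PT n) (ht : PT t) (hq : PT q) (hR : PT R) (ha : PT anc) :
    PT fun x => wireBase G (n x) (t x) (q x) (R x) (anc x) := by
  unfold QSig.wireBase; fun_prop

end RawLearnerPT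

/-! ### The learner as a uniform family, and the marginals of the forger. -/

section LearnerQPT

variable {G : GateSet} {t q : ℕ[X]}

/-- The learner that is built from a forger: it prepares a public key, puts the unknown state at a random
place of the half that belongs to the message `!m`, and runs the forger on the signature of `m`. -/
noncomputable def learner (R : ℕ[X]) (m : Bool) (ht : ∀ n, 0 < t.eval n) (A : Forger₂ G t q) :
    QPT G (fun n => Fin (q.eval n) × Fin n) (fun n => DescIdx G n) where
  anc n := wireBase G n (t.eval n) (q.eval n) (R.eval n) (A.anc n) ^ 8
  circ n := relabel Wire.place Wire.place_injective (learnGates (R.eval n) m (ht n) (A.circ n))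
  uniform := by
    rw [polyTime_iff_pt]
    have hA : PT fun n => Enc.enc (A.anc n, A.circ n) := polyTime_iff_pt.1 A.uniform
    -- The ancilla count and the encoded gates are both recovered from the tree that the uniformity
    -- program of the forger writes.
    have hanc : PT fun n => A.anc n := by
      have h1 : PT fun n => (Enc.enc (A.anc n, A.circ n)).left.toNat := by fun_prop
      have h2 : ∀ n, (Enc.enc (A.anc n, A.circ n)).left.toNat = A.anc n := fun n => Tr.toNat_enc _
      simpa only [h2] using h1
    have hcirc : PT fun n => (A.circ n).map Enc.enc := by
      have h1 : PT fun n => (Enc.enc (A.anc n, A.circ n)).right.toList := by fun_prop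
      have h2 : ∀ n, (Enc.enc (A.anc n, A.circ n)).right.toList = (A.circ n).map Enc.enc :=
        fun n => Tr.toList_enc _
      simpa only [h2] using h1
    have hpow : ∀ k : ℕ, k ^ 8 = k * k * k * k * k * k * k * k := fun k => by ring
    have h : PT fun n => (wireBase G n (t.eval n) (q.eval n) (R.eval n) (A.anc n) ^ 8,
        rawLearn G m n (t.eval n) (q.eval n) (R.eval n)
          (wireBase G n (t.eval n) (q.eval n) (R.eval n) (A.anc n)) ((A.circ n).map Enc.enc)) := by
      simp only [hpow]
      fun_prop
    refine PT.of_enc (β := Tr) (PT.enc.comp h) fun n => ?_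
    change Tr.node _ _ = Tr.node _ _
    congr 1
    rw [← encPlaced_learn m (ht n) (A.circ n)]
    exact enc_list_map _

theorem learner_outProb (R : ℕ[X]) (m : Bool) (ht : ∀ n, 0 < t.eval n) (A : Forger₂ G t q) (n : ℕ)
    (C : Ckt G n) (y : DescIdx G n → Bool) :
    (learner R m ht A).outProb n (copies (q.eval n) C.ket) y =
      ∑ x : Wire G n (t.eval n) (q.eval n) (R.eval n) (A.anc n) → Bool,
        if (fun d => x (.out d)) = y then
          ‖act (learnGates (R.eval n) m (ht n) (A.circ n)) (learnInit m C) x‖ ^ 2 else 0 := by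
  rw [QPT.outProb_eq]
  refine Eq.trans ?_ ((sum_relabel_learnGates Wire.place_injective (fun _ _ => rfl) (fun _ => rfl) m C
    (learnGates (R.eval n) m (ht n) (A.circ n)) y).trans ?_)
  · congr
  · congr

/-- A marginal of the output distribution. The message that the forger claims is summed over,
because the learner ignores it. -/
theorem forger_outProb_block (A : Forger₂ G t q) (n : ℕ) (sk : SecretKey G n (t.eval n)) (m : Bool)
    (j : Fin (t.eval n)) (y : DescIdx G n → Bool) :
    blockProb (q := q.eval n) (A.circ n) sk m j y =
      ∑ m' : Bool, ∑ σ : SigIdx G n (t.eval n) → Bool,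
        if (fun d => σ (j, d)) = y then A.outProb n (forgerInput sk m) (Sum.elim (fun _ => m') σ) else 0 := by
  have h1 : ∀ (m' : Bool) (σ : SigIdx G n (t.eval n) → Bool)
      (z : ForgerWire G n (t.eval n) (q.eval n) (A.anc n) → Bool),
      (fun o => z (.inr (.inl o))) = Sum.elim (fun _ => m') σ ↔
        m' = z (.inr (.inl (.inl ()))) ∧ σ = fun i => z (.inr (.inl (.inr i))) := by
    intro m' σ z
    constructor
    · intro h
      exact ⟨(congrFun h (.inl ())).symm, funext fun i => (congrFun h (.inr i)).symm⟩
    · rintro ⟨rfl, rfl⟩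
      funext o
      rcases o with ⟨⟨⟩⟩ | i <;> rfl
  have h2 : ∀ (m' : Bool) (σ : SigIdx G n (t.eval n) → Bool),
      A.outProb n (forgerInput sk m) (Sum.elim (fun _ => m') σ) =
        ∑ z : ForgerWire G n (t.eval n) (q.eval n) (A.anc n) → Bool,
          if m' = z (.inr (.inl (.inl ()))) then
            if σ = fun i => z (.inr (.inl (.inr i))) then
              ‖act (A.circ n) (withAncillas (forgerInput sk m)) z‖ ^ 2 else 0
          else 0 := by
    intro m' σ
    rw [QPT.outProb_eq]
    refine Finset.sum_congr rfl fun z _ => ?_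
    rw [← ite_and]
    exact if_congr (h1 m' σ z) (by congr) rfl
  have h3 : ∀ m' : Bool, (∑ σ : SigIdx G n (t.eval n) → Bool, if (fun d => σ (j, d)) = y then
      A.outProb n (forgerInput sk m) (Sum.elim (fun _ => m') σ) else 0) =
      ∑ z : ForgerWire G n (t.eval n) (q.eval n) (A.anc n) → Bool,
        if m' = z (.inr (.inl (.inl ()))) then
          if (fun d => z (.inr (.inl (.inr (j, d))))) = y then
            ‖act (A.circ n) (withAncillas (forgerInput sk m)) z‖ ^ 2 else 0
        else 0 := by
    intro m'
    simp only [h2]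
    have h4 : ∀ (P : Prop) [Decidable P]
        (f : (ForgerWire G n (t.eval n) (q.eval n) (A.anc n) → Bool) → ℝ),
        (if P then ∑ z, f z else 0) = ∑ z, if P then f z else 0 := by
      intro P _ f
      split_ifs <;> simp
    simp only [h4]
    rw [Finset.sum_comm]
    refine Finset.sum_congr rfl fun z _ => ?_
    by_cases hm : m' = z (.inr (.inl (.inl ())))
    · simp only [if_pos hm]
      rw [Finset.sum_eq_single_of_mem (fun i => z (.inr (.inl (.inr i)))) (Finset.mem_univ _)]
      · rw [if_pos rfl]
      · intro σ _ hσ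
        rw [if_neg hσ, ite_self]
    · simp [hm]
  simp only [h3]
  rw [Finset.sum_comm, blockProb]
  refine Finset.sum_congr rfl fun z _ => ?_
  rw [Finset.sum_ite_eq' ]
  simp

end LearnerQPT

/-! ### One-time security -/

section Security

variable {G : GateSet} {t q : ℕ[X]}

theorem card_slot_le (n : ℕ) : Fintype.card (Slot n) ≤ n ^ 3 := by
  have h1 : depth n ≤ n ^ 2 := Nat.pow_le_pow_left (Nat.log_le_self 2 n) 2
  rw [Fintype.card_sigma]
  calc ∑ l : Fin (depth n), Fintype.card (Fin ((n - l.val % 2) / 2)) ≤ ∑ _l : Fin (depth n), n :=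
        Finset.sum_le_sum fun l _ => by rw [Fintype.card_fin]; omega
    _ = depth n * n := by simp
    _ ≤ n ^ 2 * n := Nat.mul_le_mul_right _ h1
    _ = n ^ 3 := by ring

/-- A sufficient number of rounds of the coin walk. -/
theorem exists_rounds (G : GateSet) (t : ℕ[X]) : ∃ R : ℕ[X], ∀ n : ℕ,
    (Fintype.card ((Bool × Fin (t.eval n)) × Slot n) : ℝ) *
      (1 - Fintype.card (Brick G) * (Fintype.card (Brick G × Brick G → Bool) : ℝ)⁻¹) ^ R.eval n ≤ 1 / 2 ∧
    (1 - Fintype.card (Brick G) * (Fintype.card (Brick G × Brick G → Bool) : ℝ)⁻¹) ^ R.eval n ≤ 1 := by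
  obtain ⟨γ, hγ⟩ : ∃ γ : ℝ,
      Fintype.card (Brick G) * (Fintype.card (Brick G × Brick G → Bool) : ℝ)⁻¹ = γ := ⟨_, rfl⟩
  have hB : 0 < Fintype.card (Brick G) := Fintype.card_pos
  have h0 : 0 < γ := by
    rw [← hγ]
    have : 0 < Fintype.card (Brick G × Brick G → Bool) := Fintype.card_pos
    positivity
  -- With `b` bricks there are `2 ^ b²` coin outcomes, and `b ≤ 2 ^ b²`.
  have h1 : γ ≤ 1 := by
    rw [← hγ, ← div_eq_mul_inv]
    refine div_le_one_of_le₀ ?_ (Nat.cast_nonneg _)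
    have : Fintype.card (Brick G) ≤ 2 ^ (Fintype.card (Brick G) * Fintype.card (Brick G)) :=
      (Nat.le_mul_of_pos_left _ hB).trans Nat.lt_two_pow_self.le
    rw [Fintype.card_fun, Fintype.card_prod, Fintype.card_bool]
    exact_mod_cast this
  obtain ⟨c, hc⟩ := exists_nat_ge (1 / γ)
  have hc' : 1 ≤ c * γ := by rwa [div_le_iff₀ h0] at hc
  -- There are at most `2 t n³` slots in the key, and `(1 - γ)^R ≤ 1/(1 + R γ)`. With `c γ ≥ 1` this
  -- choice makes `R γ` at least `4 t n³`, twice the number of slots. The constant `c` depends on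
  -- the gate set only.
  refine ⟨4 * C c * t * X ^ 3, fun n => ?_⟩
  rw [hγ]
  refine ⟨?_, pow_le_one₀ (by linarith) (by linarith)⟩
  have hR : (((4 * C c * t * X ^ 3 : ℕ[X]).eval n : ℕ) : ℝ) = 4 * c * (t.eval n : ℕ) * (n : ℝ) ^ 3 := by
    simp
  have hN : (Fintype.card ((Bool × Fin (t.eval n)) × Slot n) : ℝ) ≤ 2 * (t.eval n : ℕ) * (n : ℝ) ^ 3 := by
    simp only [Fintype.card_prod, Fintype.card_bool, Fintype.card_fin]
    exact_mod_cast Nat.mul_le_mul_left _ (card_slot_le n)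
  have hp := pow_le_inv_one_add_mul h0.le h1 ((4 * C c * t * X ^ 3 : ℕ[X]).eval n)
  rw [hR] at hp
  have hpow : 0 ≤ (1 - γ) ^ (4 * C c * t * X ^ 3 : ℕ[X]).eval n := pow_nonneg (by linarith) _
  have hTn : 0 ≤ ((t.eval n : ℕ) : ℝ) * (n : ℝ) ^ 3 := by positivity
  have hle : 2 * (2 * ((t.eval n : ℕ) : ℝ) * (n : ℝ) ^ 3) ≤
      1 + 4 * c * (t.eval n : ℕ) * (n : ℝ) ^ 3 * γ := by
    nlinarith [mul_le_mul_of_nonneg_left hc' hTn]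
  have h2 := mul_le_mul_of_nonneg_right hN hpow
  have h3 := mul_le_mul_of_nonneg_left hle hpow
  linarith

/-- The indicator of success of a learner. -/
noncomputable def learnGain (e : ℝ) {n : ℕ} (C : Ckt G n) (y : DescIdx G n → Bool) : ℝ :=
  match decode y with
    | some D => if e ≤ C.overlap D then 1 else 0
    | none => 0

theorem learnGain_nonneg (e : ℝ) {n : ℕ} (C : Ckt G n) (y : DescIdx G n → Bool) :
    0 ≤ learnGain e C y := by
  rw [learnGain]
  split
  · split_ifs <;> norm_num
  · exact le_rfl

/-- Overlaps below `e` are absorbed by the first term, and the others are at most `1`, which the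
indicator pays for. -/
theorem overlapOpt_le_add_learnGain {e : ℝ} (he : 0 ≤ e) {n : ℕ} (C : Ckt G n)
    (y : DescIdx G n → Bool) : overlapOpt C (decode y) ≤ e + learnGain e C y := by
  rw [learnGain]
  generalize (decode y : Option (Ckt G n)) = o
  rcases o with _ | D
  · simpa [overlapOpt] using he
  · simp only [overlapOpt]
    split_ifs with h
    · linarith [overlap_le_one C D]
    · linarith

theorem le_learnProb (ε : ℕ → ℝ) {R : ℕ[X]} (m : Bool) (ht : ∀ n, 0 < t.eval n) (A : Forger₂ G t q) {n : ℕ}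
    (hδ : (Fintype.card ((Bool × Fin (t.eval n)) × Slot n) : ℝ) *
      (1 - Fintype.card (Brick G) * (Fintype.card (Brick G × Brick G → Bool) : ℝ)⁻¹) ^ R.eval n ≤ 1 / 2)
    (hδ1 : (1 - Fintype.card (Brick G) * (Fintype.card (Brick G × Brick G → Bool) : ℝ)⁻¹) ^ R.eval n ≤ 1) :
    (1 / (4 * (t.eval n : ℕ))) * ∑ j, (avg fun sk : SecretKey G n (t.eval n) =>
      ∑ y, blockProb (q := q.eval n) (A.circ n) sk m j y * learnGain (ε n) (sk (!m, j)) y) ≤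
    learnProb ε q (learner R m ht A) n := by
  classical
  have h := learn_ge (R := R.eval n) (q := q.eval n) m (ht n) hδ hδ1 (A.circ n) (learnGain (ε n))
    (learnGain_nonneg _)
  refine (le_of_eq ?_).trans (h.trans (le_of_eq ?_))
  · congr
  · rw [learnProb]
    simp only [learner_outProb]
    congr

theorem forger_outProb_sum (A : Forger₂ G t q) (n : ℕ) (sk : SecretKey G n (t.eval n)) (m : Bool) :
    ∑ m' : Bool, ∑ σ : SigIdx G n (t.eval n) → Bool,
      A.outProb n (forgerInput sk m) (Sum.elim (fun _ => m') σ) = 1 := by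
  rw [← (Equiv.funUnique Unit Bool).sum_comp]
  have h := sum_sum_elim fun (y : Unit → Bool) (z : SigIdx G n (t.eval n) → Bool) =>
    A.outProb n (forgerInput sk m) (Sum.elim y z)
  simp only [Sum.elim_comp_inl_inr] at h
  have h2 := (QPT.sum_outProb A n (forgerInput sk m)).trans (sum_norm_sq_forgerInput sk m)
  refine Eq.trans ?_ (h.symm.trans ?_)
  · rfl
  · rw [← h2]

/-- Linearity of expectation: only the marginals of the single blocks of the forged signature
matter, however correlated the blocks are. -/
theorem forger_expectation (A : Forger₂ G t q) (n : ℕ) (sk : SecretKey G n (t.eval n)) (m : Bool) (e : ℝ)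
    (g : Fin (t.eval n) → (DescIdx G n → Bool) → ℝ) :
    ∑ m' : Bool, ∑ σ : SigIdx G n (t.eval n) → Bool,
      A.outProb n (forgerInput sk m) (Sum.elim (fun _ => m') σ) * ∑ j, (e + g j fun i => σ (j, i)) =
    (t.eval n : ℕ) * e + ∑ j, ∑ y, blockProb (q := q.eval n) (A.circ n) sk m j y * g j y := by
  have h1 : ∀ j, ∑ y, blockProb (q := q.eval n) (A.circ n) sk m j y * g j y =
      ∑ m' : Bool, ∑ σ : SigIdx G n (t.eval n) → Bool,
        A.outProb n (forgerInput sk m) (Sum.elim (fun _ => m') σ) * g j fun i => σ (j, i) := by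
    intro j
    simp only [forger_outProb_block, Finset.sum_mul]
    rw [Finset.sum_comm]
    refine Finset.sum_congr rfl fun m' _ => ?_
    rw [Finset.sum_comm]
    refine Finset.sum_congr rfl fun σ _ => ?_
    simp only [ite_mul, zero_mul]
    simp
  simp only [h1, Finset.sum_add_distrib, mul_add]
  congr 1
  · simp only [← Finset.sum_mul]
    rw [forger_outProb_sum]
    simp
  · simp only [Finset.mul_sum]
    rw [Finset.sum_comm (s := (Finset.univ : Finset (Fin (t.eval n))))]
    exact Finset.sum_congr rfl fun m' _ => Finset.sum_comm

/-- The first stage is removed by bounding its probability of each message by `1` and summing over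
both. Only the answer `!m` can win, and Markov's bound on verification is enlarged to all answers so
that expectations can be taken. -/
theorem forgeProb_le (ε : ℕ → ℝ) {k : ℕ → ℝ} (A₁ : Forger₁ G t q) (A₂ : Forger₂ G t q) {n : ℕ}
    (hk : 0 < k n) (hε : 0 ≤ ε n) :
    forgeProb t q k A₁ A₂ n ≤ ∑ m : Bool, (1 / k n) * ((t.eval n : ℕ) * ε n +
      ∑ j, avg fun sk : SecretKey G n (t.eval n) =>
        ∑ y, blockProb (q := q.eval n) (A₂.circ n) sk m j y * learnGain (ε n) (sk (!m, j)) y) := by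
  have hA : ∀ (sk : SecretKey G n (t.eval n)) (m : Bool),
      A₁.outProb n (copies (q.eval n) (pkGen sk)) (fun _ => m) ≤ 1 := by
    intro sk m
    rw [← sum_norm_sq_copies (q.eval n) (sum_norm_sq_pkGen sk), ← QPT.sum_outProb A₁]
    exact Finset.single_le_sum (f := A₁.outProb n (copies (q.eval n) (pkGen sk)))
      (fun y _ => QPT.outProb_nonneg _ _ _ _) (Finset.mem_univ _)
  have hV : ∀ (sk : SecretKey G n (t.eval n)) (m m' : Bool) (σ : SigIdx G n (t.eval n) → Bool),
      (if m' ≠ m then verProb (Device.ideal G) (k n) (pkDensity sk) m' σ else 0) ≤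
        (1 / k n) * ∑ j, (ε n + learnGain (ε n) (sk (!m, j)) fun i => σ (j, i)) := by
    intro sk m m' σ
    have h1 := Finset.sum_le_sum fun (j : Fin (t.eval n)) (_ : j ∈ Finset.univ) =>
      overlapOpt_le_add_learnGain hε (sk (!m, j)) fun i => σ (j, i)
    have hk' : 0 ≤ 1 / k n := by positivity
    split_ifs with h
    · obtain rfl : m' = !m := by cases m <;> cases m' <;> simp_all
      exact (verProb_ideal_le hk sk _ σ).trans (mul_le_mul_of_nonneg_left h1 hk')
    · exact mul_nonneg hk' (Finset.sum_nonneg fun j _ => add_nonneg hε (learnGain_nonneg _ _ _))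
  have hE : ∀ (sk : SecretKey G n (t.eval n)) (m : Bool),
      A₁.outProb n (copies (q.eval n) (pkGen sk)) (fun _ => m) *
        ∑ m' : Bool, ∑ σ' : SigIdx G n (t.eval n) → Bool,
          A₂.outProb n (forgerInput sk m) (Sum.elim (fun _ => m') σ') *
            (if m' ≠ m then verProb (Device.ideal G) (k n) (pkDensity sk) m' σ' else 0) ≤
      (1 / k n) * ((t.eval n : ℕ) * ε n + ∑ j, ∑ y,
        blockProb (q := q.eval n) (A₂.circ n) sk m j y * learnGain (ε n) (sk (!m, j)) y) := by
    intro sk m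
    have h1 : ∑ m' : Bool, ∑ σ' : SigIdx G n (t.eval n) → Bool,
          A₂.outProb n (forgerInput sk m) (Sum.elim (fun _ => m') σ') *
            (if m' ≠ m then verProb (Device.ideal G) (k n) (pkDensity sk) m' σ' else 0) ≤
        (1 / k n) * ((t.eval n : ℕ) * ε n + ∑ j, ∑ y,
          blockProb (q := q.eval n) (A₂.circ n) sk m j y * learnGain (ε n) (sk (!m, j)) y) := by
      rw [← forger_expectation A₂ n sk m (ε n) fun j => learnGain (ε n) (sk (!m, j)), Finset.mul_sum]
      refine Finset.sum_le_sum fun m' _ => ?_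
      rw [Finset.mul_sum]
      refine Finset.sum_le_sum fun σ _ => ?_
      rw [mul_left_comm]
      exact mul_le_mul_of_nonneg_left (hV sk m m' σ) (QPT.outProb_nonneg _ _ _ _)
    have h2 : 0 ≤ (1 / k n) * ((t.eval n : ℕ) * ε n + ∑ j, ∑ y,
        blockProb (q := q.eval n) (A₂.circ n) sk m j y * learnGain (ε n) (sk (!m, j)) y) := by
      have h3 : 0 ≤ ∑ j, ∑ y,
          blockProb (q := q.eval n) (A₂.circ n) sk m j y * learnGain (ε n) (sk (!m, j)) y :=
        Finset.sum_nonneg fun j _ => Finset.sum_nonneg fun y _ =>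
          mul_nonneg (blockProb_nonneg _ _ _ _ _) (learnGain_nonneg _ _ _)
      positivity
    calc _ ≤ A₁.outProb n (copies (q.eval n) (pkGen sk)) (fun _ => m) * _ :=
          mul_le_mul_of_nonneg_left h1 (QPT.outProb_nonneg _ _ _ _)
      _ ≤ _ := mul_le_of_le_one_left h2 (hA sk m)
  refine (avg_mono fun sk => Finset.sum_le_sum fun m _ => hE sk m).trans (le_of_eq ?_)
  rw [avg_sum]
  refine Finset.sum_congr rfl fun m _ => ?_
  rw [avg_const_mul, avg_add, avg_const, avg_sum]

theorem verProb_ideal_nonneg {n t : ℕ} (k : ℝ) (sk : SecretKey G n t) (m : Bool)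
    (σ : SigIdx G n t → Bool) : 0 ≤ verProb (Device.ideal G) k (pkDensity sk) m σ := by
  have hN : (Device.ideal G).IsNoiseModel := Device.ideal_isNoiseModel
  obtain ⟨D, hD⟩ : ∃ D : Fin t → Option (Ckt G n), ∀ j,
      decode (G := G) (n := n) (fun i => σ (j, i)) = D j := ⟨_, fun j => rfl⟩
  have hst : ∀ a, IsState ((Device.ideal G).prepare (sk a).layers) := fun a => hN.isState_prepare _
  rw [← noisyPKGen_ideal]
  refine le_of_le_of_eq (Finset.sum_nonneg fun x _ => ?_) (verProb_prod
    (ρ := fun a => (Device.ideal G).prepare (sk a).layers) (D := D) hN k hst m σ hD).symm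
  split_ifs
  · exact Finset.prod_nonneg fun a _ => (isState_blockMap hN m D a (hst a)).diag_nonneg _
  · exact le_rfl

theorem forgeProb_nonneg {k : ℕ → ℝ} (A₁ : Forger₁ G t q) (A₂ : Forger₂ G t q) (n : ℕ) :
    0 ≤ forgeProb t q k A₁ A₂ n := by
  refine avg_nonneg fun sk => Finset.sum_nonneg fun m _ => mul_nonneg (QPT.outProb_nonneg _ _ _ _)
    (Finset.sum_nonneg fun m' _ => Finset.sum_nonneg fun σ _ => mul_nonneg (QPT.outProb_nonneg _ _ _ _) ?_)
  split_ifs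
  · exact verProb_ideal_nonneg _ _ _ _
  · exact le_rfl

/-- The threshold is a noticeable fraction of the number of circuits. -/
theorem le_threshold {p t : ℕ[X]} (hp : ∀ x : ℕ, 1 ≤ x → 0 < p.eval x) {n : ℕ} (hn : 2 ≤ n)
    (ht : 2 * n * p.eval (2 * n ^ 3) ^ 2 ≤ t.eval n) :
    ((t.eval n : ℕ) : ℝ) ≤ 2 * (p.eval (2 * n ^ 3) : ℕ) * threshold p t n := by
  have hd := one_le_depth hn
  have h0 : 0 < p.eval (n * (2 * depth n)) := hp _ (Nat.mul_pos (by omega) (by omega))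
  -- Since `log² n ≤ n²`, the argument of `p` is replaced by the polynomial `2 n³`.
  have hle : p.eval (n * (2 * depth n)) ≤ p.eval (2 * n ^ 3) := by
    have h1 : depth n ≤ n ^ 2 := Nat.pow_le_pow_left (Nat.log_le_self 2 n) 2
    refine eval_le_eval p ?_
    calc n * (2 * depth n) ≤ n * (2 * n ^ 2) := by gcongr
      _ = 2 * n ^ 3 := by ring
  rw [threshold]
  generalize p.eval (n * (2 * depth n)) = a at *
  generalize p.eval (2 * n ^ 3) = b at *
  generalize t.eval n = T at *
  have ha : (0 : ℝ) < a := by exact_mod_cast h0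
  have hab : (a : ℝ) ≤ b := by exact_mod_cast hle
  have hb : (0 : ℝ) < b := ha.trans_le hab
  have hT : 2 * n * (b : ℝ) ^ 2 ≤ T := by exact_mod_cast ht
  have hn' : (0 : ℝ) < n := by exact_mod_cast (by omega : 0 < n)
  have hT0 : (0 : ℝ) < T := lt_of_lt_of_le (by positivity) hT
  -- `T ≥ 2 n b²` gives `n/(2T) ≤ 1/(4b²)`. The deviation then takes at most half of `1/b`, and a
  -- `1/(2b)` fraction of the blocks remains required.
  have hs : Real.sqrt (n / (2 * (T : ℝ))) ≤ 1 / (2 * b) := by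
    refine Real.sqrt_le_iff.2 ⟨by positivity, ?_⟩
    rw [div_pow, one_pow, div_le_div_iff₀ (by positivity) (by positivity)]
    nlinarith
  have h1 : 1 / (b : ℝ) ≤ 1 / a := one_div_le_one_div_of_le ha hab
  have h2 : 1 / (2 * (b : ℝ)) = 1 / b / 2 := by ring
  calc (T : ℝ) = 2 * b * ((1 / b - 1 / (2 * b)) * T) := by field_simp; norm_num
    _ ≤ 2 * b * ((1 / a - Real.sqrt (n / (2 * (T : ℝ)))) * T) := by gcongr

theorem oneTimeSecure_of_noLearning {p : ℕ[X]} (hp : ∀ x : ℕ, 1 ≤ x → 0 < p.eval x) {ε : ℕ → ℝ}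
    (hε : Negligible ε) (hlearn : NoLearning G ε) (ht : ∀ n, 0 < t.eval n)
    (htp : ∀ n, 2 * n * p.eval (2 * n ^ 3) ^ 2 ≤ t.eval n) : OneTimeSecure G t (threshold p t) := by
  intro q A₁ A₂
  obtain ⟨R, hR⟩ := exists_rounds G t
  -- For each message `t/k ≤ 2 p(2n³)` multiplies `ε + 4 ε`; two messages make the factor `20`.
  have hneg := hε.polynomial_mul ((20 * p.comp (2 * X ^ 3)).map (Nat.castRingHom ℝ))
  refine Negligible.mono hneg ?_
  filter_upwards [Filter.eventually_ge_atTop 2, hlearn q (learner R true ht A₂),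
    hlearn q (learner R false ht A₂)] with n hn h₁ h₂
  refine ⟨forgeProb_nonneg _ _ _, ?_⟩
  have hL : ∀ m, (1 / (4 * (t.eval n : ℕ))) * ∑ j, (avg fun sk : SecretKey G n (t.eval n) =>
      ∑ y, blockProb (q := q.eval n) (A₂.circ n) sk m j y * learnGain (ε n) (sk (!m, j)) y) ≤ ε n := by
    intro m
    have h := le_learnProb (q := q) ε m ht A₂ (hR n).1 (hR n).2
    cases m
    · exact h.trans h₂
    · exact h.trans h₁
  have hT : (0 : ℝ) < ((t.eval n : ℕ) : ℝ) := by exact_mod_cast ht n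
  have hS : ∀ m, 0 ≤ ∑ j, (avg fun sk : SecretKey G n (t.eval n) =>
      ∑ y, blockProb (q := q.eval n) (A₂.circ n) sk m j y * learnGain (ε n) (sk (!m, j)) y) := fun m =>
    Finset.sum_nonneg fun j _ => avg_nonneg fun sk => Finset.sum_nonneg fun y _ =>
      mul_nonneg (blockProb_nonneg _ _ _ _ _) (learnGain_nonneg _ _ _)
  -- A negligible function may take negative values. Here nonnegativity follows because `ε n` bounds
  -- a nonnegative quantity.
  have hε0 : 0 ≤ ε n := le_trans (mul_nonneg (by positivity) (hS true)) (hL true)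
  have hth := le_threshold hp hn (htp n)
  have hb : (0 : ℝ) ≤ ((p.eval (2 * n ^ 3) : ℕ) : ℝ) := Nat.cast_nonneg _
  have hk : 0 < threshold p t n := by
    by_contra h
    have := mul_nonneg (mul_nonneg zero_le_two hb) (neg_nonneg.2 (not_lt.1 h))
    linarith
  have hev : ((20 * p.comp (2 * X ^ 3)).map (Nat.castRingHom ℝ)).eval (n : ℝ) =
      20 * ((p.eval (2 * n ^ 3) : ℕ) : ℝ) := by
    rw [eval_natCast_map]
    simp [eval_comp]
  rw [hev]
  refine (forgeProb_le ε A₁ A₂ hk hε0).trans ?_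
  have hm : ∀ m : Bool, (1 / threshold p t n) * ((t.eval n : ℕ) * ε n +
      ∑ j, avg fun sk : SecretKey G n (t.eval n) => ∑ y,
        blockProb (q := q.eval n) (A₂.circ n) sk m j y * learnGain (ε n) (sk (!m, j)) y) ≤
      10 * ((p.eval (2 * n ^ 3) : ℕ) : ℝ) * ε n := by
    intro m
    have h := hL m
    generalize (∑ j, avg fun sk : SecretKey G n (t.eval n) => ∑ y,
      blockProb (q := q.eval n) (A₂.circ n) sk m j y * learnGain (ε n) (sk (!m, j)) y) = S at *
    rw [one_div, inv_mul_le_iff₀ (by positivity)] at h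
    rw [one_div, inv_mul_le_iff₀ hk]
    nlinarith [mul_le_mul_of_nonneg_right hth hε0]
  rw [Fintype.sum_bool]
  linarith [hm true, hm false]

end Security

end QSig

theorem lemma5p6 (G : QSig.GateSet) (N : QSig.Device G) (hN : N.IsNoiseModel)
    (p : Polynomial ℕ) (hp : ∀ x : ℕ, 1 ≤ x → 0 < p.eval x) (hfid : N.FidelityAtLeast p)
    (ε : ℕ → ℝ) (hε : QSig.Negligible ε) (hlearn : QSig.NoLearning G ε) :
    ∃ t₀ : Polynomial ℕ, ∀ t : Polynomial ℕ, (∀ n : ℕ, t₀.eval n ≤ t.eval n) →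
      QSig.Correct G t (QSig.threshold p t) ∧
      QSig.OneTimeSecure G t (QSig.threshold p t) ∧
      QSig.NoiseRobust N t (QSig.threshold p t) := by
  -- The first summand makes the square root at most half of the fidelity bound; the `1` makes `t`
  -- positive at every `n`, including `0`.
  refine ⟨2 * Polynomial.X * (p.comp (2 * Polynomial.X ^ 3)) ^ 2 + 1, fun t h => ?_⟩
  have h' : ∀ n, 2 * n * p.eval (2 * n ^ 3) ^ 2 + 1 ≤ t.eval n := by
    intro n
    simpa [Polynomial.eval_comp] using h n
  have ht : ∀ n, 0 < t.eval n := fun n => lt_of_lt_of_le (Nat.succ_pos _) (h' n)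
  exact ⟨QSig.correct_of_pos hp ht,
    QSig.oneTimeSecure_of_noLearning hp hε hlearn ht fun n => (Nat.le_succ _).trans (h' n),
    QSig.noiseRobust_of_fidelityAtLeast hN hfid ht⟩
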